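/- **Burnside categories.** A correspondence from a finite set $X$ to a finite set $Y$ is a finite set $A$ with maps $s\colon A\to X$, $t\colon A\to Y$; a signed correspondence has in addition a map $\sigma\colon A\to\{\pm1\}$. Composition is $B\circ A=B\times_YA=\{(b,a): t(a)=s(b)\}$ with $s(b,a)=s(a)$, $t(b,a)=t(b)$, $\sigma(b,a)=\sigma(b)\sigma(a)$. Let $\mathscr B$ (resp. $\mathscr B_\sigma$) be the bicategory of finite sets, (signed) correspondences, and bijections commuting with $s,t$ (and $\sigma$); let $\mathscr B_\xi$ be the bicategory of finite free $\mathbb Z_2$-sets ($\mathbb Z_2=\{1,\xi\}$), $\mathbb Z_2$-equivariant correspondences and equivariant bijections. The identity of $X$ is $(X,\mathrm{Id},\mathrm{Id})$, with sign $+1$. Let $\mathscr C$ be a small category and $F\colon\mathscr C\to\mathscr B_\bullet$, $\bullet\in\{\varnothing,\sigma,\xi\}$, a strictly unitary 2-functor: a pseudofunctor with $F(\mathrm{Id}_u)=\mathrm{Id}_{F(u)}$ and identity unit constraints. It has structure bijections $F(g)\circ F(f)\to F(g\circ f)$. **Homotopy coherent diagrams.** Let $G$ be the trivial group if $\bullet\in\{\varnothing,\sigma\}$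 and $G=\mathbb Z_2$ if $\bullet=\xi$. A homotopy coherent diagram $D$ of pointed $G$-spaces on $\mathscr C$ assigns to each object $u$ a pointed $G$-space $D(u)$, and to each sequence $u_0\xrightarrow{f_1}\cdots\xrightarrow{f_m}u_m$, $m\ge1$, a continuous $G$-map $D(f_m,\dots,f_1)\colon[0,1]^{m-1}\times D(u_0)\to D(u_m)$, pointed for every parameter, such that $D(\mathrm{Id}_u)=\mathrm{Id}_{D(u)}$ and $D(f_m,\dots,f_1)(t_1,\dots,t_{m-1})$ equals $$\begin{cases}D(f_m,\dots,f_2)(t_2,\dots,t_{m-1}),&f_1=\mathrm{Id},\ m\ge2,\\ D(f_m,\dots,\widehat{f_i},\dots,f_1)(t_1,\dots,t_{i-1}t_i,\dots,t_{m-1}),&f_i=\mathrm{Id},\ 1<i<m,\\ D(f_{m-1},\dots,f_1)(t_1,\dots,t_{m-2}),&f_m=\mathrm{Id},\ m\ge2,\\ D(f_m,\dots,f_{i+1})(t_{i+1},\dots,t_{m-1})\circ D(f_i,\dots,f_1)(t_1,\dots,t_{i-1}),&t_i=0,\\ D(f_m,\dots,f_{i+1}\circ f_i,\dots,f_1)(t_1,\dots,\widehat{t_i},\dots,t_{m-1}),&t_i=1.\end{cases}$$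 A weak equivalence $D\to D'$ is a homotopy coherent diagram on $\{0\to1\}\times\mathscr C$ that restricts to $D$ over $0$ and to $D'$ over $1$ and whose map $D(u)\to D'(u)$ at $(0\to1,\mathrm{Id}_u)$ induces, for every $u$ and every subgroup $H\le G$, isomorphisms on all homotopy groups of $H$-fixed points. **Box maps.** Let $S^k=[0,1]^k/\partial$ (a point plus a disjoint base point if $k=0$). For a (signed) correspondence $(A,s,t,\sigma)$ from $X$ to $Y$ (with $\sigma=+1$ in the unsigned cases) let $E_k(s)$ be the space of families $e=(B_a)_{a\in A}$ of boxes $B_a=\prod_i[\alpha_i,\beta_i]\subset[0,1]^k$, $\alpha_i<\beta_i$, such that $B_a,B_{a'}$ have disjoint interiors whenever $a\ne a'$ and $s(a)=s(a')$. The box map $\Phi(e,A)\colon\bigvee_{X}S^k\to\bigvee_{Y}S^k$ sends the interior of $B_a$, viewed in the summand $s(a)$, to the summand $t(a)$ by the standard affine identification $B_a\cong[0,1]^k$, followed by the reflection $\mathfrak r$ in the first coordinate if $\sigma(a)=-1$, and all other points to the base point. (For $k=0$ there is no first coordinate and signs $-1$ are not allowed.) For $e\in E_k(s_A)$ and $e'\in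 E_k(s_B)$ let $e'\circ e\in E_k(s_{B\circ A})$ have as $(b,a)$-box the sub-box of $B_a\cong[0,1]^k$ corresponding to $B_b$ (to $\mathfrak r(B_b)$ if $\sigma(a)=-1$), so that $\Phi(e'\circ e,B\circ A)=\Phi(e',B)\circ\Phi(e,A)$. **Spatial refinements.** A *$k$-dimensional spatial refinement* of $F$ is a homotopy coherent diagram $\widetilde F_k$ of pointed $G$-spaces on $\mathscr C$ with $\widetilde F_k(u)=\bigvee_{x\in F(u)}S^k$ ($\xi$ permuting the summands if $\bullet=\xi$), all of whose maps are box maps refining $F(f_m\circ\cdots\circ f_1)$, coherently: there are continuous maps $e_{f_m,\dots,f_1}\colon[0,1]^{m-1}\to E_k(s_{F(f_m\circ\cdots\circ f_1)})$ with $\widetilde F_k(f_m,\dots,f_1)(t)=\Phi(e_{f_m,\dots,f_1}(t),F(f_m\circ\cdots\circ f_1))$ that satisfy the same compatibility conditions as above (with $e_{\mathrm{Id}_u}$ consisting of full cubes, and with the labels of $e'\circ e$ identified by the structure bijections of $F$) and, if $\bullet=\xi$, are invariant: $B_{\xi a}=B_a$ as subsets of $[0,1]^k$. **Proposition.** Let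 $\mathscr C$ be a small category in which every sequence of composable non-identity morphisms has length at most $n$, and let $F\colon\mathscr C\to\mathscr B_\bullet$, $\bullet\in\{\varnothing,\sigma,\xi\}$, be a strictly unitary 2-functor. 1. If $k\ge n$, there is a $k$-dimensional spatial refinement of $F$ ($\xi$-equivariant if $\bullet=\xi$). 2. If $k\ge n+1$, then for any two $k$-dimensional spatial refinements of $F$ there is a weak equivalence from the first to the second ($\xi$-equivariant if $\bullet=\xi$). 3. For every $k\ge 0$ and every $k$-dimensional spatial refinement $\widetilde F_k$ of $F$, the diagram obtained by taking reduced suspensions of all $\widetilde F_k(u)$ and all $\widetilde F_k(f_m,\dots,f_1)$ is a $(k+1)$-dimensional spatial refinement of $F$, under the canonical homeomorphisms $\Sigma\bigvee_{x}S^k\cong\bigvee_xS^{k+1}$ that append the suspension coordinate as last coordinate. -/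

import Mathlib

open CategoryTheory
open scoped unitInterval

universe w v u

namespace LittleBoxes

noncomputable section

/-! ### Correspondences -/

/-- A correspondence `X ← A → Y` with finite `A`. -/
structure Corr (X Y : Type w) : Type (w + 1) where
  carrier : Type w
  finite : Finite carrier
  src : carrier → X
  tgt : carrier → Y

namespace Corr

variable {X Y Z W : Type w}

/-- A morphism of correspondences: a bijection commuting with source and target. -/
@[ext]
structure Hom (A B : Corr X Y) : Type w where
  equiv : A.carrier ≃ B.carrier
  src_eq : ∀ a, B.src (equiv a) = A.src a
  tgt_eq : ∀ a, B.tgt (equiv a) = A.tgt a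

/-- The identity correspondence `(X, Id, Id)`. -/
def one (X : Type w) (hX : Finite X) : Corr X X := ⟨X, hX, id, id⟩

/-- The composite `B ∘ A`, the fibre product `{(b, a) | t(a) = s(b)}`. -/
def comp (A : Corr X Y) (B : Corr Y Z) : Corr X Z where
  carrier := {p : B.carrier × A.carrier // A.tgt p.2 = B.src p.1}
  finite := by
    have := A.finite
    have := B.finite
    infer_instance
  src p := A.src p.1.2
  tgt p := B.tgt p.1.1

namespace Hom

def refl (A : Corr X Y) : Hom A A := ⟨Equiv.refl _, fun _ => rfl, fun _ => rfl⟩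

def trans {A B D : Corr X Y} (f : Hom A B) (g : Hom B D) : Hom A D :=
  ⟨f.equiv.trans g.equiv, fun a => (g.src_eq _).trans (f.src_eq a),
    fun a => (g.tgt_eq _).trans (f.tgt_eq a)⟩

def symm {A B : Corr X Y} (f : Hom A B) : Hom B A :=
  ⟨f.equiv.symm, fun b => by rw [← f.src_eq, Equiv.apply_symm_apply],
    fun b => by rw [← f.tgt_eq, Equiv.apply_symm_apply]⟩

theorem trans_symm {A B : Corr X Y} (f : Hom A B) : f.trans f.symm = refl A :=
  Hom.ext (Equiv.self_trans_symm f.equiv)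

theorem symm_trans {A B : Corr X Y} (f : Hom A B) : f.symm.trans f = refl B :=
  Hom.ext (Equiv.symm_trans_self f.equiv)

/-- Horizontal composition `(b, a) ↦ (g b, f a)`. -/
def hcomp {A A' : Corr X Y} {B B' : Corr Y Z} (f : Hom A A') (g : Hom B B') :
    Hom (A.comp B) (A'.comp B') where
  equiv :=
    { toFun := fun p => ⟨(g.equiv p.1.1, f.equiv p.1.2), by
        rw [f.tgt_eq, g.src_eq]; exact p.2⟩
      invFun := fun p => ⟨(g.equiv.symm p.1.1, f.equiv.symm p.1.2), by
        have h1 := f.symm.tgt_eq p.1.2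
        have h2 := g.symm.src_eq p.1.1
        exact h1.trans (p.2.trans h2.symm)⟩
      left_inv := fun p => Subtype.ext
        (Prod.ext (g.equiv.symm_apply_apply _) (f.equiv.symm_apply_apply _))
      right_inv := fun p => Subtype.ext
        (Prod.ext (g.equiv.apply_symm_apply _) (f.equiv.apply_symm_apply _)) }
  src_eq p := f.src_eq p.1.2
  tgt_eq p := g.tgt_eq p.1.1

/-- The associator `(c, (b, a)) ↦ ((c, b), a)`. -/
def assoc (A : Corr X Y) (B : Corr Y Z) (D : Corr Z W) :
    Hom ((A.comp B).comp D) (A.comp (B.comp D)) where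
  equiv :=
    { toFun := fun p => ⟨(⟨(p.1.1, p.1.2.1.1), p.2⟩, p.1.2.1.2), p.1.2.2⟩
      invFun := fun p => ⟨(p.1.1.1.1, ⟨(p.1.1.1.2, p.1.2), p.2⟩), p.1.1.2⟩
      left_inv := fun _ => rfl
      right_inv := fun _ => rfl }
  src_eq _ := rfl
  tgt_eq _ := rfl

/-- The unitor `(a, x) ↦ a`. -/
def precompOne (hX : Finite X) (A : Corr X Y) : Hom ((one X hX).comp A) A where
  equiv :=
    { toFun := fun p => p.1.1
      invFun := fun a => ⟨(a, A.src a), rfl⟩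
      left_inv := fun p => Subtype.ext (Prod.ext rfl p.2.symm)
      right_inv := fun _ => rfl }
  src_eq p := p.2.symm
  tgt_eq _ := rfl

/-- The unitor `(y, a) ↦ a`. -/
def postcompOne (hY : Finite Y) (A : Corr X Y) : Hom (A.comp (one Y hY)) A where
  equiv :=
    { toFun := fun p => p.1.2
      invFun := fun a => ⟨(A.tgt a, a), rfl⟩
      left_inv := fun p => Subtype.ext (Prod.ext p.2 rfl)
      right_inv := fun _ => rfl }
  src_eq _ := rfl
  tgt_eq p := p.2

end Hom

end Corr

/-! ### The Burnside category -/

/-- Objects of the Burnside category: finite sets. -/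
structure Burn : Type (w + 1) where
  carrier : Type w
  finite : Finite carrier

instance Burn.catStruct : CategoryStruct.{w + 1} Burn.{w} where
  Hom X Y := Corr X.carrier Y.carrier
  id X := Corr.one X.carrier X.finite
  comp A B := A.comp B

instance Burn.homCat (X Y : Burn.{w}) : Category.{w} (X ⟶ Y) where
  Hom A B := Corr.Hom A B
  id A := Corr.Hom.refl A
  comp f g := Corr.Hom.trans f g

def Burn.mkIso {X Y : Burn.{w}} {A B : X ⟶ Y} (f : Corr.Hom A B) : A ≅ B :=
  ⟨f, f.symm, f.trans_symm, f.symm_trans⟩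

instance Burn.bicategory : Bicategory.{w, w + 1} Burn.{w} where
  homCategory X Y := Burn.homCat X Y
  whiskerLeft A _ _ g := Corr.Hom.hcomp (Corr.Hom.refl A) g
  whiskerRight f B := Corr.Hom.hcomp f (Corr.Hom.refl B)
  associator A B D := Burn.mkIso (Corr.Hom.assoc A B D)
  leftUnitor {X _} A := Burn.mkIso (Corr.Hom.precompOne X.finite A)
  rightUnitor {_ Y} A := Burn.mkIso (Corr.Hom.postcompOne Y.finite A)
  whiskerLeft_id _ _ := rfl
  whiskerLeft_comp _ _ _ _ _ _ := rfl
  id_whiskerLeft η := Corr.Hom.ext (Equiv.ext fun p =>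
    Subtype.ext (Prod.ext rfl (p.2.trans (η.src_eq _).symm)))
  comp_whiskerLeft _ _ _ _ _ := rfl
  id_whiskerRight _ _ := rfl
  comp_whiskerRight _ _ _ := rfl
  whiskerRight_id η := Corr.Hom.ext (Equiv.ext fun p =>
    Subtype.ext (Prod.ext (p.2.symm.trans (η.tgt_eq _).symm) rfl))
  whiskerRight_comp _ _ _ := rfl
  whisker_assoc _ _ _ _ _ := rfl
  whisker_exchange _ _ := rfl
  pentagon _ _ _ _ := rfl
  triangle _ _ := Corr.Hom.ext (Equiv.ext fun _ => rfl)

/-! ### The signed Burnside category -/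

/-- A signed correspondence: a correspondence with a sign map to `{+1, -1} = ℤˣ`. -/
structure SignedCorr (X Y : Type w) : Type (w + 1) extends Corr X Y where
  sgn : carrier → ℤˣ

namespace SignedCorr

variable {X Y Z W : Type w}

/-- A map of signed correspondences: a map of correspondences preserving signs. -/
@[ext]
structure Hom (A B : SignedCorr X Y) : Type w extends Corr.Hom A.toCorr B.toCorr where
  sgn_eq : ∀ a, B.sgn (equiv a) = A.sgn a

theorem Hom.ext_toHom {A B : SignedCorr X Y} {f g : Hom A B} (h : f.toHom = g.toHom) : f = g := by
  cases f; cases g; cases h; rfl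

/-- The identity signed correspondence, with all signs `+1`. -/
def one (X : Type w) (hX : Finite X) : SignedCorr X X := ⟨Corr.one X hX, fun _ => 1⟩

/-- Composition, with `σ(b, a) = σ(b) σ(a)`. -/
def comp (A : SignedCorr X Y) (B : SignedCorr Y Z) : SignedCorr X Z :=
  ⟨A.toCorr.comp B.toCorr, fun p => B.sgn p.1.1 * A.sgn p.1.2⟩

namespace Hom

def refl (A : SignedCorr X Y) : Hom A A := ⟨Corr.Hom.refl _, fun _ => rfl⟩

def trans {A B D : SignedCorr X Y} (f : Hom A B) (g : Hom B D) : Hom A D :=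
  ⟨f.toHom.trans g.toHom, fun a => (g.sgn_eq _).trans (f.sgn_eq a)⟩

def symm {A B : SignedCorr X Y} (f : Hom A B) : Hom B A :=
  ⟨f.toHom.symm, fun b => by
    rw [← f.sgn_eq]; exact congrArg B.sgn (f.equiv.apply_symm_apply b)⟩

theorem trans_symm {A B : SignedCorr X Y} (f : Hom A B) : f.trans f.symm = refl A :=
  ext_toHom f.toHom.trans_symm

theorem symm_trans {A B : SignedCorr X Y} (f : Hom A B) : f.symm.trans f = refl B :=
  ext_toHom f.toHom.symm_trans

def hcomp {A A' : SignedCorr X Y} {B B' : SignedCorr Y Z} (f : Hom A A') (g : Hom B B') :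
    Hom (A.comp B) (A'.comp B') :=
  ⟨f.toHom.hcomp g.toHom, fun p => congrArg₂ (· * ·) (g.sgn_eq p.1.1) (f.sgn_eq p.1.2)⟩

def assoc (A : SignedCorr X Y) (B : SignedCorr Y Z) (D : SignedCorr Z W) :
    Hom ((A.comp B).comp D) (A.comp (B.comp D)) :=
  ⟨Corr.Hom.assoc _ _ _, fun _ => mul_assoc _ _ _⟩

def precompOne (hX : Finite X) (A : SignedCorr X Y) : Hom ((one X hX).comp A) A :=
  ⟨Corr.Hom.precompOne hX _, fun _ => (mul_one _).symm⟩

def postcompOne (hY : Finite Y) (A : SignedCorr X Y) : Hom (A.comp (one Y hY)) A :=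
  ⟨Corr.Hom.postcompOne hY _, fun _ => (one_mul _).symm⟩

end Hom

end SignedCorr

/-- Objects of the signed Burnside category: finite sets. -/
structure SignedBurn : Type (w + 1) where
  carrier : Type w
  finite : Finite carrier

instance SignedBurn.catStruct : CategoryStruct.{w + 1} SignedBurn.{w} where
  Hom X Y := SignedCorr X.carrier Y.carrier
  id X := SignedCorr.one X.carrier X.finite
  comp A B := A.comp B

instance SignedBurn.homCat (X Y : SignedBurn.{w}) : Category.{w} (X ⟶ Y) where
  Hom A B := SignedCorr.Hom A B
  id A := SignedCorr.Hom.refl A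
  comp f g := SignedCorr.Hom.trans f g

def SignedBurn.mkIso {X Y : SignedBurn.{w}} {A B : X ⟶ Y} (f : SignedCorr.Hom A B) : A ≅ B :=
  ⟨f, f.symm, f.trans_symm, f.symm_trans⟩

instance SignedBurn.bicategory : Bicategory.{w, w + 1} SignedBurn.{w} where
  homCategory X Y := SignedBurn.homCat X Y
  whiskerLeft A _ _ g := SignedCorr.Hom.hcomp (SignedCorr.Hom.refl A) g
  whiskerRight f B := SignedCorr.Hom.hcomp f (SignedCorr.Hom.refl B)
  associator A B D := SignedBurn.mkIso (SignedCorr.Hom.assoc A B D)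
  leftUnitor {X _} A := SignedBurn.mkIso (SignedCorr.Hom.precompOne X.finite A)
  rightUnitor {_ Y} A := SignedBurn.mkIso (SignedCorr.Hom.postcompOne Y.finite A)
  whiskerLeft_id _ _ := rfl
  whiskerLeft_comp _ _ _ _ _ _ := rfl
  id_whiskerLeft η := SignedCorr.Hom.ext (Equiv.ext fun p =>
    Subtype.ext (Prod.ext rfl (p.2.trans (η.src_eq _).symm)))
  comp_whiskerLeft _ _ _ _ _ := rfl
  id_whiskerRight _ _ := rfl
  comp_whiskerRight _ _ _ := rfl
  whiskerRight_id η := SignedCorr.Hom.ext (Equiv.ext fun p =>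
    Subtype.ext (Prod.ext (p.2.symm.trans (η.tgt_eq _).symm) rfl))
  whiskerRight_comp _ _ _ := rfl
  whisker_assoc _ _ _ _ _ := rfl
  whisker_exchange _ _ := rfl
  pentagon _ _ _ _ := rfl
  triangle _ _ := SignedCorr.Hom.ext (Equiv.ext fun _ => rfl)

/-! ### The equivariant Burnside category

The group `ℤ/2 = {1, ξ}` is `ℤˣ`, with `ξ = -1`. -/

/-- Objects of the equivariant Burnside category: finite free `ℤ/2`-sets. -/
structure EquivBurn : Type (w + 1) where
  carrier : Type w
  finite : Finite carrier
  action : MulAction ℤˣ carrier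
  free : ∀ x : carrier, (-1 : ℤˣ) • x ≠ x

attribute [instance] EquivBurn.action

/-- A `ℤ/2`-equivariant correspondence. -/
structure EquivCorr (X Y : EquivBurn.{w}) : Type (w + 1) extends
    Corr X.carrier Y.carrier where
  action : MulAction ℤˣ carrier
  src_smul : ∀ (g : ℤˣ) (a : carrier), src (g • a) = g • src a
  tgt_smul : ∀ (g : ℤˣ) (a : carrier), tgt (g • a) = g • tgt a

attribute [instance] EquivCorr.action

namespace EquivCorr

variable {X Y Z W : EquivBurn.{w}}

/-- A `ℤ/2`-equivariant bijection of correspondences. -/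
@[ext]
structure Hom (A B : EquivCorr X Y) : Type w extends Corr.Hom A.toCorr B.toCorr where
  smul_eq : ∀ (g : ℤˣ) a, equiv (g • a) = g • equiv a

theorem Hom.ext_toHom {A B : EquivCorr X Y} {f g : Hom A B} (h : f.toHom = g.toHom) : f = g := by
  cases f; cases g; cases h; rfl

def one (X : EquivBurn.{w}) : EquivCorr X X :=
  ⟨Corr.one X.carrier X.finite, X.action, fun _ _ => rfl, fun _ _ => rfl⟩

/-- Composition, with the diagonal action on the fibre product. -/
def comp (A : EquivCorr X Y) (B : EquivCorr Y Z) : EquivCorr X Z where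
  toCorr := A.toCorr.comp B.toCorr
  action :=
    { smul := fun g p => ⟨(g • p.1.1, g • p.1.2), by
        rw [A.tgt_smul, B.src_smul]; exact congrArg (g • ·) p.2⟩
      one_smul := fun p => Subtype.ext (Prod.ext (one_smul _ _) (one_smul _ _))
      mul_smul := fun g h p => Subtype.ext (Prod.ext (mul_smul _ _ _) (mul_smul _ _ _)) }
  src_smul g p := A.src_smul g p.1.2
  tgt_smul g p := B.tgt_smul g p.1.1

namespace Hom

def refl (A : EquivCorr X Y) : Hom A A := ⟨Corr.Hom.refl _, fun _ _ => rfl⟩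

def trans {A B D : EquivCorr X Y} (f : Hom A B) (g : Hom B D) : Hom A D :=
  ⟨f.toHom.trans g.toHom, fun h a =>
    (congrArg g.equiv (f.smul_eq h a)).trans (g.smul_eq h (f.equiv a))⟩

def symm {A B : EquivCorr X Y} (f : Hom A B) : Hom B A :=
  ⟨f.toHom.symm, fun h b => f.equiv.injective <| by
    have e := f.smul_eq h (f.equiv.symm b)
    rw [Equiv.apply_symm_apply] at e
    exact (f.equiv.apply_symm_apply (h • b)).trans e.symm⟩

theorem trans_symm {A B : EquivCorr X Y} (f : Hom A B) : f.trans f.symm = refl A :=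
  ext_toHom f.toHom.trans_symm

theorem symm_trans {A B : EquivCorr X Y} (f : Hom A B) : f.symm.trans f = refl B :=
  ext_toHom f.toHom.symm_trans

def hcomp {A A' : EquivCorr X Y} {B B' : EquivCorr Y Z} (f : Hom A A') (g : Hom B B') :
    Hom (A.comp B) (A'.comp B') :=
  ⟨f.toHom.hcomp g.toHom, fun h p =>
    Subtype.ext (Prod.ext (g.smul_eq h p.1.1) (f.smul_eq h p.1.2))⟩

def assoc (A : EquivCorr X Y) (B : EquivCorr Y Z) (D : EquivCorr Z W) :
    Hom ((A.comp B).comp D) (A.comp (B.comp D)) :=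
  ⟨Corr.Hom.assoc _ _ _, fun _ _ => rfl⟩

def precompOne (A : EquivCorr X Y) : Hom ((one X).comp A) A :=
  ⟨Corr.Hom.precompOne X.finite _, fun _ _ => rfl⟩

def postcompOne (A : EquivCorr X Y) : Hom (A.comp (one Y)) A :=
  ⟨Corr.Hom.postcompOne Y.finite _, fun _ _ => rfl⟩

end Hom

end EquivCorr

instance EquivBurn.catStruct : CategoryStruct.{w + 1} EquivBurn.{w} where
  Hom X Y := EquivCorr X Y
  id X := EquivCorr.one X
  comp A B := A.comp B

instance EquivBurn.homCat (X Y : EquivBurn.{w}) : Category.{w} (X ⟶ Y) where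
  Hom A B := EquivCorr.Hom A B
  id A := EquivCorr.Hom.refl A
  comp f g := EquivCorr.Hom.trans f g

def EquivBurn.mkIso {X Y : EquivBurn.{w}} {A B : X ⟶ Y} (f : EquivCorr.Hom A B) : A ≅ B :=
  ⟨f, f.symm, f.trans_symm, f.symm_trans⟩

instance EquivBurn.bicategory : Bicategory.{w, w + 1} EquivBurn.{w} where
  homCategory X Y := EquivBurn.homCat X Y
  whiskerLeft A _ _ g := EquivCorr.Hom.hcomp (EquivCorr.Hom.refl A) g
  whiskerRight f B := EquivCorr.Hom.hcomp f (EquivCorr.Hom.refl B)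
  associator A B D := EquivBurn.mkIso (EquivCorr.Hom.assoc A B D)
  leftUnitor A := EquivBurn.mkIso (EquivCorr.Hom.precompOne A)
  rightUnitor A := EquivBurn.mkIso (EquivCorr.Hom.postcompOne A)
  whiskerLeft_id _ _ := rfl
  whiskerLeft_comp _ _ _ _ _ _ := rfl
  id_whiskerLeft η := EquivCorr.Hom.ext (Equiv.ext fun p =>
    Subtype.ext (Prod.ext rfl (p.2.trans (η.src_eq _).symm)))
  comp_whiskerLeft _ _ _ _ _ := rfl
  id_whiskerRight _ _ := rfl
  comp_whiskerRight _ _ _ := rfl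
  whiskerRight_id η := EquivCorr.Hom.ext (Equiv.ext fun p =>
    Subtype.ext (Prod.ext (p.2.symm.trans (η.tgt_eq _).symm) rfl))
  whiskerRight_comp _ _ _ := rfl
  whisker_assoc _ _ _ _ _ := rfl
  whisker_exchange _ _ := rfl
  pentagon _ _ _ _ := rfl
  triangle _ _ := EquivCorr.Hom.ext (Equiv.ext fun _ => rfl)

/-! ### Pointed spaces with a group action -/

/-- A pointed topological space with an action of the discrete group `G` by pointed continuous
maps. For the trivial group this is just a pointed space. -/
structure GSpace (G : Type) [Group G] : Type (w + 1) where
  carrier : Type w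
  [top : TopologicalSpace carrier]
  [action : MulAction G carrier]
  pt : carrier
  continuous_smul : ∀ g : G, Continuous fun x : carrier => g • x
  smul_pt : ∀ g : G, g • pt = pt

attribute [instance] GSpace.top GSpace.action

instance (G : Type) [Group G] : CoeSort (GSpace.{w} G) (Type w) := ⟨GSpace.carrier⟩

/-- Pointed equivariant continuous maps. -/
structure GMap {G : Type} [Group G] (X Y : GSpace.{w} G) where
  toFun : X → Y
  continuous_toFun : Continuous toFun
  map_pt : toFun X.pt = Y.pt
  map_smul : ∀ (g : G) (x : X), toFun (g • x) = g • toFun x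

/-- The map induced on `n`-th homotopy groups by a continuous map. -/
def homotopyGroupMap {X Y : Type w} [TopologicalSpace X] [TopologicalSpace Y] (f : C(X, Y))
    (n : ℕ) (x : X) : HomotopyGroup (Fin n) X x → HomotopyGroup (Fin n) Y (f x) :=
  Quotient.map (fun γ => ⟨f.comp γ.1, fun y hy => congrArg f (γ.2 y hy)⟩)
    fun _ _ h => ContinuousMap.HomotopicRel.comp_continuousMap h f

/-- A continuous map inducing isomorphisms on all homotopy groups (bijections for `n = 0`)
at all basepoints; the first condition only matters for empty `X`. -/
def IsWeakEquiv {X Y : Type w} [TopologicalSpace X] [TopologicalSpace Y] (f : C(X, Y)) : Prop :=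
  (Nonempty Y → Nonempty X) ∧
    ∀ (n : ℕ) (x : X), Function.Bijective (homotopyGroupMap f n x)

/-- The points fixed by a subgroup. -/
def GSpace.Fixed {G : Type} [Group G] (X : GSpace.{w} G) (H : Subgroup G) : Set X :=
  {x | ∀ g ∈ H, g • x = x}

/-- The map `X^H → Y^H` induced by an equivariant map. -/
def GMap.fixed {G : Type} [Group G] {X Y : GSpace.{w} G} (f : GMap X Y) (H : Subgroup G) :
    C(X.Fixed H, Y.Fixed H) where
  toFun x := ⟨f.toFun x.1, fun g hg => by rw [← f.map_smul, x.2 g hg]⟩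
  continuous_toFun := (f.continuous_toFun.comp continuous_subtype_val).subtype_mk _

/-- Weak equivalence of `G`-spaces: a weak equivalence on `H`-fixed points for every subgroup. -/
def GMap.IsWeakEquiv {G : Type} [Group G] {X Y : GSpace.{w} G} (f : GMap X Y) : Prop :=
  ∀ H : Subgroup G, LittleBoxes.IsWeakEquiv (f.fixed H)

/-! ### Homotopy coherent diagrams

A sequence `x₀ → x₁ → ⋯ → xₙ` of composable morphisms is a `Quiver.Path x₀ xₙ` of length `n`;
`q.comp r` is the concatenation `q` followed by `r`. The parameters `(t₁, …, tₙ₋₁)` are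
`t 0, …, t (n - 2)`; to avoid reindexing, the compatibility conditions evaluate everything at
an infinite sequence `t : ℕ → [0,1]`, of which only the first `n - 1` entries are used. -/

/-- `(t₁, …, tₘ)`. -/
def cut {m : ℕ} (t : ℕ → I) : Fin m → I := fun j => t j

/-- `(tₘ₊₁, tₘ₊₂, …)`. -/
def shift (m : ℕ) (t : ℕ → I) : ℕ → I := fun j => t (m + j)

/-- `(t₁, …, tₘ, tₘ₊₂, …)`. -/
def dropAt (m : ℕ) (t : ℕ → I) : ℕ → I := fun j => if j < m then t j else t (j + 1)

/-- `(t₁, …, tₘ₋₁, tₘ · tₘ₊₁, tₘ₊₂, …)`. -/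
def merge (m : ℕ) (t : ℕ → I) : ℕ → I := fun j =>
  if j + 1 < m then t j else if j + 1 = m then t j * t (j + 1) else t (j + 1)

/-- A homotopy coherent diagram of pointed `G`-spaces with values `X u` on objects.
The empty sequence is assigned the identity. -/
structure HCDiagram (C : Type u) [Category.{v} C] {G : Type} [Group G]
    (X : C → GSpace.{w} G) where
  map : ∀ {x y : C} (p : Quiver.Path x y), (Fin (p.length - 1) → I) → X x → X y
  continuous_map : ∀ {x y : C} (p : Quiver.Path x y),
    Continuous fun a : (Fin (p.length - 1) → I) × X x => map p a.1 a.2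
  map_pt : ∀ {x y : C} (p : Quiver.Path x y) t, map p t (X x).pt = (X y).pt
  map_smul : ∀ {x y : C} (p : Quiver.Path x y) t (g : G) (a : X x),
    map p t (g • a) = g • map p t a
  map_nil : ∀ (x : C) t (a : X x), map (Quiver.Path.nil : Quiver.Path x x) t a = a
  /-- the first morphism is an identity -/
  map_id_first : ∀ {x y : C} (r : Quiver.Path x y) (t : ℕ → I) (a : X x),
    map ((𝟙 x : x ⟶ x).toPath.comp r) (cut t) a = map r (cut (shift 1 t)) a
  /-- an intermediate morphism is an identity -/
  map_id_mid : ∀ {x y z : C} (q : Quiver.Path x y) (r : Quiver.Path y z), 0 < q.length →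
    0 < r.length → ∀ (t : ℕ → I) (a : X x),
    map ((q.cons (𝟙 y)).comp r) (cut t) a = map (q.comp r) (cut (merge q.length t)) a
  /-- the last morphism is an identity -/
  map_id_last : ∀ {x y : C} (q : Quiver.Path x y) (t : ℕ → I) (a : X x),
    map (q.cons (𝟙 y)) (cut t) a = map q (cut t) a
  /-- `tᵢ = 0` -/
  map_zero : ∀ {x y z : C} (q : Quiver.Path x y) (r : Quiver.Path y z), 0 < q.length →
    0 < r.length → ∀ t : ℕ → I, t (q.length - 1) = 0 → ∀ a : X x,
    map (q.comp r) (cut t) a = map r (cut (shift q.length t)) (map q (cut t) a)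
  /-- `tᵢ = 1` -/
  map_one : ∀ {x y z y' : C} (q : Quiver.Path x y) (f : y ⟶ z) (g : z ⟶ y')
    {z' : C} (r : Quiver.Path y' z') (t : ℕ → I), t q.length = 1 → ∀ a : X x,
    map (((q.cons f).cons g).comp r) (cut t) a =
      map ((q.cons (f ≫ g)).comp r) (cut (dropAt q.length t)) a

section Diagrams

variable {C : Type u} [Category.{v} C] {G : Type} [Group G]

/-- The objects of a diagram on `{0 → 1} × C` that is `X` over `0` and `Y` over `1`. -/
def joinObj (X Y : C → GSpace.{w} G) : Fin 2 × C → GSpace.{w} G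
  | (0, x) => X x
  | (1, x) => Y x

/-- A natural transformation of homotopy coherent diagrams: a homotopy coherent diagram on
`{0 → 1} × C` restricting to the source over `0` and to the target over `1`. -/
structure HCTrans {X Y : C → GSpace.{w} G} (D : HCDiagram C X) (E : HCDiagram C Y) where
  diag : HCDiagram (Fin 2 × C) (joinObj X Y)
  restrict_zero : ∀ {x y : C} (p : Quiver.Path x y) (t : ℕ → I) (a : X x),
    diag.map ((Prod.sectR (0 : Fin 2) C).toPrefunctor.mapPath p) (cut t) a = D.map p (cut t) a
  restrict_one : ∀ {x y : C} (p : Quiver.Path x y) (t : ℕ → I) (a : Y x),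
    diag.map ((Prod.sectR (1 : Fin 2) C).toPrefunctor.mapPath p) (cut t) a = E.map p (cut t) a

/-- The morphism `(0, x) → (1, x)` of `{0 → 1} × C`. -/
def crossing (x : C) : ((0, x) : Fin 2 × C) ⟶ (1, x) :=
  Prod.mkHom (homOfLE (by decide)) (𝟙 x)

/-- The value of a natural transformation at an object. -/
def HCTrans.component {X Y : C → GSpace.{w} G} {D : HCDiagram C X} {E : HCDiagram C Y}
    (η : HCTrans D E) (x : C) : GMap (X x) (Y x) where
  toFun := η.diag.map (crossing x).toPath (fun _ => 0)
  continuous_toFun := (η.diag.continuous_map (crossing x).toPath).comp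
    (continuous_const.prodMk continuous_id)
  map_pt := η.diag.map_pt _ _
  map_smul := η.diag.map_smul (crossing x).toPath (fun _ => 0)

/-- The diagrams are related by a natural transformation that is a weak equivalence of `G`-spaces
at every object. -/
def WeaklyEquivalent {X Y : C → GSpace.{w} G} (D : HCDiagram C X) (E : HCDiagram C Y) : Prop :=
  ∃ η : HCTrans D E, ∀ x, (η.component x).IsWeakEquiv

/-- The homeomorphisms `h x` are an isomorphism from the diagram `D` to the diagram `E`. -/
structure IsDiagramIso {X Y : C → GSpace.{w} G} (D : HCDiagram C X) (E : HCDiagram C Y)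
    (h : ∀ x, X x → Y x) : Prop where
  isHomeomorph : ∀ x, IsHomeomorph (h x)
  map_pt : ∀ x, h x (X x).pt = (Y x).pt
  map_smul : ∀ x (g : G) (a : X x), h x (g • a) = g • h x a
  comm : ∀ {x y : C} (p : Quiver.Path x y) t (a : X x), h y (D.map p t a) = E.map p t (h x a)

/-- A morphism that is an identity. -/
def IsIdentity {x y : C} (f : x ⟶ y) : Prop := ∃ h : x = y, f = eqToHom h

/-- All morphisms of the sequence are non-identity morphisms. -/
def NoIdentities {x : C} : ∀ {y : C}, Quiver.Path x y → Prop
  | _, Quiver.Path.nil => True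
  | _, Quiver.Path.cons p f => NoIdentities p ∧ ¬ IsIdentity f

variable (C) in
/-- Every sequence of composable non-identity morphisms has length at most `n`. -/
def ChainsAtMost (n : ℕ) : Prop :=
  ∀ (x y : C) (p : Quiver.Path x y), NoIdentities p → p.length ≤ n

end Diagrams

/-! ### Collapsing a subset, wedges of spheres, suspensions -/

/-- The relation collapsing the subset `S` to one point. -/
def collapseSetoid {Y : Type w} (S : Set Y) : Setoid Y where
  r a b := a = b ∨ (a ∈ S ∧ b ∈ S)
  iseqv :=
    { refl := fun _ => Or.inl rfl
      symm := by
        rintro a b (rfl | h)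
        exacts [Or.inl rfl, Or.inr ⟨h.2, h.1⟩]
      trans := by
        rintro a b c (rfl | h) (rfl | h')
        exacts [Or.inl rfl, Or.inr h', Or.inr h, Or.inr ⟨h.1, h'.2⟩] }

/-- The quotient space `Y / S`. -/
def Collapse {Y : Type w} (S : Set Y) : Type w := Quotient (collapseSetoid S)

namespace Collapse

variable {Y Z : Type w} {S : Set Y} {T : Set Z}

instance [TopologicalSpace Y] : TopologicalSpace (Collapse S) :=
  inferInstanceAs (TopologicalSpace (Quotient (collapseSetoid S)))

def mk (S : Set Y) (y : Y) : Collapse S := Quotient.mk (collapseSetoid S) y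

theorem mk_eq {a b : Y} (ha : a ∈ S) (hb : b ∈ S) : mk S a = mk S b :=
  Quotient.sound (s := collapseSetoid S) (Or.inr ⟨ha, hb⟩)

theorem isQuotientMap_mk [TopologicalSpace Y] : Topology.IsQuotientMap (mk S) :=
  isQuotientMap_quotient_mk'

def lift {A : Type*} (f : Y → A) (h : ∀ a ∈ S, ∀ b ∈ S, f a = f b) : Collapse S → A :=
  Quotient.lift (s := collapseSetoid S) f (by
    rintro a b (rfl | hab)
    exacts [rfl, h a hab.1 b hab.2])

theorem ind {p : Collapse S → Prop} (h : ∀ y, p (mk S y)) (z : Collapse S) : p z :=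
  Quotient.ind h z

def map (f : Y → Z) (h : ∀ a ∈ S, f a ∈ T) : Collapse S → Collapse T :=
  lift (fun y => mk T (f y)) fun a ha b hb => mk_eq (h a ha) (h b hb)

theorem continuous_map [TopologicalSpace Y] [TopologicalSpace Z] {f : Y → Z} (hf : Continuous f)
    (h : ∀ a ∈ S, f a ∈ T) : Continuous (map f h) :=
  isQuotientMap_mk.continuous_iff.2 (isQuotientMap_mk.continuous.comp hf)

end Collapse

/-- The subset of `{*} ⊔ ⨆ₓ [0,1]^k` to be collapsed: the point `*` and all boundaries. -/
def wedgeBase (k : ℕ) (X : Type w) : Set (PUnit.{w + 1} ⊕ (Σ _ : X, Fin k → I)) :=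
  {p | ∀ q, p = Sum.inr q → q.2 ∈ Cube.boundary (Fin k)}

/-- The wedge `⋁_{x ∈ X} S^k` with `S^k = [0,1]^k / ∂`. The base point `*` is added separately, so
this is a point for empty `X`, and `S^0 = [0,1]^0 / ∅` is a point with a disjoint base point. -/
abbrev Wedge (k : ℕ) (X : Type w) : Type w := Collapse (wedgeBase k X)

namespace Wedge

variable {k : ℕ} {X Y : Type w}

def pt (k : ℕ) (X : Type w) : Wedge k X := Collapse.mk _ (Sum.inl PUnit.unit)

/-- The image in the wedge of the point `c` of the cube labelled `x`. -/
def cell (x : X) (c : Fin k → I) : Wedge k X := Collapse.mk _ (Sum.inr ⟨x, c⟩)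

theorem inl_mem (k : ℕ) (X : Type w) : Sum.inl PUnit.unit ∈ wedgeBase k X := by
  intro q h; cases h

theorem inr_mem {q : Σ _ : X, Fin k → I} :
    Sum.inr q ∈ wedgeBase k X ↔ q.2 ∈ Cube.boundary (Fin k) :=
  ⟨fun h => h q rfl, fun h q' e => by cases e; exact h⟩

/-- A map out of the wedge, given on cubes, constant on boundaries. -/
def lift {A : Type*} (a₀ : A) (f : X → (Fin k → I) → A)
    (h : ∀ x, ∀ c ∈ Cube.boundary (Fin k), f x c = a₀) : Wedge k X → A :=
  Collapse.lift (Sum.elim (fun _ => a₀) fun q => f q.1 q.2) (by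
    have key : ∀ a ∈ wedgeBase k X, Sum.elim (fun _ => a₀) (fun q => f q.1 q.2) a = a₀ := by
      rintro (a | q) hq
      · rfl
      · exact h q.1 q.2 (inr_mem.1 hq)
    intro a ha b hb
    rw [key a ha, key b hb])

/-- The map of wedges induced by a map of index sets. -/
def relabel (k : ℕ) (f : X → Y) : Wedge k X → Wedge k Y :=
  Collapse.map (Sum.map id (Sigma.map f fun _ => id)) (by
    rintro (a | q) hq
    · exact inl_mem k Y
    · exact inr_mem.2 (inr_mem (q := q).1 hq))

theorem continuous_relabel (f : X → Y) : Continuous (relabel k f) := by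
  have h : Continuous (Sigma.map f (fun _ => id) : (Σ _ : X, Fin k → I) → Σ _ : Y, Fin k → I) :=
    continuous_sigma fun x => by
      change Continuous fun c : Fin k → I => (⟨f x, c⟩ : Σ _ : Y, Fin k → I)
      exact @continuous_sigmaMk Y (fun _ => Fin k → I) _ (f x)
  exact Collapse.continuous_map (continuous_id.sumMap h) _

end Wedge

/-- `⋁_{x ∈ X} S^k` as a pointed `G`-space, for a `G`-set `X`. -/
def wedge (G : Type) [Group G] (k : ℕ) (X : Type w) [MulAction G X] : GSpace.{w} G where
  carrier := Wedge k X
  action :=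
    { smul := fun g => Wedge.relabel k (g • ·)
      one_smul := by
        refine Collapse.ind ?_
        rintro (a | ⟨x, c⟩)
        · rfl
        · exact congrArg (fun y => Wedge.cell y c) (one_smul G x)
      mul_smul := by
        intro g h
        refine Collapse.ind ?_
        rintro (a | ⟨x, c⟩)
        · rfl
        · exact congrArg (fun y => Wedge.cell y c) (mul_smul g h x) }
  pt := Wedge.pt k X
  continuous_smul g := Wedge.continuous_relabel _
  smul_pt _ := rfl

/-- The subset of `X × [0,1]` collapsed in the reduced suspension. -/
def suspBase {X : Type w} (x₀ : X) : Set (X × I) := {a | a.1 = x₀ ∨ a.2 = 0 ∨ a.2 = 1}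

/-- The reduced suspension of a pointed `G`-space, with `G` acting trivially on the suspension
coordinate. -/
def GSpace.susp {G : Type} [Group G] (X : GSpace.{w} G) : GSpace.{w} G where
  carrier := Collapse (suspBase X.pt)
  action :=
    { smul := fun g => Collapse.map (fun a => (g • a.1, a.2)) (by
        rintro ⟨x, r⟩ (h | h)
        · exact Or.inl ((congrArg (g • ·) h).trans (X.smul_pt g))
        · exact Or.inr h)
      one_smul := Collapse.ind fun a =>
        congrArg (Collapse.mk _) (Prod.ext (one_smul G a.1) rfl)
      mul_smul := fun g h => Collapse.ind fun a =>
        congrArg (Collapse.mk _) (Prod.ext (mul_smul g h a.1) rfl) }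
  pt := Collapse.mk _ (X.pt, 0)
  continuous_smul g := Collapse.continuous_map
    (((X.continuous_smul g).comp continuous_fst).prodMk continuous_snd) _
  smul_pt g := congrArg (Collapse.mk _) (Prod.ext (X.smul_pt g) rfl)

/-- The reduced suspension of a pointed map. -/
def suspMap {G : Type} [Group G] {X Y : GSpace.{w} G} (f : X → Y) (hf : f X.pt = Y.pt) :
    X.susp → Y.susp :=
  Collapse.map (fun a => (f a.1, a.2)) (by
    rintro ⟨x, r⟩ (h | h)
    · exact Or.inl ((congrArg f h).trans hf)
    · exact Or.inr h)

/-- The diagram obtained by suspending all spaces and all maps. -/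
def HCDiagram.susp {C : Type u} [Category.{v} C] {G : Type} [Group G] {X : C → GSpace.{w} G}
    (D : HCDiagram C X) : HCDiagram C fun x => (X x).susp where
  map p t := suspMap (D.map p t) (D.map_pt p t)
  continuous_map p := by
    refine Collapse.isQuotientMap_mk.continuous_lift_prod_right ?_
    exact Collapse.isQuotientMap_mk.continuous.comp
      (((D.continuous_map p).comp
        (continuous_fst.prodMk (continuous_fst.comp continuous_snd))).prodMk
          (continuous_snd.comp continuous_snd))
  map_pt p t := congrArg (Collapse.mk _) (Prod.ext (D.map_pt p t) rfl)
  map_smul p t g := Collapse.ind fun a =>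
    congrArg (Collapse.mk _) (Prod.ext (D.map_smul p t g a.1) rfl)
  map_nil x t := Collapse.ind fun a =>
    congrArg (Collapse.mk _) (Prod.ext (D.map_nil x t a.1) rfl)
  map_id_first r t := Collapse.ind fun a =>
    congrArg (Collapse.mk _) (Prod.ext (D.map_id_first r t a.1) rfl)
  map_id_mid q r hq hr t := Collapse.ind fun a =>
    congrArg (Collapse.mk _) (Prod.ext (D.map_id_mid q r hq hr t a.1) rfl)
  map_id_last q t := Collapse.ind fun a =>
    congrArg (Collapse.mk _) (Prod.ext (D.map_id_last q t a.1) rfl)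
  map_zero q r hq hr t ht := Collapse.ind fun a =>
    congrArg (Collapse.mk _) (Prod.ext (D.map_zero q r hq hr t ht a.1) rfl)
  map_one q f g _ r t ht := Collapse.ind fun a =>
    congrArg (Collapse.mk _) (Prod.ext (D.map_one q f g r t ht a.1) rfl)

/-- The canonical map `Σ(⋁ S^k) → ⋁ S^{k+1}`, which appends the suspension coordinate `r` to the
coordinates `c` of a point of `[0,1]^k`. -/
def suspWedge (G : Type) [Group G] (k : ℕ) (X : Type w) [MulAction G X] :
    (wedge G k X).susp → wedge G (k + 1) X :=
  Collapse.lift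
    (fun a => Wedge.lift (A := Wedge (k + 1) X) (Wedge.pt (k + 1) X)
      (fun x c => Wedge.cell x (Fin.snoc (α := fun _ => I) c a.2))
      (fun x c hc => Collapse.mk_eq (Wedge.inr_mem.2 (by
        obtain ⟨i, hi⟩ := hc
        exact ⟨i.castSucc, by simpa using hi⟩)) (Wedge.inl_mem _ _)) a.1) (by
    have key : ∀ a ∈ suspBase (wedge G k X).pt,
        Wedge.lift (A := Wedge (k + 1) X) (Wedge.pt (k + 1) X)
          (fun x c => Wedge.cell x (Fin.snoc (α := fun _ => I) c a.2))
          (fun x c hc => Collapse.mk_eq (Wedge.inr_mem.2 (by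
            obtain ⟨i, hi⟩ := hc
            exact ⟨i.castSucc, by simpa using hi⟩)) (Wedge.inl_mem _ _)) a.1 =
          Wedge.pt (k + 1) X := by
      rintro ⟨z, r⟩ (h | h)
      · cases h
        rfl
      · change r = 0 ∨ r = 1 at h
        revert z
        refine Collapse.ind ?_
        rintro (z | ⟨x, c⟩)
        · rfl
        · exact Collapse.mk_eq (Wedge.inr_mem.2 ⟨Fin.last k, by simpa using h⟩)
            (Wedge.inl_mem _ _)
    intro a ha b hb
    rw [key a ha, key b hb])

/-! ### Boxes and box maps -/

/-- A box `∏ [lo i, hi i]` in `[0,1]^k`, with sides of positive length. -/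
@[ext]
structure Box (k : ℕ) where
  lo : Fin k → ℝ
  hi : Fin k → ℝ
  lo_nonneg : ∀ i, 0 ≤ lo i
  lo_lt_hi : ∀ i, lo i < hi i
  hi_le_one : ∀ i, hi i ≤ 1

namespace Box

variable {k : ℕ}

instance : TopologicalSpace (Box k) :=
  TopologicalSpace.induced (fun B => (B.lo, B.hi)) inferInstance

/-- The open box. -/
def interior (B : Box k) : Set (Fin k → I) := {c | ∀ i, B.lo i < c i ∧ (c i : ℝ) < B.hi i}

/-- The whole cube. -/
def full (k : ℕ) : Box k :=
  ⟨fun _ => 0, fun _ => 1, fun _ => le_rfl, fun _ => zero_lt_one, fun _ => le_rfl⟩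

/-- The standard affine homeomorphism from `B` to `[0,1]^k` (clamped outside `B`). -/
def rescale (B : Box k) (c : Fin k → I) : Fin k → I := fun i =>
  Set.projIcc (0 : ℝ) 1 zero_le_one ((c i - B.lo i) / (B.hi i - B.lo i))

/-- The reflection in the first coordinate if the sign is `-1`, the identity if it is `+1`. -/
def reflectPoint (ε : ℤˣ) (c : Fin k → I) : Fin k → I := fun i =>
  if ε = -1 ∧ (i : ℕ) = 0 then unitInterval.symm (c i) else c i

/-- The image of a box under `reflectPoint ε`. -/
def reflect (ε : ℤˣ) (B : Box k) : Box k where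
  lo i := if ε = -1 ∧ (i : ℕ) = 0 then 1 - B.hi i else B.lo i
  hi i := if ε = -1 ∧ (i : ℕ) = 0 then 1 - B.lo i else B.hi i
  lo_nonneg i := by
    split_ifs
    · linarith [B.hi_le_one i]
    · exact B.lo_nonneg i
  lo_lt_hi i := by
    split_ifs
    · linarith [B.lo_lt_hi i]
    · exact B.lo_lt_hi i
  hi_le_one i := by
    split_ifs
    · linarith [B.lo_nonneg i]
    · exact B.hi_le_one i

/-- The sub-box of `B` corresponding to `B'` under the standard identification of `B` with
`[0,1]^k`. -/
def sub (B B' : Box k) : Box k where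
  lo i := B.lo i + (B.hi i - B.lo i) * B'.lo i
  hi i := B.lo i + (B.hi i - B.lo i) * B'.hi i
  lo_nonneg i := by
    have h1 := B.lo_nonneg i
    have h2 := mul_nonneg (sub_pos.2 (B.lo_lt_hi i)).le (B'.lo_nonneg i)
    linarith
  lo_lt_hi i := by
    have h2 := mul_lt_mul_of_pos_left (B'.lo_lt_hi i) (sub_pos.2 (B.lo_lt_hi i))
    linarith
  hi_le_one i := by
    have h1 := B.hi_le_one i
    have h2 := mul_le_mul_of_nonneg_left (B'.hi_le_one i) (sub_pos.2 (B.lo_lt_hi i)).le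
    linarith

end Box

/-- The space `E({B_x}, s)` of collections of boxes `B_a ⊆ B_{s(a)} = [0,1]^k` labelled by `A`,
such that boxes in the same cube have disjoint interiors. -/
def BoxConfig (k : ℕ) {A X : Type w} (s : A → X) : Set (A → Box k) :=
  {e | ∀ a b, a ≠ b → s a = s b → Disjoint (e a).interior (e b).interior}

open Classical in
/-- The box map `Φ(e, A) : ⋁_X S^k → ⋁_Y S^k` of a signed correspondence `(A, s, t, σ)`: the
interior of `B_a`, in the cube labelled `s(a)`, is expanded to the cube labelled `t(a)`, after
reflection in the first coordinate if `σ(a) = -1`; everything else goes to the base point. -/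
def boxMap {k : ℕ} {A X Y : Type w} {s : A → X} (e : BoxConfig k s) (t : A → Y) (sg : A → ℤˣ) :
    Wedge k X → Wedge k Y :=
  Wedge.lift (Wedge.pt k Y)
    (fun x c => if h : ∃ a, s a = x ∧ c ∈ (e.1 a).interior then
        Wedge.cell (t h.choose) (Box.reflectPoint (sg h.choose) ((e.1 h.choose).rescale c))
      else Wedge.pt k Y) (by
    intro x c hc
    rw [dif_neg]
    rintro ⟨a, -, ha⟩
    obtain ⟨i, hi | hi⟩ := hc
    · have h := (ha i).1
      rw [hi] at h
      exact absurd ((e.1 a).lo_nonneg i) (not_le.2 h)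
    · have h := (ha i).2
      rw [hi] at h
      exact absurd ((e.1 a).hi_le_one i) (not_le.2 h))

/-! ### Spatial refinements -/

/-- The sets, source, target and sign maps, composition bijections and group actions that the
box construction uses; they are read off from functors to the three Burnside categories below. -/
structure Labels (G : Type) [Group G] (C : Type u) [Category.{v} C] where
  /-- the set `F(x)` -/
  obj : C → Type w
  objAction : ∀ x, MulAction G (obj x)
  /-- the underlying set of the correspondence `F(f)` -/
  lab : ∀ {x y : C}, (x ⟶ y) → Type w
  labSmul : ∀ {x y : C} (f : x ⟶ y), G → lab f → lab f
  src : ∀ {x y : C} (f : x ⟶ y), lab f → obj x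
  tgt : ∀ {x y : C} (f : x ⟶ y), lab f → obj y
  sgn : ∀ {x y : C} (f : x ⟶ y), lab f → ℤˣ
  /-- the structure bijection `F(g) ∘ F(f) → F(g ∘ f)`, `(b, a) ↦ comp f g a b` -/
  comp : ∀ {x y z : C} (f : x ⟶ y) (g : y ⟶ z) (a : lab f) (b : lab g),
    tgt f a = src g b → lab (f ≫ g)

attribute [instance] Labels.objAction

section Refinements

variable {C : Type u} [Category.{v} C]

/-- The action of the trivial group. -/
abbrev trivialAction (X : Type w) : MulAction Unit X where
  smul _ x := x
  one_smul _ := rfl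
  mul_smul _ _ _ := rfl

/-- The labels of a functor to the Burnside category: no group, all signs `+1`. -/
def ordinaryLabels (F : StrictlyUnitaryPseudofunctor (LocallyDiscrete C) Burn.{w}) :
    Labels.{w} Unit C where
  obj x := (F.obj ⟨x⟩).carrier
  objAction _ := trivialAction _
  lab f := (F.map f.toLoc).carrier
  labSmul _ _ a := a
  src f := (F.map f.toLoc).src
  tgt f := (F.map f.toLoc).tgt
  sgn _ _ := 1
  comp f g a b h := Corr.Hom.equiv (F.mapComp f.toLoc g.toLoc).inv ⟨(b, a), h⟩

/-- The labels of a functor to the signed Burnside category: no group. -/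
def signedLabels (F : StrictlyUnitaryPseudofunctor (LocallyDiscrete C) SignedBurn.{w}) :
    Labels.{w} Unit C where
  obj x := (F.obj ⟨x⟩).carrier
  objAction _ := trivialAction _
  lab f := (F.map f.toLoc).carrier
  labSmul _ _ a := a
  src f := (F.map f.toLoc).src
  tgt f := (F.map f.toLoc).tgt
  sgn f := (F.map f.toLoc).sgn
  comp f g a b h :=
    (SignedCorr.Hom.toHom (F.mapComp f.toLoc g.toLoc).inv).equiv ⟨(b, a), h⟩

/-- The labels of a functor to the equivariant Burnside category: the group is `ℤ/2`, all signs
are `+1`. -/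
def equivariantLabels (F : StrictlyUnitaryPseudofunctor (LocallyDiscrete C) EquivBurn.{w}) :
    Labels.{w} ℤˣ C where
  obj x := (F.obj ⟨x⟩).carrier
  objAction x := (F.obj ⟨x⟩).action
  lab f := (F.map f.toLoc).carrier
  labSmul f g a := (F.map f.toLoc).action.smul g a
  src f := (F.map f.toLoc).src
  tgt f := (F.map f.toLoc).tgt
  sgn _ _ := 1
  comp f g a b h :=
    (EquivCorr.Hom.toHom (F.mapComp f.toLoc g.toLoc).inv).equiv ⟨(b, a), h⟩

variable {G : Type} [Group G]

/-- The pointed `G`-spaces `⋁_{F(x)} S^k`. -/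
abbrev Labels.wedges (L : Labels.{w} G C) (k : ℕ) (x : C) : GSpace.{w} G :=
  wedge G k (L.obj x)

/-- Transport of labels along an equality of morphisms. -/
def Labels.cast (L : Labels.{w} G C) {x y : C} {f g : x ⟶ y} (h : f = g) (a : L.lab f) :
    L.lab g :=
  h ▸ a

/-- Box families exhibiting the maps of a homotopy coherent diagram on the wedges `⋁_{F(x)} S^k`
as box maps refining the correspondences `F(fₙ ∘ ⋯ ∘ f₁)`. The families are continuous,
and they satisfy the same compatibility conditions as the diagram, where boxes of composites
are sub-boxes of sub-boxes and are matched by the structure bijections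
`F(g) ∘ F(f) → F(g ∘ f)`; they are invariant under `G`. -/
structure BoxFamilies (L : Labels.{w} G C) (k : ℕ) (D : HCDiagram C (L.wedges k)) where
  /-- `e p t` is a point of `E({B_x}, s_{F(fₙ ∘ ⋯ ∘ f₁)})` -/
  e : ∀ {x y : C} (p : Quiver.Path x y), (Fin (p.length - 1) → I) →
    BoxConfig k (L.src (composePath p))
  continuous_e : ∀ {x y : C} (p : Quiver.Path x y), Continuous (e p)
  map_eq : ∀ {x y : C} (p : Quiver.Path x y) t,
    D.map p t = boxMap (e p t) (L.tgt (composePath p)) (L.sgn (composePath p))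
  /-- in dimension `0` there is no first coordinate to reflect in, so no sign `-1` is allowed -/
  sgn_eq_one : k = 0 → ∀ {x y : C} (f : x ⟶ y) (a : L.lab f), L.sgn f a = 1
  smul_eq : ∀ {x y : C} (p : Quiver.Path x y) t (g : G) (a : L.lab (composePath p)),
    (e p t).1 (L.labSmul _ g a) = (e p t).1 a
  nil_eq : ∀ (x : C) t (a : L.lab (𝟙 x)),
    (e (Quiver.Path.nil : Quiver.Path x x) t).1 a = Box.full k
  id_first : ∀ {x y : C} (r : Quiver.Path x y) (t : ℕ → I) (a : L.lab (composePath r)),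
    (e ((𝟙 x : x ⟶ x).toPath.comp r) (cut t)).1 (L.cast (by simp) a) =
      (e r (cut (shift 1 t))).1 a
  id_mid : ∀ {x y z : C} (q : Quiver.Path x y) (r : Quiver.Path y z), 0 < q.length →
    0 < r.length → ∀ (t : ℕ → I) (a : L.lab (composePath (q.comp r))),
    (e ((q.cons (𝟙 y)).comp r) (cut t)).1 (L.cast (by simp) a) =
      (e (q.comp r) (cut (merge q.length t))).1 a
  id_last : ∀ {x y : C} (q : Quiver.Path x y) (t : ℕ → I) (a : L.lab (composePath q)),
    (e (q.cons (𝟙 y)) (cut t)).1 (L.cast (by simp) a) = (e q (cut t)).1 a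
  zero_eq : ∀ {x y z : C} (q : Quiver.Path x y) (r : Quiver.Path y z), 0 < q.length →
    0 < r.length → ∀ t : ℕ → I, t (q.length - 1) = 0 →
    ∀ (a : L.lab (composePath q)) (b : L.lab (composePath r)) (h : L.tgt _ a = L.src _ b),
    (e (q.comp r) (cut t)).1 (L.cast (by simp) (L.comp _ _ a b h)) =
      ((e q (cut t)).1 a).sub
        (Box.reflect (L.sgn _ a) ((e r (cut (shift q.length t))).1 b))
  one_eq : ∀ {x y z y' : C} (q : Quiver.Path x y) (f : y ⟶ z) (g : z ⟶ y')
    {z' : C} (r : Quiver.Path y' z') (t : ℕ → I), t q.length = 1 →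
    ∀ a : L.lab (composePath ((q.cons (f ≫ g)).comp r)),
    (e (((q.cons f).cons g).comp r) (cut t)).1 (L.cast (by simp) a) =
      (e ((q.cons (f ≫ g)).comp r) (cut (dropAt q.length t))).1 a

/-- `D` is a `k`-dimensional spatial refinement. -/
def IsSpatialRefinement (L : Labels.{w} G C) (k : ℕ) (D : HCDiagram C (L.wedges k)) : Prop :=
  Nonempty (BoxFamilies L k D)

/-- The suspended diagram `ΣD` is, under the canonical homeomorphisms `Σ(⋁ S^k) ≅ ⋁ S^{k+1}`,
a `(k + 1)`-dimensional spatial refinement. -/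
def SuspIsSpatialRefinement (L : Labels.{w} G C) (k : ℕ) (D : HCDiagram C (L.wedges k)) : Prop :=
  ∃ E : HCDiagram C (L.wedges (k + 1)), IsSpatialRefinement L (k + 1) E ∧
    IsDiagramIso D.susp E fun x => suspWedge G k (L.obj x)

end Refinements

end

end LittleBoxes

open LittleBoxes

/-! The space of box families refining one correspondence is highly connected: a family given on a
closed subset of a cube of parameters of dimension `d < k` extends to the whole cube
(`exists_box_extension`). A box is a centre together with side lengths. Centres are extended by
Tietze and then perturbed generically: with fewer than `k` parameters, the difference of two
smoothed centres misses a dense subset of `ℝᵏ`, so a small translation separates them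
(`exists_point_extension`). Side lengths are extended and then shrunk until the boxes are disjoint;
over the given subset no shrinking is needed. In the equivariant case the action is free, so it
suffices to place one box per orbit of labels (`boxCat_extends`).

The rest of the existence proof is obstruction theory. Box configurations form a topological
category `boxCat` over `C`, and a spatial refinement amounts to a coherent system of lifts of the
morphisms of `C` to it. A chain of `m + 1` non-identity morphisms has an `m`-dimensional parameter
cube. The conditions at `tᵢ = 0` and `tᵢ = 1` prescribe the value on each face of this cube through
shorter chains. The prescriptions agree on intersections of faces (`CoherentOn.forced_unique`),
hence define a continuous map on the boundary, which extends as long as `m < k`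
(`CoherentOn.exists_extension`, `Shape.exists_coherent`). Since chains have length at most `n`, the
bound `n ≤ k` suffices. Identity morphisms are added afterwards: they are deleted from a chain and
neighbouring parameters are multiplied (`Coherent.of_nonId`).

For uniqueness the same extension runs on `{0 → 1} × C`, whose chains have length at most `n + 1`,
with values prescribed over `0`, over `1` and on single morphisms (`exists_coherent_join`). On the
morphism from `(0, x)` to `(1, x)` the full cubes may be prescribed. The component at every object
is then the identity map, so it is a weak equivalence for trivial reasons.

For suspensions every box `B` is replaced by `B × [0,1]` (`suspIsSpatialRefinement`). The three
kinds of functors are treated together through the laws `Labels.Lawful`. -/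

namespace LittleBoxes

noncomputable section

/-! ### Extending families of points and boxes -/

/-- The minimum of `1` and finitely many real numbers. -/
def minOne {J : Type*} [Fintype J] (u : J → ℝ) : ℝ :=
  Finset.univ.inf' ⟨none, Finset.mem_univ _⟩ fun o : Option J => o.elim 1 u

section MinOne

variable {J : Type*} [Fintype J]

theorem minOne_le_one (u : J → ℝ) : minOne u ≤ 1 :=
  Finset.inf'_le (fun o : Option J => o.elim 1 u) (Finset.mem_univ none)

theorem minOne_le (u : J → ℝ) (j : J) : minOne u ≤ u j :=
  Finset.inf'_le (fun o : Option J => o.elim 1 u) (Finset.mem_univ (some j))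

theorem minOne_pos {u : J → ℝ} (h : ∀ j, 0 < u j) : 0 < minOne u := by
  refine (Finset.lt_inf'_iff _).2 ?_
  rintro (_ | j) -
  exacts [one_pos, h j]

theorem minOne_eq_one {u : J → ℝ} (h : ∀ j, 1 ≤ u j) : minOne u = 1 := by
  refine (minOne_le_one u).antisymm (Finset.le_inf' _ _ ?_)
  rintro (_ | j) -
  exacts [le_rfl, h j]

theorem continuousOn_minOne {T : Type*} [TopologicalSpace T] {S : Set T} {u : T → J → ℝ}
    (h : ∀ j, ContinuousOn (fun t => u t j) S) : ContinuousOn (fun t => minOne (u t)) S := by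
  refine ContinuousOn.finset_inf'_apply _ ?_
  rintro (_ | j) -
  exacts [continuousOn_const, h j]

end MinOne

/-- A generic perturbation of a family of points of `ℝᵏ`, depending on fewer than `k` parameters,
consists of pairwise distinct points. -/
theorem exists_distinct_approx {A : Type*} [Fintype A] {d k : ℕ} (hd : d < k)
    {c : (Fin d → I) → A → Fin k → ℝ} (hc : Continuous c) {ε : ℝ} (hε : 0 < ε) :
    ∃ c' : (Fin d → I) → A → Fin k → ℝ, Continuous c' ∧
      (∀ t a i, |c' t a i - c t a i| < ε) ∧ ∀ t a b, a ≠ b → c' t a ≠ c' t b := by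
  classical
  -- Clamping to the cube extends the family to all of `ℝᵈ`, where it can be approximated by a `C¹`
  -- family.
  set ext : (Fin d → ℝ) → (Fin d → I) := fun x i => Set.projIcc 0 1 zero_le_one (x i) with hext
  have hext_cont : Continuous ext :=
    continuous_pi fun i => continuous_projIcc.comp (continuous_apply i)
  have hext_coe : ∀ t : Fin d → I, ext (fun i => (t i : ℝ)) = t := fun t =>
    funext fun i => Set.projIcc_val _ (t i)
  obtain ⟨F, hF, hFc, -⟩ := (hc.comp hext_cont).exists_contDiff_approx (n := 1)
    (ε := fun _ => ε / 2) continuous_const fun _ => by positivity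
  set val : (Fin d → I) → (Fin d → ℝ) := fun t i => (t i : ℝ) with hval
  have hval_cont : Continuous val :=
    continuous_pi fun i => continuous_subtype_val.comp (continuous_apply i)
  have hFval : Continuous fun t => F (val t) := hF.continuous.comp hval_cont
  -- One small translation `v`, independent of `t`, that is good for all pairs at once is enough; it
  -- exists since each `good p` is open and dense.
  let good : {p : A × A // p.1 ≠ p.2} → Set (A → Fin k → ℝ) := fun p =>
    {v | ∀ t, F (val t) p.1.1 + v p.1.1 ≠ F (val t) p.1.2 + v p.1.2}
  have hopen : ∀ p, IsOpen (good p) := by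
    intro p
    have hset : good p = {v | ∀ t ∈ (Set.univ : Set (Fin d → I)), (v, t) ∈
        {q : (A → Fin k → ℝ) × (Fin d → I) |
          F (val q.2) p.1.1 + q.1 p.1.1 ≠ F (val q.2) p.1.2 + q.1 p.1.2}} := by
      ext v; simp [good]
    have ho : IsOpen {q : (A → Fin k → ℝ) × (Fin d → I) |
          F (val q.2) p.1.1 + q.1 p.1.1 ≠ F (val q.2) p.1.2 + q.1 p.1.2} := by
      have h2 : Continuous fun q : (A → Fin k → ℝ) × (Fin d → I) => F (val q.2) :=
        hFval.comp continuous_snd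
      refine isOpen_ne_fun ?_ ?_
      · exact ((continuous_apply _).comp h2).add ((continuous_apply _).comp continuous_fst)
      · exact ((continuous_apply _).comp h2).add ((continuous_apply _).comp continuous_fst)
    rw [hset, isOpen_iff_mem_nhds]
    intro v hv
    -- Openness survives the quantifier over `t` because the cube is compact.
    have := isCompact_univ.eventually_forall_of_forall_eventually (x₀ := v)
      (P := fun v t => (v, t) ∈ {q : (A → Fin k → ℝ) × (Fin d → I) |
          F (val q.2) p.1.1 + q.1 p.1.1 ≠ F (val q.2) p.1.2 + q.1 p.1.2})
      fun t ht => ho.mem_nhds (hv t ht)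
    exact this
  have hdense : ∀ p, Dense (good p) := by
    rintro ⟨⟨a, b⟩, hab⟩
    have hab' : a ≠ b := hab
    intro v
    rw [Metric.mem_closure_iff]
    intro δ hδ
    have hG : ContDiff ℝ 1 fun x => F x b + v b - (F x a + v a) := by
      have h := contDiff_pi.1 hF
      exact ((h b).add contDiff_const).sub ((h a).add contDiff_const)
    -- This is where `d < k` enters: a `C¹` map to a space of larger dimension misses a dense set.
    -- Moving the point `a` by a small missed vector `w` separates it from `b` at every parameter.
    have hD := hG.dense_compl_range_of_finrank_lt_finrank (by simpa using hd)
    obtain ⟨w, hw, hwδ⟩ := Metric.dense_iff.1 hD 0 δ hδ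
    refine ⟨Function.update v a (v a + w), ?_, ?_⟩
    · intro t ht
      apply hwδ
      refine ⟨val t, ?_⟩
      have h1 : F (val t) a + (v a + w) = F (val t) b + v b := by
        simpa [Function.update_of_ne hab'.symm] using ht
      change F (val t) b + v b - (F (val t) a + v a) = w
      rw [← h1]; abel
    · rw [dist_pi_lt_iff hδ]
      intro e
      by_cases he : e = a
      · subst he
        simpa [dist_eq_norm] using hw
      · simpa [Function.update_of_ne he] using hδ
  have hD := dense_iInter_of_isOpen hopen hdense
  obtain ⟨v, hv, hvg⟩ := Metric.dense_iff.1 hD 0 (ε / 2) (by positivity)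
  refine ⟨fun t => F (val t) + v, hFval.add continuous_const, ?_, ?_⟩
  · intro t a i
    have h1 : dist (F (val t)) (c t) < ε / 2 := by
      have := hFc (val t)
      simpa [hval, hext_coe] using this
    have h2 : |F (val t) a i - c t a i| < ε / 2 := by
      have := (dist_pi_lt_iff (half_pos hε)).1 ((dist_pi_lt_iff (half_pos hε)).1 h1 a) i
      simpa [Real.dist_eq] using this
    have h3 : |v a i| < ε / 2 := by
      have := (dist_pi_lt_iff (half_pos hε)).1 ((dist_pi_lt_iff (half_pos hε)).1 hv a) i
      simpa [Real.dist_eq] using this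
    have : (F (val t) + v) a i - c t a i = (F (val t) a i - c t a i) + v a i := by
      simp only [Pi.add_apply]; ring
    rw [this]
    exact (abs_add_le _ _).trans_lt (by linarith)
  · intro t a b hab
    exact Set.mem_iInter.1 hvg ⟨(a, b), hab⟩ t

/-- Families of points of the open cube `(0,1)ᵏ`, certain pairs of which are distinct, extend from
a closed subset of a cube of dimension less than `k`. -/
theorem exists_point_extension {A : Type*} [Fintype A] {d k : ℕ} (hd : d < k)
    (R : A → A → Prop) (hR : ∀ a, ¬ R a a) {S : Set (Fin d → I)} (hS : IsClosed S)
    {c : (Fin d → I) → A → Fin k → ℝ} (hc : ContinuousOn c S)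
    (h01 : ∀ t ∈ S, ∀ a i, 0 < c t a i ∧ c t a i < 1)
    (hne : ∀ t ∈ S, ∀ a b, R a b → c t a ≠ c t b) :
    ∃ c' : (Fin d → I) → A → Fin k → ℝ, Continuous c' ∧ Set.EqOn c' c S ∧
      (∀ t a i, 0 < c' t a i ∧ c' t a i < 1) ∧ ∀ t a b, R a b → c' t a ≠ c' t b := by
  classical
  have hcomp : ∀ a i, ContinuousOn (fun t => c t a i) S := fun a i =>
    continuousOn_pi.1 (continuousOn_pi.1 hc a) i
  -- Compactness of `S` gives one margin for the distances to the faces of the cube and for those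
  -- between related points.
  obtain ⟨m, hm0, hm⟩ : ∃ m, 0 < m ∧ ∀ t ∈ S, m ≤ minOne
      (fun j : (A × Fin k) ⊕ ((A × Fin k) ⊕ {p : A × A // R p.1 p.2}) =>
        j.elim (fun p => c t p.1 p.2) (Sum.elim (fun p => 1 - c t p.1 p.2)
          fun p => dist (c t p.1.1) (c t p.1.2))) := by
    refine hS.isCompact.exists_forall_le' (continuousOn_minOne ?_) ?_
    · rintro (p | p | p)
      · exact hcomp _ _
      · exact continuousOn_const.sub (hcomp _ _)
      · have h := continuousOn_pi.1 hc
        exact continuous_dist.comp_continuousOn ((h p.1.1).prodMk (h p.1.2))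
    · intro t ht
      refine minOne_pos ?_
      rintro (p | p | p)
      · exact (h01 t ht _ _).1
      · exact sub_pos.2 (h01 t ht _ _).2
      · exact dist_pos.2 (hne t ht _ _ p.2)
  have hmlo : ∀ t ∈ S, ∀ a i, m ≤ c t a i := fun t ht a i =>
    (hm t ht).trans (minOne_le _ (Sum.inl (a, i)))
  have hmhi : ∀ t ∈ S, ∀ a i, m ≤ 1 - c t a i := fun t ht a i =>
    (hm t ht).trans (minOne_le _ (Sum.inr (Sum.inl (a, i))))
  have hmd : ∀ t ∈ S, ∀ a b, R a b → m ≤ dist (c t a) (c t b) := fun t ht a b h =>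
    (hm t ht).trans (minOne_le _ (Sum.inr (Sum.inr (⟨(a, b), h⟩ : {p : A × A // R p.1 p.2}))))
  obtain ⟨g, hg⟩ := ContinuousMap.exists_restrict_eq hS
    (⟨fun t => c t, hc.domRestrict⟩ : C(S, A → Fin k → ℝ))
  have hgS : ∀ t ∈ S, g t = c t := fun t ht => congrArg (fun f => f ⟨t, ht⟩) hg
  let η := min m (1 / 2)
  have hη0 : 0 < η := lt_min hm0 (by norm_num)
  have hηm : η ≤ m := min_le_left _ _
  have hηh : η ≤ 1 / 2 := min_le_right _ _
  -- The Tietze extension, kept away from the faces of the cube; the clamp does nothing on `S`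
  -- because `η ≤ m`.
  let c₁ : (Fin d → I) → A → Fin k → ℝ := fun t a i => max η (min (1 - η) (g t a i))
  have hc₁ : Continuous c₁ := by
    refine continuous_pi fun a => continuous_pi fun i => ?_
    exact continuous_const.max (continuous_const.min
      ((continuous_apply i).comp ((continuous_apply a).comp g.continuous)))
  have hc₁S : ∀ t ∈ S, c₁ t = c t := by
    intro t ht
    funext a i
    have h1 := hmlo t ht a i
    have h2 := hmhi t ht a i
    simp only [c₁, hgS t ht]
    rw [min_eq_right (by linarith), max_eq_right (by linarith)]
  have hc₁lo : ∀ t a i, η ≤ c₁ t a i := fun t a i => le_max_left _ _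
  have hc₁hi : ∀ t a i, c₁ t a i ≤ 1 - η := fun t a i =>
    max_le (by linarith) (min_le_left _ _)
  -- With moves smaller than `η / 4`, coordinates in `[η, 1 - η]` stay in `(0, 1)`, and points more
  -- than `η / 2` apart stay distinct.
  obtain ⟨c₂, hc₂, hc₂c, hc₂ne⟩ := exists_distinct_approx hd hc₁ (ε := η / 4) (by positivity)
  let B : Set (Fin d → I) := ⋃ p : {p : A × A // R p.1 p.2},
    {t | dist (c₁ t p.1.1) (c₁ t p.1.2) ≤ η / 2}
  have hB : IsClosed B := isClosed_iUnion_of_finite fun p => isClosed_le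
    (((continuous_apply _).comp hc₁).dist ((continuous_apply _).comp hc₁)) continuous_const
  have hdisj : Disjoint S B := by
    rw [Set.disjoint_left]
    intro t ht htB
    obtain ⟨p, hp⟩ := Set.mem_iUnion.1 htB
    have h1 := hmd t ht _ _ p.2
    have hp' : dist (c₁ t p.1.1) (c₁ t p.1.2) ≤ η / 2 := hp
    rw [hc₁S t ht] at hp'
    linarith
  -- The perturbation is switched off on `S` and fully on wherever two related points come close;
  -- elsewhere any part of it is harmless.
  obtain ⟨φ, hφS, hφB, hφ01⟩ := exists_continuous_zero_one_of_isClosed hS hB hdisj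
  let c' : (Fin d → I) → A → Fin k → ℝ := fun t a i =>
    c₁ t a i + φ t * (c₂ t a i - c₁ t a i)
  have hclose : ∀ t a i, |c' t a i - c₁ t a i| < η / 4 := by
    intro t a i
    have h : c' t a i - c₁ t a i = φ t * (c₂ t a i - c₁ t a i) := by simp only [c']; ring
    rw [h, abs_mul, abs_of_nonneg (hφ01 t).1]
    exact (mul_le_of_le_one_left (abs_nonneg _) (hφ01 t).2).trans_lt (hc₂c t a i)
  refine ⟨c', ?_, ?_, ?_, ?_⟩
  · refine continuous_pi fun a => continuous_pi fun i => ?_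
    have e1 : Continuous fun t => c₁ t a i := (continuous_apply i).comp ((continuous_apply a).comp hc₁)
    have e2 : Continuous fun t => c₂ t a i := (continuous_apply i).comp ((continuous_apply a).comp hc₂)
    exact e1.add (φ.continuous.mul (e2.sub e1))
  · intro t ht
    funext a i
    have : φ t = 0 := hφS ht
    simp only [c', this, zero_mul, add_zero, hc₁S t ht]
  · intro t a i
    have h1 := abs_lt.1 (hclose t a i)
    have h2 := hc₁lo t a i
    have h3 := hc₁hi t a i
    constructor <;> linarith [h1.1, h1.2]
  · intro t a b hab heq
    by_cases htB : t ∈ B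
    · have h1 : φ t = 1 := hφB htB
      have h2 : ∀ e, c' t e = c₂ t e := fun e => by
        funext i; simp only [c', h1, one_mul]; ring
      rw [h2, h2] at heq
      exact hc₂ne t a b (fun h => hR a (h ▸ hab)) heq
    · have h1 : η / 2 < dist (c₁ t a) (c₁ t b) := by
        by_contra h
        exact htB (Set.mem_iUnion.2 ⟨⟨(a, b), hab⟩, not_lt.1 h⟩)
      refine absurd ((dist_pi_le_iff (by positivity)).2 fun i => ?_) (not_le.2 h1)
      have e1 := abs_lt.1 (hclose t a i)
      have e2 := abs_lt.1 (hclose t b i)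
      have e3 : c' t a i = c' t b i := congrFun heq i
      rw [Real.dist_eq, abs_le]
      constructor <;> linarith [e1.1, e1.2, e2.1, e2.2]

/-! ### Extending families of boxes. -/

namespace Box

variable {k : ℕ}

theorem continuousOn_iff {T : Type*} [TopologicalSpace T] {S : Set T} {e : T → Box k} :
    ContinuousOn e S ↔ ContinuousOn (fun t => (e t).lo) S ∧ ContinuousOn (fun t => (e t).hi) S := by
  rw [Topology.IsInducing.continuousOn_iff (f := e) (g := fun B : Box k => (B.lo, B.hi)) ⟨rfl⟩]
  exact ⟨fun h => ⟨continuous_fst.comp_continuousOn h, continuous_snd.comp_continuousOn h⟩,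
    fun h => h.1.prodMk h.2⟩

theorem continuous_iff {T : Type*} [TopologicalSpace T] {e : T → Box k} :
    Continuous e ↔ Continuous (fun t => (e t).lo) ∧ Continuous (fun t => (e t).hi) := by
  simp only [← continuousOn_univ, continuousOn_iff]

/-- If the sides overlap in every coordinate, the midpoints of the overlaps form a common interior
point. -/
theorem disjoint_interior_iff {B B' : Box k} : Disjoint B.interior B'.interior ↔
    ∃ i, B.hi i ≤ B'.lo i ∨ B'.hi i ≤ B.lo i := by
  constructor
  · intro h
    by_contra! hcon
    have hlt : ∀ i, max (B.lo i) (B'.lo i) < min (B.hi i) (B'.hi i) := fun i =>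
      max_lt (lt_min (B.lo_lt_hi i) (hcon i).2) (lt_min (hcon i).1 (B'.lo_lt_hi i))
    have hmem : ∀ i, (max (B.lo i) (B'.lo i) + min (B.hi i) (B'.hi i)) / 2 ∈ I := fun i => by
      have h1 := le_max_left (B.lo i) (B'.lo i)
      have h2 := min_le_left (B.hi i) (B'.hi i)
      constructor <;> linarith [B.lo_nonneg i, hlt i, B.hi_le_one i]
    refine Set.disjoint_left.1 h
      (show (fun i => ⟨_, hmem i⟩ : Fin k → I) ∈ B.interior from ?_) ?_
    · intro i
      have h1 := le_max_left (B.lo i) (B'.lo i)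
      have h2 := min_le_left (B.hi i) (B'.hi i)
      have h3 := hlt i
      constructor <;> dsimp only <;> linarith
    · intro i
      have h1 := le_max_right (B.lo i) (B'.lo i)
      have h2 := min_le_right (B.hi i) (B'.hi i)
      have h3 := hlt i
      constructor <;> dsimp only <;> linarith
  · rintro ⟨i, h | h⟩
    · exact Set.disjoint_left.2 fun c hc hc' => by linarith [(hc i).2, (hc' i).1]
    · exact Set.disjoint_left.2 fun c hc hc' => by linarith [(hc i).1, (hc' i).2]

end Box

/-- Families of boxes in `[0,1]ᵏ`, certain pairs of which have disjoint interiors, extend from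
a closed subset of a cube of dimension less than `k`. -/
theorem exists_box_extension {A : Type*} [Finite A] {d k : ℕ} (hd : d < k)
    (R : A → A → Prop) (hR : ∀ a, ¬ R a a) {S : Set (Fin d → I)} (hS : IsClosed S)
    {e : (Fin d → I) → A → Box k} (he : ContinuousOn e S)
    (hdis : ∀ t ∈ S, ∀ a b, R a b → Disjoint (e t a).interior (e t b).interior) :
    ∃ e' : (Fin d → I) → A → Box k, Continuous e' ∧ Set.EqOn e' e S ∧
      ∀ t a b, R a b → Disjoint (e' t a).interior (e' t b).interior := by
  classical
  have := Fintype.ofFinite A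
  have hne : (Finset.univ : Finset (Fin k)).Nonempty := ⟨⟨d, hd⟩, Finset.mem_univ _⟩
  have helo : ∀ a i, ContinuousOn (fun t => (e t a).lo i) S := fun a i =>
    continuousOn_pi.1 (Box.continuousOn_iff.1 (continuousOn_pi.1 he a)).1 i
  have hehi : ∀ a i, ContinuousOn (fun t => (e t a).hi i) S := fun a i =>
    continuousOn_pi.1 (Box.continuousOn_iff.1 (continuousOn_pi.1 he a)).2 i
  have hlt : ∀ t a i, (e t a).lo i < (e t a).hi i := fun t a i => (e t a).lo_lt_hi i
  obtain ⟨c, hc, hcS, hc01, hcne⟩ := exists_point_extension hd R hR hS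
    (c := fun t a i => ((e t a).lo i + (e t a).hi i) / 2)
    (continuousOn_pi.2 fun a => continuousOn_pi.2 fun i =>
      ((helo a i).add (hehi a i)).div_const 2)
    (fun t _ a i => by
      have h1 := (e t a).lo_nonneg i
      have h2 := (e t a).hi_le_one i
      have h3 := hlt t a i
      constructor <;> linarith)
    (fun t ht a b hab heq => by
      obtain ⟨i, hi⟩ := Box.disjoint_interior_iff.1 (hdis t ht a b hab)
      have h1 := congrFun heq i
      have h2 := hlt t a i
      have h3 := hlt t b i
      rcases hi with hi | hi <;> linarith)
  -- Half side lengths are extended through their logarithms, which keeps them positive.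
  have hlog : ContinuousOn (fun t a i => Real.log (((e t a).hi i - (e t a).lo i) / 2)) S :=
    continuousOn_pi.2 fun a => continuousOn_pi.2 fun i =>
      (((hehi a i).sub (helo a i)).div_const 2).log fun t _ => by
        have := hlt t a i
        exact (by linarith : (0 : ℝ) < ((e t a).hi i - (e t a).lo i) / 2).ne'
  obtain ⟨g, hg⟩ := ContinuousMap.exists_restrict_eq hS (⟨_, hlog.domRestrict⟩ :
    C(S, A → Fin k → ℝ))
  have hgS : ∀ t ∈ S, g t = fun a i => Real.log (((e t a).hi i - (e t a).lo i) / 2) :=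
    fun t ht => congrArg (fun f => f ⟨t, ht⟩) hg
  let h : (Fin d → I) → A → Fin k → ℝ := fun t a i => Real.exp (g t a i)
  have hpos : ∀ t a i, 0 < h t a i := fun t a i => Real.exp_pos _
  have hcont : ∀ a i, Continuous fun t => h t a i := fun a i =>
    Real.continuous_exp.comp ((continuous_apply i).comp ((continuous_apply a).comp g.continuous))
  have hhS : ∀ t ∈ S, ∀ a i, h t a i = ((e t a).hi i - (e t a).lo i) / 2 := by
    intro t ht a i
    simp only [h, hgS t ht]
    exact Real.exp_log (by linarith [hlt t a i])
  have hccont : ∀ a i, Continuous fun t => c t a i := fun a i =>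
    (continuous_apply i).comp ((continuous_apply a).comp hc)
  have hcS' : ∀ t ∈ S, ∀ a i, c t a i = ((e t a).lo i + (e t a).hi i) / 2 := fun t ht a i =>
    congrFun (congrFun (hcS ht) a) i
  -- Upper bounds for a common factor on the half sides: the first two kinds keep the boxes in the
  -- cube, the third keeps related boxes disjoint. One separating coordinate is enough for
  -- disjointness, hence the supremum over `i`.
  let gap : (Fin d → I) → (A × Fin k) ⊕ ((A × Fin k) ⊕ {p : A × A // R p.1 p.2}) → ℝ :=
    fun t j => j.elim (fun p => c t p.1 p.2 / h t p.1 p.2)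
      (Sum.elim (fun p => (1 - c t p.1 p.2) / h t p.1 p.2) fun p =>
        Finset.univ.sup' hne fun i =>
          |c t p.1.1 i - c t p.1.2 i| / (h t p.1.1 i + h t p.1.2 i))
  let κ : (Fin d → I) → ℝ := fun t => minOne (gap t)
  have hκcont : Continuous κ := by
    rw [← continuousOn_univ]
    refine continuousOn_minOne ?_
    rintro (p | p | p)
    · exact ((hccont _ _).div (hcont _ _) fun t => (hpos t _ _).ne').continuousOn
    · exact ((continuous_const.sub (hccont _ _)).div (hcont _ _)
        fun t => (hpos t _ _).ne').continuousOn
    · refine Continuous.continuousOn (Continuous.finset_sup'_apply hne fun i _ => ?_)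
      exact ((hccont _ _).sub (hccont _ _)).abs.div ((hcont _ _).add (hcont _ _))
        fun t => (add_pos (hpos t _ _) (hpos t _ _)).ne'
  have hκpos : ∀ t, 0 < κ t := by
    intro t
    refine minOne_pos ?_
    rintro (p | p | p)
    · exact div_pos (hc01 t _ _).1 (hpos _ _ _)
    · exact div_pos (sub_pos.2 (hc01 t _ _).2) (hpos _ _ _)
    · obtain ⟨i, hi⟩ := Function.ne_iff.1 (hcne t _ _ p.2)
      exact (div_pos (abs_pos.2 (sub_ne_zero.2 hi)) (add_pos (hpos _ _ _) (hpos _ _ _))).trans_le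
        (Finset.le_sup' (fun i => |c t p.1.1 i - c t p.1.2 i| / (h t p.1.1 i + h t p.1.2 i))
          (Finset.mem_univ i))
  -- Over `S` the given boxes already fit, so the factor is `1` and the extension restricts to `e`.
  have hκS : ∀ t ∈ S, κ t = 1 := by
    intro t ht
    refine minOne_eq_one ?_
    rintro (p | p | p)
    · refine (one_le_div (hpos _ _ _)).2 ?_
      rw [hhS t ht, hcS' t ht]
      linarith [(e t p.1).lo_nonneg p.2]
    · refine (one_le_div (hpos _ _ _)).2 ?_
      rw [hhS t ht, hcS' t ht]
      linarith [(e t p.1).hi_le_one p.2]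
    · obtain ⟨i, hi⟩ := Box.disjoint_interior_iff.1 (hdis t ht _ _ p.2)
      refine le_trans ?_ (Finset.le_sup'
        (fun i => |c t p.1.1 i - c t p.1.2 i| / (h t p.1.1 i + h t p.1.2 i)) (Finset.mem_univ i))
      refine (one_le_div (add_pos (hpos _ _ _) (hpos _ _ _))).2 ?_
      rw [hhS t ht, hhS t ht, hcS' t ht, hcS' t ht]
      rcases hi with hi | hi
      · exact le_trans (by linarith) (neg_le_abs _)
      · exact le_trans (by linarith) (le_abs_self _)
  have hκlo : ∀ t a i, κ t * h t a i ≤ c t a i := fun t a i =>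
    (le_div_iff₀ (hpos t a i)).1 (minOne_le (gap t) (Sum.inl (a, i)))
  have hκhi : ∀ t a i, κ t * h t a i ≤ 1 - c t a i := fun t a i =>
    (le_div_iff₀ (hpos t a i)).1 (minOne_le (gap t) (Sum.inr (Sum.inl (a, i))))
  refine ⟨fun t a => ⟨fun i => c t a i - κ t * h t a i, fun i => c t a i + κ t * h t a i,
    fun i => sub_nonneg.2 (hκlo t a i), fun i => ?_, fun i => ?_⟩, ?_, ?_, ?_⟩
  · linarith [mul_pos (hκpos t) (hpos t a i)]
  · linarith [hκhi t a i]
  · refine continuous_pi fun a => Box.continuous_iff.2 ⟨continuous_pi fun i => ?_,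
      continuous_pi fun i => ?_⟩
    · exact (hccont a i).sub (hκcont.mul (hcont a i))
    · exact (hccont a i).add (hκcont.mul (hcont a i))
  · intro t ht
    funext a
    refine Box.ext (funext fun i => ?_) (funext fun i => ?_)
    · dsimp only
      rw [hκS t ht, hhS t ht, hcS' t ht]; ring
    · dsimp only
      rw [hκS t ht, hhS t ht, hcS' t ht]; ring
  · intro t a b hab
    rw [Box.disjoint_interior_iff]
    obtain ⟨i, -, hi⟩ := Finset.exists_mem_eq_sup' hne
      (fun i => |c t a i - c t b i| / (h t a i + h t b i))
    have h1 : κ t ≤ _ := minOne_le (gap t) (Sum.inr (Sum.inr ⟨(a, b), hab⟩))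
    have h2 := (le_div_iff₀ (add_pos (hpos t a i) (hpos t b i))).1 (h1.trans_eq hi)
    refine ⟨i, ?_⟩
    dsimp only
    rcases le_abs.1 h2 with h3 | h3
    · right; linarith
    · left; linarith

end

end LittleBoxes

namespace LittleBoxes

noncomputable section

/-! ### Weighted paths

A homotopy coherent diagram is evaluated at a sequence `f₁, …, fₘ` of morphisms and parameters
`t₁, …, tₘ₋₁`. We attach the parameter `tᵢ` to the morphism `fᵢ`, and give the last morphism an
irrelevant extra weight, so that the compatibility conditions become relations between paths. -/

/-- Paths whose edges carry weights in `[0,1]`. -/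
inductive WPath {V : Type*} (R : V → V → Type*) (x : V) : V → Type _
  | nil : WPath R x x
  | cons {y z : V} (p : WPath R x y) (f : R y z) (s : I) : WPath R x z

namespace WPath

variable {V : Type*} {R : V → V → Type*} {x y z : V}

def length {x : V} : ∀ {y : V}, WPath R x y → ℕ
  | _, nil => 0
  | _, cons p _ _ => p.length + 1

def comp {x y : V} (p : WPath R x y) : ∀ {z : V}, WPath R y z → WPath R x z
  | _, nil => p
  | _, cons q f s => cons (comp p q) f s

/-- The weight of the last edge, `0` for the empty path. -/
def lastWeight {x : V} : ∀ {y : V}, WPath R x y → I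
  -- With this value an empty path may stand on the left of a cut at weight `0`. This happens when
  -- every edge on the left of the cut is an identity and gets removed.
  | _, nil => 0
  | _, cons _ _ s => s

/-- Replace all weights. -/
def setWeights {x : V} : ∀ {y : V}, WPath R x y → (ℕ → I) → WPath R x y
  | _, nil, _ => nil
  | _, cons p f _, t => cons (p.setWeights t) f (t p.length)

/-- The sequence of weights. -/
def weights {x : V} : ∀ {y : V}, WPath R x y → ℕ → I
  -- The constant default makes `weights_comp_add` true at every index, past the end of the path
  -- included.
  | _, nil => fun _ => 1
  | _, cons p _ s => fun i => if i = p.length then s else p.weights i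

@[simp] theorem length_nil : (nil : WPath R x x).length = 0 := rfl

@[simp] theorem length_cons (p : WPath R x y) (f : R y z) (s : I) :
    (p.cons f s).length = p.length + 1 := rfl

@[simp] theorem comp_nil (p : WPath R x y) : p.comp nil = p := rfl

@[simp] theorem comp_cons {v : V} (p : WPath R x y) (q : WPath R y z) (f : R z v) (s : I) :
    p.comp (q.cons f s) = (p.comp q).cons f s := rfl

@[simp] theorem nil_comp (p : WPath R x y) : (nil : WPath R x x).comp p = p := by
  induction p with
  | nil => rfl
  | cons p f s ih => rw [comp_cons, ih]

theorem comp_assoc {v : V} (p : WPath R x y) (q : WPath R y z) (r : WPath R z v) :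
    (p.comp q).comp r = p.comp (q.comp r) := by
  induction r with
  | nil => rfl
  | cons r f s ih => rw [comp_cons, comp_cons, comp_cons, ih]

@[simp] theorem length_comp (p : WPath R x y) (q : WPath R y z) :
    (p.comp q).length = p.length + q.length := by
  induction q with
  | nil => rfl
  | cons q f s ih => simp [ih, Nat.add_assoc]

@[simp] theorem lastWeight_nil : (nil : WPath R x x).lastWeight = 0 := rfl

@[simp] theorem lastWeight_cons (p : WPath R x y) (f : R y z) (s : I) :
    (p.cons f s).lastWeight = s := rfl

@[simp] theorem length_setWeights (p : WPath R x y) (t : ℕ → I) :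
    (p.setWeights t).length = p.length := by
  induction p with
  | nil => rfl
  | cons p f s ih => simp [setWeights, ih]

theorem setWeights_congr (p : WPath R x y) {t t' : ℕ → I} (h : ∀ i < p.length, t i = t' i) :
    p.setWeights t = p.setWeights t' := by
  induction p with
  | nil => rfl
  | cons p f s ih =>
    simp only [setWeights]
    rw [ih fun i hi => h i (Nat.lt_succ_of_lt hi), h p.length (Nat.lt_succ_self _)]

@[simp] theorem setWeights_setWeights (p : WPath R x y) (t t' : ℕ → I) :
    (p.setWeights t).setWeights t' = p.setWeights t' := by
  induction p with
  | nil => rfl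
  | cons p f s ih => simp [setWeights, ih]

theorem setWeights_comp (p : WPath R x y) (q : WPath R y z) (t : ℕ → I) :
    (p.comp q).setWeights t = (p.setWeights t).comp (q.setWeights (shift p.length t)) := by
  induction q with
  | nil => rfl
  | cons q f s ih => simp [setWeights, ih, shift]

@[simp] theorem setWeights_weights (p : WPath R x y) : p.setWeights p.weights = p := by
  induction p with
  | nil => rfl
  | cons p f s ih =>
    simp only [setWeights, weights, if_true]
    rw [setWeights_congr p (t' := p.weights) fun i hi => by rw [if_neg hi.ne], ih]

theorem weights_setWeights (p : WPath R x y) (t : ℕ → I) {i : ℕ} (hi : i < p.length) :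
    (p.setWeights t).weights i = t i := by
  induction p with
  | nil => simp at hi
  | cons p f s ih =>
    simp only [setWeights, weights, length_setWeights]
    split_ifs with h
    · rw [h]
    · exact ih (by rw [length_cons] at hi; omega)

theorem lastWeight_comp (p : WPath R x y) (q : WPath R y z) (hq : 0 < q.length) :
    (p.comp q).lastWeight = q.lastWeight := by
  cases q with
  | nil => simp at hq
  | cons q f s => rfl

theorem lastWeight_setWeights (p : WPath R x y) (t : ℕ → I) (hp : 0 < p.length) :
    (p.setWeights t).lastWeight = t (p.length - 1) := by
  cases p with
  | nil => simp at hp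
  | cons p f s => simp [setWeights]

theorem weights_comp_of_lt (p : WPath R x y) (q : WPath R y z) {i : ℕ} (hi : i < p.length) :
    (p.comp q).weights i = p.weights i := by
  induction q with
  | nil => rfl
  | cons q f s ih =>
    simp only [comp_cons, weights, length_comp]
    rw [if_neg (by omega), ih]

theorem weights_of_length_le (p : WPath R x y) {i : ℕ} (hi : p.length ≤ i) : p.weights i = 1 := by
  induction p with
  | nil => rfl
  | cons p f s ih =>
    rw [length_cons] at hi
    simp only [weights]
    rw [if_neg (by omega), ih (by omega)]

theorem weights_comp_add (p : WPath R x y) (q : WPath R y z) (i : ℕ) :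
    (p.comp q).weights (p.length + i) = q.weights i := by
  induction q with
  | nil => exact p.weights_of_length_le (Nat.le_add_right _ _)
  | cons q f s ih =>
    simp only [comp_cons, weights, length_comp, ih, Nat.add_left_cancel_iff]

theorem weights_length_sub_one (p : WPath R x y) (hp : 0 < p.length) :
    p.weights (p.length - 1) = p.lastWeight := by
  cases p with
  | nil => simp at hp
  | cons p f s => simp [weights]

/-- Two factorizations of a path are comparable. -/
theorem exists_of_comp_eq_comp {v v' : V} {a : WPath R x v} {b : WPath R v z} {c : WPath R x v'}
    {d : WPath R v' z} (h : a.comp b = c.comp d) (hl : a.length ≤ c.length) :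
    ∃ m : WPath R v v', c = a.comp m ∧ b = m.comp d := by
  induction d with
  | nil => exact ⟨b, h.symm, rfl⟩
  | cons d f s ih =>
    cases b with
    | nil =>
      have := congrArg length h
      simp at this
      omega
    | cons b g s' =>
      rw [comp_cons, comp_cons] at h
      injection h with h1 _ h2 h3 h4
      subst h1
      obtain ⟨m, hm, hm'⟩ := ih (eq_of_heq h2)
      refine ⟨m, hm, ?_⟩
      rw [comp_cons, hm', eq_of_heq h3, h4]

/-- A path can be split at any position. -/
theorem exists_split (w : WPath R x z) {i : ℕ} (hi : i ≤ w.length) :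
    ∃ (y : V) (a : WPath R x y) (b : WPath R y z), w = a.comp b ∧ a.length = i := by
  induction w with
  | nil => exact ⟨_, nil, nil, rfl, by simpa [eq_comm] using hi⟩
  | cons p f s ih =>
    rcases Nat.lt_or_ge p.length i with h | h
    · exact ⟨_, p.cons f s, nil, rfl, le_antisymm h hi⟩
    · obtain ⟨y, a, b, hab, ha⟩ := ih h
      exact ⟨y, a, b.cons f s, by rw [comp_cons, ← hab], ha⟩

/-- Compose the images of the edges in a category. -/
def fold {C : Type*} [Category C] {o : V → C} (φ : ∀ ⦃x y : V⦄, R x y → (o x ⟶ o y)) {x : V} :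
    ∀ {y : V}, WPath R x y → (o x ⟶ o y)
  | _, nil => 𝟙 _
  | _, cons p f _ => fold φ p ≫ φ f

section Fold

variable {C : Type*} [Category C] {o : V → C} (φ : ∀ ⦃x y : V⦄, R x y → (o x ⟶ o y))

theorem fold_comp (p : WPath R x y) (q : WPath R y z) :
    (p.comp q).fold φ = p.fold φ ≫ q.fold φ := by
  induction q with
  | nil => exact (Category.comp_id _).symm
  | cons q f s ih => simp only [comp_cons, fold, ih, Category.assoc]

@[simp] theorem fold_setWeights (p : WPath R x y) (t : ℕ → I) :
    (p.setWeights t).fold φ = p.fold φ := by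
  induction p with
  | nil => rfl
  | cons p f s ih => simp only [setWeights, fold, ih]

end Fold

/-- The image of a path under a map of edges. -/
def map {V' : Type*} {R' : V' → V' → Type*} {o : V → V'} (φ : ∀ ⦃x y : V⦄, R x y → R' (o x) (o y))
    {x : V} : ∀ {y : V}, WPath R x y → WPath R' (o x) (o y)
  | _, nil => nil
  | _, cons p f s => cons (map φ p) (φ f) s

section Map

variable {V' : Type*} {R' : V' → V' → Type*} {o : V → V'}
  (φ : ∀ ⦃x y : V⦄, R x y → R' (o x) (o y))

@[simp] theorem map_nil : (nil : WPath R x x).map φ = nil := rfl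

@[simp] theorem map_cons (p : WPath R x y) (f : R y z) (s : I) :
    (p.cons f s).map φ = (p.map φ).cons (φ f) s := rfl

@[simp] theorem map_comp (p : WPath R x y) (q : WPath R y z) :
    (p.comp q).map φ = (p.map φ).comp (q.map φ) := by
  induction q with
  | nil => rfl
  | cons q f s ih => simp [ih]

@[simp] theorem length_map (p : WPath R x y) : (p.map φ).length = p.length := by
  induction p with
  | nil => rfl
  | cons p f s ih => simp [ih]

@[simp] theorem lastWeight_map (p : WPath R x y) : (p.map φ).lastWeight = p.lastWeight := by
  cases p <;> rfl

theorem map_setWeights (p : WPath R x y) (t : ℕ → I) :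
    (p.setWeights t).map φ = (p.map φ).setWeights t := by
  induction p with
  | nil => rfl
  | cons p f s ih => simp [setWeights, ih]

theorem fold_map {C : Type*} [Category C] {o' : V' → C}
    (ψ : ∀ ⦃x y : V'⦄, R' x y → (o' x ⟶ o' y)) (p : WPath R x y) :
    (p.map φ).fold ψ = p.fold (o := fun x => o' (o x)) fun _ _ f => ψ (φ f) := by
  induction p with
  | nil => rfl
  | cons p f s ih => simp only [map_cons, fold, ih]

end Map

end WPath

/-! ### Topological categories over a category -/

/-- A topologically enriched category with a functor to `C` that is the identity on objects. -/
structure TopOver (C : Type u) [Category.{v} C] where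
  hom : C → C → Type w
  [top : ∀ x y, TopologicalSpace (hom x y)]
  proj : ∀ {x y}, hom x y → (x ⟶ y)
  one : ∀ x, hom x x
  comp : ∀ {x y z}, hom x y → hom y z → hom x z
  one_comp : ∀ {x y} (a : hom x y), comp (one x) a = a
  comp_one : ∀ {x y} (a : hom x y), comp a (one y) = a
  assoc : ∀ {x y z v} (a : hom x y) (b : hom y z) (c : hom z v),
    comp (comp a b) c = comp a (comp b c)
  proj_one : ∀ x, proj (one x) = 𝟙 x
  proj_comp : ∀ {x y z} (a : hom x y) (b : hom y z), proj (comp a b) = proj a ≫ proj b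
  continuous_comp : ∀ {x y z}, Continuous fun p : hom x y × hom y z => comp p.1 p.2

attribute [instance] TopOver.top

variable {C : Type u} [Category.{v} C]

/-- Maps from closed subsets of cubes of dimension less than `k` to the fibres of the projection
extend to the cube. -/
def TopOver.Extends (E : TopOver.{w} C) (k : ℕ) : Prop :=
  ∀ d < k, ∀ {x y : C} (f : x ⟶ y) (S : Set (Fin d → I)), IsClosed S →
    ∀ g : S → E.hom x y, Continuous g → (∀ t, E.proj (g t) = f) →
      ∃ g' : (Fin d → I) → E.hom x y, Continuous g' ∧ (∀ t : S, g' t = g t) ∧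
        ∀ t, E.proj (g' t) = f

/-- The case of a zero-dimensional cube and its empty subset. -/
theorem TopOver.Extends.exists_proj_eq {E : TopOver.{w} C} {k : ℕ} (hE : E.Extends k) (hk : 0 < k)
    {x y : C} (f : x ⟶ y) : ∃ a : E.hom x y, E.proj a = f := by
  obtain ⟨g, -, -, hg⟩ := hE 0 hk f ∅ isClosed_empty (fun t => t.2.elim)
    (continuous_of_const fun t => t.2.elim) (fun t => t.2.elim)
  exact ⟨g 0, hg 0⟩

/-! ### Constructing coherent systems -/

/-- A graph whose edges can be composed (a category without identities) with a
functor to `C`. -/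
structure Shape (C : Type u) [Category.{v} C] (V : Type*) where
  R : V → V → Type*
  mul : ∀ {x y z}, R x y → R y z → R x z
  mul_assoc : ∀ {x y z v} (f : R x y) (g : R y z) (h : R z v), mul (mul f g) h = mul f (mul g h)
  obj : V → C
  map : ∀ ⦃x y⦄, R x y → (obj x ⟶ obj y)
  map_mul : ∀ {x y z} (f : R x y) (g : R y z), map (mul f g) = map f ≫ map g

namespace Shape

variable {V : Type*} (Q : Shape C V) (E : TopOver.{w} C)

/-- Functions assigning lifts to weighted paths. -/
abbrev Assignment := ∀ ⦃x y : V⦄, WPath Q.R x y → E.hom (Q.obj x) (Q.obj y)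

variable {Q E}

/-- The compatibility conditions for weighted paths satisfying `D`. -/
structure CoherentOn (D : ∀ ⦃x y : V⦄, WPath Q.R x y → Prop) (Φ : Q.Assignment E) : Prop where
  nil : ∀ x, Φ (WPath.nil : WPath Q.R x x) = E.one _
  proj : ∀ ⦃x y⦄ (w : WPath Q.R x y), D w → E.proj (Φ w) = w.fold Q.map
  cont : ∀ ⦃x y⦄ (w : WPath Q.R x y), D w → Continuous fun t => Φ (w.setWeights t)
  last : ∀ ⦃x y z⦄ (q : WPath Q.R x y) (f : Q.R y z) (s s' : I), D (q.cons f s) →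
    Φ (q.cons f s) = Φ (q.cons f s')
  -- Empty factors are allowed; for them the condition only repeats `nil` and the unit laws.
  zero : ∀ ⦃x y z⦄ (q : WPath Q.R x y) (r : WPath Q.R y z), q.lastWeight = 0 → D (q.comp r) →
    Φ (q.comp r) = E.comp (Φ q) (Φ r)
  -- The parameter between `f` and `g` disappears; the merged edge inherits the weight of `g`, the
  -- parameter that follows it.
  one : ∀ ⦃x y z v v'⦄ (q : WPath Q.R x y) (f : Q.R y z) (g : Q.R z v) (s : I)
    (r : WPath Q.R v v'), D (((q.cons f 1).cons g s).comp r) →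
    Φ (((q.cons f 1).cons g s).comp r) = Φ ((q.cons (Q.mul f g) s).comp r)

/-- `v` is the value at `w` forced by the values of `Φ` on shorter paths. -/
inductive Forced (Φ : Q.Assignment E) {x z : V} :
    WPath Q.R x z → E.hom (Q.obj x) (Q.obj z) → Prop
  | zero {y : V} (a : WPath Q.R x y) (b : WPath Q.R y z) (ha : 0 < a.length) (hb : 0 < b.length)
    (h : a.lastWeight = 0) : Forced Φ (a.comp b) (E.comp (Φ a) (Φ b))
  | one {y y' v : V} (q : WPath Q.R x y) (f : Q.R y y') (g : Q.R y' v) (s : I)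
    (r : WPath Q.R v z) :
    Forced Φ (((q.cons f 1).cons g s).comp r) (Φ ((q.cons (Q.mul f g) s).comp r))

/-! ### Agreement of the prescribed values on intersections of faces. -/

section Forced

variable {m : ℕ} {Φ : Q.Assignment E}

/-- Cutting at both places leaves `a`, a middle piece and `b'`; the two values are the two
bracketings of their composite. -/
theorem CoherentOn.zero_zero (hΦ : CoherentOn (fun _ _ w => w.length ≤ m) Φ)
    {x y y' z : V} {a : WPath Q.R x y} {b : WPath Q.R y z}
    {a' : WPath Q.R x y'} {b' : WPath Q.R y' z} (hl : (a.comp b).length = m + 1)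
    (ha : 0 < a.length) (hb' : 0 < b'.length) (h : a.lastWeight = 0) (h' : a'.lastWeight = 0)
    (heq : a.comp b = a'.comp b') (hle : a.length ≤ a'.length) :
    E.comp (Φ a) (Φ b) = E.comp (Φ a') (Φ b') := by
  obtain ⟨c, rfl, rfl⟩ := WPath.exists_of_comp_eq_comp heq hle
  simp only [WPath.length_comp] at hl
  rcases Nat.eq_zero_or_pos c.length with hc | hc
  · cases c with
    | nil => simp
    | cons c f s => simp at hc
  · rw [hΦ.zero a c h (by simp; omega), hΦ.zero c b' (by rwa [WPath.lastWeight_comp _ _ hc] at h')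
      (by simp; omega), E.assoc]

/-- If the cut lies before `f` or after `g`, the merging happens inside one of the two factors. A
cut between `f` and `g` is impossible, since the weight of `f` would be both `0` and `1`. -/
theorem CoherentOn.zero_one (hΦ : CoherentOn (fun _ _ w => w.length ≤ m) Φ)
    {x y z v v' v'' : V} {a : WPath Q.R x y} {b : WPath Q.R y z}
    {q : WPath Q.R x v} {f : Q.R v v'} {g : Q.R v' v''} {s : I} {r : WPath Q.R v'' z}
    (hl : (a.comp b).length = m + 1) (ha : 0 < a.length) (hb : 0 < b.length)
    (h : a.lastWeight = 0) (heq : a.comp b = ((q.cons f 1).cons g s).comp r) :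
    E.comp (Φ a) (Φ b) = Φ ((q.cons (Q.mul f g) s).comp r) := by
  have hlen := congrArg WPath.length heq
  rw [hl] at hlen
  simp only [WPath.length_comp, WPath.length_cons] at hl hlen
  rcases Nat.lt_trichotomy a.length (q.length + 1) with hlt | hlt | hlt
  · obtain ⟨c, hc, hc'⟩ := WPath.exists_of_comp_eq_comp
      (a := a) (b := b) (c := q) (d := ((WPath.nil.cons f 1).cons g s).comp r)
      (by rw [heq, ← WPath.comp_assoc]; rfl) (by omega)
    subst hc
    have hb' : b = ((c.cons f 1).cons g s).comp r := by
      rw [hc', ← WPath.comp_assoc]; rfl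
    subst hb'
    have e : ((a.comp c).cons (Q.mul f g) s).comp r =
        a.comp ((c.cons (Q.mul f g) s).comp r) := by rw [← WPath.comp_assoc]; rfl
    simp only [WPath.length_comp, WPath.length_cons] at hl
    rw [e, hΦ.zero a _ h (by simp; omega), hΦ.one c f g s r (by simp; omega)]
  · obtain ⟨c, hc, hc'⟩ := WPath.exists_of_comp_eq_comp
      (a := a) (b := b) (c := q.cons f 1) (d := (WPath.nil.cons g s).comp r)
      (by rw [heq, ← WPath.comp_assoc]; rfl) (by simp; omega)
    have := congrArg WPath.length hc
    simp only [WPath.length_comp, WPath.length_cons] at this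
    cases c with
    | nil =>
      rw [WPath.comp_nil] at hc
      rw [← hc, WPath.lastWeight_cons] at h
      exact absurd h one_ne_zero
    | cons c f s => simp at this; omega
  · obtain ⟨c, hc, hc'⟩ := WPath.exists_of_comp_eq_comp
      (a := (q.cons f 1).cons g s) (b := r) (c := a) (d := b) heq.symm (by simp; omega)
    subst hc hc'
    simp only [WPath.length_comp, WPath.length_cons] at hl
    -- For empty `c` the last weight of `a` is the weight `s` of `g`, and the merged edge still
    -- carries it.
    have hlast : ((q.cons (Q.mul f g) s).comp c).lastWeight = 0 := by
      cases c with
      | nil => exact h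
      | cons c f s => exact h
    rw [hΦ.one q f g s c (by simp; omega), ← WPath.comp_assoc,
      hΦ.zero _ _ hlast (by simp; omega)]

/-- Two mergings at separate places commute. If the merged pairs share an edge, both orders merge
the same three edges, and associativity of `Q.mul` identifies the results. -/
theorem CoherentOn.one_one (hΦ : CoherentOn (fun _ _ w => w.length ≤ m) Φ)
    {x z v v' v'' u u' u'' : V}
    {q : WPath Q.R x v} {f : Q.R v v'} {g : Q.R v' v''} {s : I} {r : WPath Q.R v'' z}
    {q' : WPath Q.R x u} {f' : Q.R u u'} {g' : Q.R u' u''} {s' : I} {r' : WPath Q.R u'' z}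
    (hl : (((q.cons f 1).cons g s).comp r).length = m + 1)
    (heq : ((q.cons f 1).cons g s).comp r = ((q'.cons f' 1).cons g' s').comp r')
    (hle : q.length ≤ q'.length) :
    Φ ((q.cons (Q.mul f g) s).comp r) = Φ ((q'.cons (Q.mul f' g') s').comp r') := by
  have hlen := congrArg WPath.length heq
  rw [hl] at hlen
  simp only [WPath.length_comp, WPath.length_cons] at hl hlen
  rcases Nat.lt_trichotomy q'.length (q.length + 1) with hlt | hlt | hlt
  · obtain ⟨c, hc, hc'⟩ := WPath.exists_of_comp_eq_comp heq (by simp; omega)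
    have h1 := congrArg WPath.length hc
    simp only [WPath.length_comp, WPath.length_cons] at h1
    cases c with
    | nil =>
      rw [WPath.comp_nil] at hc
      injection hc with e1 _ e2 e3 e4
      subst e1
      injection eq_of_heq e2 with e5 _ e6 e7 e8
      subst e5
      rw [WPath.nil_comp] at hc'
      rw [eq_of_heq e3, eq_of_heq e6, eq_of_heq e7, e4, hc']
    | cons c f s => simp at h1; omega
  · obtain ⟨c, hc, hc'⟩ := WPath.exists_of_comp_eq_comp
      (a := (q.cons f 1).cons g s) (b := r) (c := q'.cons f' 1)
      (d := (WPath.nil.cons g' s').comp r') (by rw [heq, ← WPath.comp_assoc]; rfl) (by simp; omega)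
    have h1 := congrArg WPath.length hc
    simp only [WPath.length_comp, WPath.length_cons] at h1
    cases c with
    | nil =>
      rw [WPath.comp_nil] at hc
      injection hc with e1 _ e2 e3 e4
      subst e1
      have e2 := eq_of_heq e2
      have e3 := eq_of_heq e3
      subst e2 e3 e4
      rw [WPath.nil_comp] at hc'
      subst hc'
      simp only [WPath.length_comp, WPath.length_cons, WPath.length_nil] at hl
      have a1 := hΦ.one q (Q.mul f f') g' s' r' (by simp; omega)
      have a2 := hΦ.one q f (Q.mul f' g') s' r' (by simp; omega)
      rw [← WPath.comp_assoc]
      exact a1.trans (by rw [a2, Q.mul_assoc])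
    | cons c f s => simp at h1; omega
  · obtain ⟨c, hc, hc'⟩ := WPath.exists_of_comp_eq_comp
      (a := (q.cons f 1).cons g s) (b := r) (c := q')
      (d := ((WPath.nil.cons f' 1).cons g' s').comp r')
      (by rw [heq, ← WPath.comp_assoc]; rfl) (by simp; omega)
    subst hc hc'
    simp only [WPath.length_comp, WPath.length_cons, WPath.length_nil] at hl hlen
    have a1 := hΦ.one ((q.cons (Q.mul f g) s).comp c) f' g' s' r' (by simp; omega)
    have a2 := hΦ.one q f g s ((c.cons (Q.mul f' g') s').comp r') (by simp; omega)
    rw [← WPath.comp_assoc, ← WPath.comp_assoc] at a2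
    rw [← WPath.comp_assoc, ← WPath.comp_assoc]
    exact a1.trans a2.symm

/-- This glues the prescriptions on the faces of a parameter cube to a single map on its boundary.
-/
theorem CoherentOn.forced_unique (hΦ : CoherentOn (fun _ _ w => w.length ≤ m) Φ)
    {x z : V} {w : WPath Q.R x z} (hl : w.length = m + 1)
    {v v' : E.hom (Q.obj x) (Q.obj z)} (h : Forced Φ w v) (h' : Forced Φ w v') : v = v' := by
  obtain @⟨y, a, b, ha, hb, hab⟩ | @⟨y, y', u, q, f, g, s, r⟩ := h
  · generalize hw : a.comp b = w at h' hl
    obtain @⟨y', a', b', ha', hb', hab'⟩ | @⟨y', y'', u, q, f, g, s, r⟩ := h'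
    · rcases le_total a.length a'.length with h | h
      · exact hΦ.zero_zero (by rw [hw, hl]) ha hb' hab hab' hw h
      · exact (hΦ.zero_zero hl ha' hb hab' hab hw.symm h).symm
    · exact hΦ.zero_one (by rw [hw, hl]) ha hb hab hw
  · generalize hw : ((q.cons f 1).cons g s).comp r = w at h' hl
    obtain @⟨y', a', b', ha', hb', hab'⟩ | @⟨y', y'', u, q', f', g', s', r'⟩ := h'
    · exact (hΦ.zero_one hl ha' hb' hab' hw.symm).symm
    · rcases le_total q.length q'.length with h | h
      · exact hΦ.one_one (by rw [hw, hl]) hw h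
      · exact (hΦ.one_one hl hw.symm h).symm

/-- The last weight is not a parameter of the diagram, so the prescriptions must not depend on it.
They do not, because the values on shorter paths do not. -/
theorem CoherentOn.forced_last (hΦ : CoherentOn (fun _ _ w => w.length ≤ m) Φ)
    {x y z : V} {w : WPath Q.R x z} (hl : w.length = m + 1)
    {v : E.hom (Q.obj x) (Q.obj z)} (h : Forced Φ w v) {p : WPath Q.R x y} {f : Q.R y z} {s : I}
    (hw : w = p.cons f s) (s' : I) : Forced Φ (p.cons f s') v := by
  obtain @⟨y, a, b, ha, hb, hab⟩ | @⟨y, y', u, q, f', g, c, r⟩ := h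
  · cases b with
    | nil => simp at hb
    | cons b f' c =>
      rw [WPath.comp_cons] at hw
      injection hw with e1 _ e2 e3 e4
      subst e1
      have e2 := eq_of_heq e2
      have e3 := eq_of_heq e3
      subst e2 e3
      simp only [WPath.length_comp, WPath.length_cons] at hl
      rw [hΦ.last b f' c s' (by simp; omega)]
      exact Forced.zero a (b.cons f' s') ha (by simp) hab
  · cases r with
    | nil =>
      rw [WPath.comp_nil] at hw
      injection hw with e1 _ e2 e3 e4
      subst e1
      have e2 := eq_of_heq e2
      have e3 := eq_of_heq e3
      subst e2 e3
      simp only [WPath.length_comp, WPath.length_cons, WPath.length_nil] at hl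
      rw [WPath.comp_nil, hΦ.last q (Q.mul f' g) c s' (by simp; omega)]
      exact Forced.one q f' g s' WPath.nil
    | cons r f'' c' =>
      rw [WPath.comp_cons] at hw
      injection hw with e1 _ e2 e3 e4
      subst e1
      have e2 := eq_of_heq e2
      have e3 := eq_of_heq e3
      subst e2 e3
      simp only [WPath.length_comp, WPath.length_cons] at hl
      rw [WPath.comp_cons, hΦ.last _ f'' c' s' (by simp; omega)]
      exact Forced.one q f' g c (r.cons f'' s')

theorem CoherentOn.forced_proj (hΦ : CoherentOn (fun _ _ w => w.length ≤ m) Φ)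
    {x z : V} {w : WPath Q.R x z} (hl : w.length = m + 1)
    {v : E.hom (Q.obj x) (Q.obj z)} (h : Forced Φ w v) : E.proj v = w.fold Q.map := by
  obtain @⟨y, a, b, ha, hb, hab⟩ | @⟨y, y', u, q, f', g, c, r⟩ := h
  · simp only [WPath.length_comp] at hl
    rw [E.proj_comp, hΦ.proj a (by omega), hΦ.proj b (by omega), WPath.fold_comp]
  · simp only [WPath.length_comp, WPath.length_cons] at hl
    rw [hΦ.proj _ (by simp; omega), WPath.fold_comp, WPath.fold_comp]
    simp only [WPath.fold, Q.map_mul, Category.assoc]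

end Forced

end Shape

end

end LittleBoxes

/-! ### Parameter sequences as weights of paths. -/

namespace LittleBoxes

noncomputable section

variable {C : Type u} [Category.{v} C]

/-- Extend a finite sequence by zeros. -/
def pad {m : ℕ} (τ : Fin m → I) : ℕ → I := fun i => if h : i < m then τ ⟨i, h⟩ else 0

theorem pad_of_lt {m : ℕ} (τ : Fin m → I) {i : ℕ} (h : i < m) : pad τ i = τ ⟨i, h⟩ := dif_pos h

theorem pad_cut {m : ℕ} (t : ℕ → I) {i : ℕ} (h : i < m) : pad (cut t : Fin m → I) i = t i :=
  dif_pos h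

theorem continuous_pad {m : ℕ} : Continuous (pad : (Fin m → I) → ℕ → I) := by
  refine continuous_pi fun i => ?_
  by_cases h : i < m
  · simpa only [pad, dif_pos h] using continuous_apply _
  · simpa only [pad, dif_neg h] using continuous_const

theorem continuous_cut {m : ℕ} : Continuous (cut : (ℕ → I) → Fin m → I) :=
  continuous_pi fun _ => continuous_apply _

theorem continuous_shift (m : ℕ) : Continuous (shift m) :=
  continuous_pi fun _ => continuous_apply _

theorem continuous_dropAt (m : ℕ) : Continuous (dropAt m) := by
  refine continuous_pi fun i => ?_
  by_cases h : i < m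
  · simpa only [dropAt, if_pos h] using continuous_apply _
  · simpa only [dropAt, if_neg h] using continuous_apply _

theorem shift_dropAt (m j : ℕ) (t : ℕ → I) : shift (m + j) (dropAt m t) = shift (m + j + 1) t := by
  funext i
  simp only [shift, dropAt, if_neg (show ¬ m + j + i < m by omega)]
  congr 1
  omega

theorem shift_merge (m j : ℕ) (t : ℕ → I) : shift (m + j) (merge m t) = shift (m + j + 1) t := by
  funext i
  simp only [shift, merge, if_neg (show ¬ m + j + i + 1 < m by omega),
    if_neg (show ¬ m + j + i + 1 = m by omega)]
  congr 1
  omega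

namespace WPath

variable {V : Type*} {R : V → V → Type*} {x y z v v' : V}

theorem setWeights_cons_cons_comp (q : WPath R x y) (f : R y z) (s : I) (g : R z v) (s' : I)
    (r : WPath R v v') (t : ℕ → I) : (((q.cons f s).cons g s').comp r).setWeights t =
      (((q.setWeights t).cons f (t q.length)).cons g (t (q.length + 1))).comp
        (r.setWeights (shift (q.length + 1 + 1) t)) := by
  rw [setWeights_comp]
  rfl

theorem setWeights_dropAt (q : WPath R x y) (f : R y z) (s : I) (r : WPath R z v) (t : ℕ → I) :
    ((q.cons f s).comp r).setWeights (dropAt q.length t) =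
      ((q.setWeights t).cons f (t (q.length + 1))).comp
        (r.setWeights (shift (q.length + 1 + 1) t)) := by
  rw [setWeights_comp]
  simp only [setWeights, length_cons]
  rw [shift_dropAt, q.setWeights_congr (t := dropAt q.length t) (t' := t) fun i hi => if_pos hi]
  congr 2
  exact if_neg (lt_irrefl _)

theorem setWeights_merge (q : WPath R x y) (f : R y z) (s : I) (r : WPath R z v) (t : ℕ → I) :
    ((q.cons f s).comp r).setWeights (merge (q.length + 1) t) =
      ((q.setWeights t).cons f (t q.length * t (q.length + 1))).comp
        (r.setWeights (shift (q.length + 1 + 1) t)) := by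
  rw [setWeights_comp]
  simp only [setWeights, length_cons]
  rw [shift_merge (q.length + 1) 0, q.setWeights_congr (t := merge (q.length + 1) t) (t' := t)
    fun i hi => if_pos (by omega)]
  congr 2
  exact (if_neg (lt_irrefl _)).trans (if_pos rfl)

end WPath

namespace Shape

variable {V : Type*} {Q : Shape C V} {E : TopOver.{w} C}

/-! ### Extension over one parameter cube. -/

section Step

variable {m : ℕ} {Φ : Q.Assignment E}

/-- The parameter `t i` is the weight of the edge with index `i`, so the cut comes after `i + 1`
edges; `i < m` leaves at least one edge on the right. -/
theorem CoherentOn.exists_forced_zero (hΦ : CoherentOn (fun _ _ w => w.length ≤ m) Φ)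
    {x z : V} (u : WPath Q.R x z) (hu : u.length = m + 1)
    {i : ℕ} (hi : i < m) : ∃ h : (ℕ → I) → E.hom (Q.obj x) (Q.obj z), Continuous h ∧
      ∀ t, t i = 0 → Forced Φ (u.setWeights t) (h t) := by
  obtain ⟨y, a, b, rfl, ha⟩ := u.exists_split (i := i + 1) (by omega)
  rw [WPath.length_comp] at hu
  refine ⟨fun t => E.comp (Φ (a.setWeights t)) (Φ (b.setWeights (shift a.length t))), ?_, ?_⟩
  · exact E.continuous_comp.comp ((hΦ.cont a (by omega)).prodMk
      ((hΦ.cont b (by omega)).comp (continuous_shift _)))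
  · intro t ht
    rw [WPath.setWeights_comp]
    refine Forced.zero _ _ (by simp; omega) (by simp; omega) ?_
    rw [WPath.lastWeight_setWeights _ _ (by omega), ha]
    exact ht

/-- The edges with indices `i` and `i + 1` are merged, so the path is split after `i + 2` edges. -/
theorem CoherentOn.exists_forced_one (hΦ : CoherentOn (fun _ _ w => w.length ≤ m) Φ)
    {x z : V} (u : WPath Q.R x z) (hu : u.length = m + 1)
    {i : ℕ} (hi : i < m) : ∃ h : (ℕ → I) → E.hom (Q.obj x) (Q.obj z), Continuous h ∧
      ∀ t, t i = 1 → Forced Φ (u.setWeights t) (h t) := by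
  obtain ⟨y, a, r, rfl, ha⟩ := u.exists_split (i := i + 2) (by omega)
  rw [WPath.length_comp] at hu
  cases a with
  | nil => simp at ha
  | cons a g s =>
    cases a with
    | nil => simp at ha
    | cons q f s' =>
      simp only [WPath.length_cons] at ha hu
      have hq : q.length = i := by omega
      subst hq
      refine ⟨fun t => Φ (((q.cons (Q.mul f g) 1).comp r).setWeights (dropAt q.length t)),
        (hΦ.cont _ (by simp; omega)).comp (continuous_dropAt _), fun t ht => ?_⟩
      beta_reduce
      rw [WPath.setWeights_dropAt, WPath.setWeights_cons_cons_comp, ht]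
      exact Forced.one _ _ _ _ _

/-- Values are prescribed over the boundary of the cube only; the bound `i < m` leaves out the last
weight. -/
theorem Forced.exists_eq {x z : V} {u : WPath Q.R x z} (hu : u.length = m + 1) {t : ℕ → I}
    {v : E.hom (Q.obj x) (Q.obj z)} (h : Forced Φ (u.setWeights t) v) :
    ∃ i < m, t i = 0 ∨ t i = 1 := by
  generalize hw : u.setWeights t = w at h
  have hl := congrArg WPath.length hw
  have hwt : ∀ i < m + 1, w.weights i = t i := fun i hi => by
    rw [← hw, WPath.weights_setWeights _ _ (hu ▸ hi)]
  rw [WPath.length_setWeights, hu] at hl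
  obtain @⟨y, a, b, ha, hb, hab⟩ | @⟨y, y', v, q, f, g, s, r⟩ := h
  · rw [WPath.length_comp] at hl
    refine ⟨a.length - 1, by omega, Or.inl ?_⟩
    rw [← hwt _ (by omega), WPath.weights_comp_of_lt _ _ (by omega),
      WPath.weights_length_sub_one _ ha, hab]
  · simp only [WPath.length_comp, WPath.length_cons] at hl
    refine ⟨q.length, by omega, Or.inr ?_⟩
    rw [← hwt _ (by omega), WPath.weights_comp_of_lt _ _ (by simp)]
    simp [WPath.weights]

/-- The obstruction-theoretic step: `m + 1` edges have an `m`-dimensional parameter cube, on whose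
boundary the value is prescribed, and `m < k` permits the extension to the interior. -/
theorem CoherentOn.exists_extension (hΦ : CoherentOn (fun _ _ w => w.length ≤ m) Φ)
    {k : ℕ} (hE : E.Extends k) (hm : m < k) {x z : V}
    (u : WPath Q.R x z) (hu : u.length = m + 1) :
    ∃ G : (Fin m → I) → E.hom (Q.obj x) (Q.obj z), Continuous G ∧
      (∀ τ, E.proj (G τ) = u.fold Q.map) ∧
      ∀ t v, Forced Φ (u.setWeights t) v → G (cut t) = v := by
  let face : Fin m × Bool → Set (Fin m → I) := fun j => {τ | τ j.1 = if j.2 then 1 else 0}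
  have hface : ∀ j, IsClosed (face j) := fun j =>
    isClosed_eq (continuous_apply _) continuous_const
  have hforced : ∀ j, ∃ h : (ℕ → I) → E.hom (Q.obj x) (Q.obj z), Continuous h ∧
      ∀ τ ∈ face j, Forced Φ (u.setWeights (pad τ)) (h (pad τ)) := by
    rintro ⟨i, b⟩
    cases b with
    | false =>
      obtain ⟨h, hc, hf⟩ := hΦ.exists_forced_zero u hu i.2
      exact ⟨h, hc, fun τ hτ => hf _ ((pad_of_lt τ i.2).trans hτ)⟩
    | true =>
      obtain ⟨h, hc, hf⟩ := hΦ.exists_forced_one u hu i.2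
      exact ⟨h, hc, fun τ hτ => hf _ ((pad_of_lt τ i.2).trans hτ)⟩
  choose h hh hf using hforced
  have hS : ∀ τ : (⋃ j, face j : Set (Fin m → I)), ∃ v, Forced Φ (u.setWeights (pad τ.1)) v := by
    rintro ⟨τ, hτ⟩
    obtain ⟨j, hj⟩ := Set.mem_iUnion.1 hτ
    exact ⟨_, hf j τ hj⟩
  choose g hg using hS
  have hgc : Continuous g := by
    -- Finitely many closed faces cover the boundary. On each of them the chosen values coincide, by
    -- uniqueness, with a continuous prescription.
    have hfin : LocallyFinite fun j => ((↑) : (⋃ j, face j : Set (Fin m → I)) → _) ⁻¹' face j :=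
      locallyFinite_of_finite _
    refine hfin.continuous ?_ (fun j => (hface j).preimage continuous_subtype_val) fun j => ?_
    · refine Set.eq_univ_of_forall fun τ => ?_
      obtain ⟨j, hj⟩ := Set.mem_iUnion.1 τ.2
      exact Set.mem_iUnion.2 ⟨j, hj⟩
    · refine ((hh j).comp (continuous_pad.comp continuous_subtype_val)).continuousOn.congr
        fun τ hτ => ?_
      exact hΦ.forced_unique (by rw [WPath.length_setWeights, hu]) (hg τ) (hf j τ.1 hτ)
  obtain ⟨G, hG, hGg, hGp⟩ := hE m hm (u.fold Q.map) _ (isClosed_iUnion_of_finite hface) g hgc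
    fun τ => by
      rw [hΦ.forced_proj (by rw [WPath.length_setWeights, hu]) (hg τ), WPath.fold_setWeights]
  refine ⟨G, hG, hGp, fun t v hv => ?_⟩
  obtain ⟨i, hi, hti⟩ := Forced.exists_eq hu hv
  have hmem : (cut t : Fin m → I) ∈ ⋃ j, face j := by
    rcases hti with hti | hti
    · exact Set.mem_iUnion.2 ⟨(⟨i, hi⟩, false), hti⟩
    · exact Set.mem_iUnion.2 ⟨(⟨i, hi⟩, true), hti⟩
  rw [hGg ⟨cut t, hmem⟩]
  refine hΦ.forced_unique (by rw [WPath.length_setWeights, hu]) (hg ⟨cut t, hmem⟩) ?_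
  cases u with
  | nil => simp at hu
  | cons p f s =>
    have hp : p.length = m := by simpa using hu
    -- Passing through `cut` and `pad` replaces the last weight by `0`, which does not affect forced
    -- values.
    have h1 := hΦ.forced_last (by rw [WPath.length_setWeights, hu]) hv rfl
      (pad (cut t : Fin m → I) p.length)
    rw [p.setWeights_congr (t' := pad (cut t : Fin m → I)) fun i hi =>
      (pad_cut t (hp ▸ hi)).symm] at h1
    exact h1

end Step

/-! ### Induction on the length of paths, relative to prescribed values. -/

/-- A class of weighted paths on which a coherent system may be prescribed. -/
structure FaceClosed (D : ∀ ⦃x y : V⦄, WPath Q.R x y → Prop) : Prop where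
  setWeights : ∀ ⦃x y⦄ (w : WPath Q.R x y) (t : ℕ → I), D w → D (w.setWeights t)
  left : ∀ ⦃x y z⦄ (a : WPath Q.R x y) (b : WPath Q.R y z), D (a.comp b) → D a
  right : ∀ ⦃x y z⦄ (a : WPath Q.R x y) (b : WPath Q.R y z), D (a.comp b) → D b
  mul : ∀ ⦃x y z v v'⦄ (q : WPath Q.R x y) (f : Q.R y z) (g : Q.R z v) (s : I)
    (r : WPath Q.R v v'), D (((q.cons f 1).cons g s).comp r) → D ((q.cons (Q.mul f g) s).comp r)

theorem FaceClosed.cons_iff {D : ∀ ⦃x y : V⦄, WPath Q.R x y → Prop} (hD : FaceClosed D) {x y z : V}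
    (q : WPath Q.R x y) (f : Q.R y z) (s s' : I) : D (q.cons f s) → D (q.cons f s') := fun h => by
  have h1 := hD.setWeights _ (q.cons f s').weights h
  have h2 : (q.cons f s).setWeights (q.cons f s').weights = q.cons f s' := by
    conv_rhs => rw [← (q.cons f s').setWeights_weights]
    rfl
  rwa [h2] at h1

variable {D : ∀ ⦃x y : V⦄, WPath Q.R x y → Prop} {Φ₀ : Q.Assignment E}

/-- Only the empty paths are constrained. The other values are arbitrary; they exist because the
presence of an edge gives `0 < n ≤ k`. -/
theorem exists_coherentOn_zero {n k : ℕ} (hlen : ∀ ⦃x y⦄ (w : WPath Q.R x y), w.length ≤ n)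
    (hnk : n ≤ k) (hE : E.Extends k) :
    ∃ Φ : Q.Assignment E, CoherentOn (fun _ _ w => w.length ≤ 0) Φ := by
  have hne : ∀ ⦃x y z⦄, WPath Q.R x y → Q.R y z → Nonempty (E.hom (Q.obj x) (Q.obj z)) := by
    intro x y z p f
    have h1 := hlen (p.cons f 1)
    rw [WPath.length_cons] at h1
    obtain ⟨a, -⟩ := hE.exists_proj_eq (by omega) ((p.cons f 1).fold Q.map)
    exact ⟨a⟩
  refine ⟨fun x y w => match y, w with
    | _, WPath.nil => E.one _
    | _, WPath.cons p f _ => (hne p f).some, fun _ => rfl, ?_, ?_, ?_, ?_, ?_⟩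
  · rintro x y (_ | ⟨p, f, s⟩) hw
    · exact E.proj_one _
    · simp at hw
  · rintro x y (_ | ⟨p, f, s⟩) hw
    · exact continuous_const
    · simp at hw
  · intro x y z q f s s' hw
    simp at hw
  · rintro x y z q (_ | ⟨r, f, s⟩) hq hw
    · exact (E.comp_one _).symm
    · simp at hw
  · intro x y z v v' q f g s r hw
    simp at hw

/-- The values are those of `Φ₀` on `D`, those of the extended cubes on the remaining paths of
length `m + 1`, and the old ones on the remaining shorter paths. These fit together because `D`
contains all faces of its members, where `Φ` and `Φ₀` agree. -/
theorem CoherentOn.exists_succ {m k : ℕ} {Φ : Q.Assignment E} (hE : E.Extends k) (hm : m < k)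
    (hD : FaceClosed D) (h₀ : CoherentOn D Φ₀)
    (hΦ : CoherentOn (fun _ _ w => w.length ≤ m) Φ)
    (hΦ₀ : ∀ ⦃x y⦄ (w : WPath Q.R x y), w.length ≤ m → D w → Φ w = Φ₀ w) :
    ∃ Φ' : Q.Assignment E, CoherentOn (fun _ _ w => w.length ≤ m + 1) Φ' ∧
      ∀ ⦃x y⦄ (w : WPath Q.R x y), w.length ≤ m + 1 → D w → Φ' w = Φ₀ w := by
  classical
  choose G hG hGp hGf using fun (x z : V) (u : WPath Q.R x z) (hu : u.length = m + 1) =>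
    hΦ.exists_extension hE hm u hu
  have hshape : ∀ ⦃x z⦄ (w : WPath Q.R x z), w.length = m + 1 →
      (w.setWeights fun _ => 1).length = m + 1 := fun x z w hw => by
    rw [WPath.length_setWeights, hw]
  -- Setting all weights to `1` makes the choice of `G` depend on the underlying path alone. The
  -- actual weights enter only as parameters, which gives continuity.
  let Φ' : Q.Assignment E := fun x z w =>
    if D w then Φ₀ w
    else if hw : w.length = m + 1 then
      G x z (w.setWeights fun _ => 1) (hshape w hw) (cut w.weights)
    else Φ w
  have hD' : ∀ ⦃x z⦄ (w : WPath Q.R x z), D w → Φ' w = Φ₀ w := fun x z w h => if_pos h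
  have hle : ∀ ⦃x z⦄ (w : WPath Q.R x z), w.length ≤ m → Φ' w = Φ w := fun x z w hw => by
    by_cases h : D w
    · rw [hD' w h, hΦ₀ w hw h]
    · exact (if_neg h).trans (dif_neg (by omega))
  have hGG : ∀ ⦃x z⦄ (w : WPath Q.R x z) (hw : w.length = m + 1), ¬ D w →
      Φ' w = G x z (w.setWeights fun _ => 1) (hshape w hw) (cut w.weights) := fun x z w hw h =>
    (if_neg h).trans (dif_pos hw)
  have hforced : ∀ ⦃x z⦄ (w : WPath Q.R x z) (v), w.length = m + 1 → ¬ D w → Forced Φ w v →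
      Φ' w = v := fun x z w v hw h hv => by
    rw [hGG w hw h]
    exact hGf _ _ _ _ _ _ (by rwa [WPath.setWeights_setWeights, WPath.setWeights_weights])
  have hnil : ∀ x, Φ' (WPath.nil : WPath Q.R x x) = E.one _ := fun x => by
    rw [hle _ (by simp), hΦ.nil]
  refine ⟨Φ', ⟨hnil, ?_, ?_, ?_, ?_, ?_⟩, fun x y w _ h => hD' w h⟩
  · intro x y w hw
    by_cases hDw : D w
    · rw [hD' w hDw, h₀.proj w hDw]
    · rcases Nat.lt_or_ge m w.length with h | h
      · rw [hGG w (by omega) hDw, hGp, WPath.fold_setWeights]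
      · rw [hle w h, hΦ.proj w h]
  · intro x y w hw
    by_cases hDw : D w
    · simp_rw [fun t => hD' _ (hD.setWeights w t hDw)]
      exact h₀.cont w hDw
    · have hDw' : ∀ t, ¬ D (w.setWeights t) := fun t h => hDw (by
        have := hD.setWeights _ w.weights h
        rwa [WPath.setWeights_setWeights, WPath.setWeights_weights] at this)
      rcases Nat.lt_or_ge m w.length with h | h
      · have hw' : w.length = m + 1 := by omega
        have : ∀ t, Φ' (w.setWeights t) =
            G x y (w.setWeights fun _ => 1) (hshape w hw') (cut t) := fun t => by
          rw [hGG _ (by rw [WPath.length_setWeights, hw']) (hDw' t)]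
          have h1 : (cut (w.setWeights t).weights : Fin m → I) = cut t :=
            funext fun i => w.weights_setWeights t (by omega)
          rw [h1]
          simp only [WPath.setWeights_setWeights]
        simp_rw [this]
        exact (hG _ _ _ _).comp continuous_cut
      · simp_rw [fun t => hle (w.setWeights t) (by rwa [WPath.length_setWeights])]
        exact hΦ.cont w h
  · intro x y z q f s s' hw
    by_cases hDw : D (q.cons f s)
    · rw [hD' _ hDw, hD' _ (hD.cons_iff q f s s' hDw), h₀.last q f s s' hDw]
    · have hDw' : ¬ D (q.cons f s') := fun h => hDw (hD.cons_iff q f s' s h)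
      simp only [WPath.length_cons] at hw
      rcases Nat.lt_or_ge m (q.length + 1) with h | h
      · have hq : q.length = m := by omega
        rw [hGG _ (by simp [hq]) hDw, hGG _ (by simp [hq]) hDw']
        have h1 : (cut (q.cons f s).weights : Fin m → I) = cut (q.cons f s').weights :=
          funext fun i => by
            have := i.2
            simp only [cut, WPath.weights]
            rw [if_neg (by omega), if_neg (by omega)]
        rw [h1]
        rfl
      · rw [hle _ (by simpa using h), hle _ (by simpa using h), hΦ.last q f s s' (by simpa using h)]
  · intro x y z q r hq hw
    by_cases hDw : D (q.comp r)
    · rw [hD' _ hDw, hD' _ (hD.left q r hDw), hD' _ (hD.right q r hDw), h₀.zero q r hq hDw]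
    · rw [WPath.length_comp] at hw
      cases r with
      | nil => rw [hnil, E.comp_one, WPath.comp_nil]
      | cons r f s =>
        cases q with
        | nil => rw [hnil, E.one_comp, WPath.nil_comp]
        | cons q g s' =>
          simp only [WPath.length_cons] at hw
          rw [hle (q.cons g s') (by simp; omega), hle (r.cons f s) (by simp; omega)]
          rcases Nat.lt_or_ge m (q.length + 1 + (r.length + 1)) with h | h
          · exact hforced _ _ (by simp; omega) hDw (Forced.zero _ _ (by simp) (by simp) hq)
          · rw [hle _ (by simp; omega), hΦ.zero _ _ hq (by simp; omega)]
  · intro x y z v v' q f g s r hw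
    by_cases hDw : D (((q.cons f 1).cons g s).comp r)
    · rw [hD' _ hDw, hD' _ (hD.mul q f g s r hDw), h₀.one q f g s r hDw]
    · simp only [WPath.length_cons, WPath.length_comp] at hw
      rw [hle ((q.cons (Q.mul f g) s).comp r) (by simp; omega)]
      rcases Nat.lt_or_ge m (q.length + 2 + r.length) with h | h
      · exact hforced _ _ (by simp; omega) hDw (Forced.one _ _ _ _ _)
      · rw [hle _ (by simp; omega), hΦ.one _ _ _ _ _ (by simp; omega)]

/-- Coherent systems with prescribed restriction exist if the paths are not too long. -/
theorem exists_coherent {n k : ℕ} (hlen : ∀ ⦃x y⦄ (w : WPath Q.R x y), w.length ≤ n) (hnk : n ≤ k)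
    (hE : E.Extends k) (hD : FaceClosed D) (h₀ : CoherentOn D Φ₀) :
    ∃ Φ : Q.Assignment E, CoherentOn (fun _ _ _ => True) Φ ∧
      ∀ ⦃x y⦄ (w : WPath Q.R x y), D w → Φ w = Φ₀ w := by
  have key : ∀ m ≤ n, ∃ Φ : Q.Assignment E, CoherentOn (fun _ _ w => w.length ≤ m) Φ ∧
      ∀ ⦃x y⦄ (w : WPath Q.R x y), w.length ≤ m → D w → Φ w = Φ₀ w := by
    intro m
    induction m with
    | zero =>
      intro _
      obtain ⟨Φ, hΦ⟩ := exists_coherentOn_zero hlen hnk hE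
      refine ⟨Φ, hΦ, ?_⟩
      rintro x y (_ | ⟨p, f, s⟩) hw -
      · rw [hΦ.nil, h₀.nil]
      · simp at hw
    | succ m ih =>
      intro hm
      obtain ⟨Φ, hΦ, hΦ₀⟩ := ih (by omega)
      exact CoherentOn.exists_succ hE (by omega) hD h₀ hΦ hΦ₀
  obtain ⟨Φ, hΦ, hΦ₀⟩ := key n le_rfl
  exact ⟨Φ, ⟨hΦ.nil, fun x y w _ => hΦ.proj w (hlen w), fun x y w _ => hΦ.cont w (hlen w),
    fun x y z q f s s' _ => hΦ.last q f s s' (hlen _), fun x y z q r h _ => hΦ.zero q r h (hlen _),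
    fun x y z v v' q f g s r _ => hΦ.one q f g s r (hlen _)⟩, fun x y w h => hΦ₀ w (hlen w) h⟩

end Shape

end

end LittleBoxes

namespace LittleBoxes

noncomputable section

variable {C : Type u} [Category.{v} C]

/-! ### Removing identities from weighted paths -/

namespace WPath

section ScaleLast

variable {V : Type*} {R : V → V → Type*} {x y z : V}

/-- Multiply the weight of the last edge. -/
def scaleLast (c : I) {x : V} : ∀ {y : V}, WPath R x y → WPath R x y
  | _, nil => nil
  | _, cons p f s => cons p f (s * c)

@[simp] theorem scaleLast_one (p : WPath R x y) : p.scaleLast 1 = p := by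
  cases p with
  | nil => rfl
  | cons p f s => simp [scaleLast]

theorem scaleLast_scaleLast (p : WPath R x y) (c c' : I) :
    (p.scaleLast c).scaleLast c' = p.scaleLast (c * c') := by
  cases p with
  | nil => rfl
  | cons p f s => simp [scaleLast, mul_assoc]

theorem lastWeight_scaleLast (p : WPath R x y) (c : I) :
    (p.scaleLast c).lastWeight = p.lastWeight * c := by
  cases p with
  | nil => simp [scaleLast]
  | cons p f s => rfl

theorem fold_scaleLast {o : V → C} (φ : ∀ ⦃x y : V⦄, R x y → (o x ⟶ o y)) (p : WPath R x y)
    (c : I) : (p.scaleLast c).fold φ = p.fold φ := by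
  cases p <;> rfl

end ScaleLast

end WPath

variable {K : Type*} [Category K]

/-- The non-identity morphisms. -/
@[ext]
structure NonId (K : Type*) [Category K] (x y : K) where
  hom : x ⟶ y
  not_isIdentity : ¬ IsIdentity hom

theorem isIdentity_id (x : K) : IsIdentity (𝟙 x) := ⟨rfl, rfl⟩

namespace WPath

variable {x y z : K}

open Classical in
/-- Remove the identities from a path, and multiply the weights in between. -/
def reduce {x : K} : ∀ {y : K}, WPath (fun x y : K => x ⟶ y) x y → WPath (NonId K) x y
  | _, nil => nil
  | _, cons p f s =>
    if h : IsIdentity f then h.choose ▸ (reduce p).scaleLast s else cons (reduce p) ⟨f, h⟩ s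

@[simp] theorem reduce_nil :
    (nil : WPath (fun x y : K => x ⟶ y) x x).reduce = nil := rfl

@[simp] theorem reduce_cons_id (p : WPath (fun x y : K => x ⟶ y) x y) (s : I) :
    (p.cons (𝟙 y) s).reduce = p.reduce.scaleLast s :=
  dif_pos (isIdentity_id y)

theorem reduce_cons_of_not (p : WPath (fun x y : K => x ⟶ y) x y) {f : y ⟶ z}
    (hf : ¬ IsIdentity f) (s : I) : (p.cons f s).reduce = p.reduce.cons ⟨f, hf⟩ s :=
  dif_neg hf

/-- The factor `c` is the product of the weights of the identities at the beginning of `q`: no other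
edge of `q` precedes them, so the last edge of `p.reduce` absorbs them. -/
theorem exists_reduce_comp (q : WPath (fun x y : K => x ⟶ y) y z) :
    ∃ c : I, ∀ {x : K} (p : WPath (fun x y : K => x ⟶ y) x y),
      (p.comp q).reduce = (p.reduce.scaleLast c).comp q.reduce := by
  induction q with
  | nil => exact ⟨1, fun p => by simp⟩
  | cons q f s ih =>
    obtain ⟨c, hc⟩ := ih
    by_cases hf : IsIdentity f
    · obtain ⟨rfl, rfl⟩ := hf
      simp only [eqToHom_refl, comp_cons, reduce_cons_id, hc]
      generalize q.reduce = r
      cases r with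
      | nil =>
        exact ⟨c * s, fun p => scaleLast_scaleLast _ _ _⟩
      | cons r g s' => exact ⟨c, fun p => rfl⟩
    · refine ⟨c, fun p => ?_⟩
      rw [comp_cons, reduce_cons_of_not _ hf, reduce_cons_of_not _ hf, comp_cons, hc]

/-- An identity of weight `0` passes its weight on by multiplication. If no edge is left, the
convention for the empty path applies. -/
theorem lastWeight_reduce (q : WPath (fun x y : K => x ⟶ y) x y) (hq : q.lastWeight = 0) :
    q.reduce.lastWeight = 0 := by
  cases q with
  | nil => rfl
  | cons q f s =>
    have hs : s = 0 := hq
    by_cases hf : IsIdentity f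
    · obtain ⟨rfl, rfl⟩ := hf
      rw [eqToHom_refl, reduce_cons_id, lastWeight_scaleLast, hs, mul_zero]
    · rw [reduce_cons_of_not _ hf, lastWeight_cons, hs]

theorem fold_reduce (P : K ⥤ C) (q : WPath (fun x y : K => x ⟶ y) x y) :
    q.reduce.fold (o := P.obj) (fun _ _ f => P.map f.hom) =
      q.fold (o := P.obj) (fun _ _ f => P.map f) := by
  induction q with
  | nil => rfl
  | cons q f s ih =>
    by_cases hf : IsIdentity f
    · obtain ⟨rfl, rfl⟩ := hf
      rw [eqToHom_refl, reduce_cons_id, fold_scaleLast, ih]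
      simp [fold]
    · simp only [reduce_cons_of_not _ hf, fold, ih]

/-- The weights of the reduced path are products of original weights, so they depend continuously on
them. -/
theorem exists_reduce_setWeights (q : WPath (fun x y : K => x ⟶ y) x y) :
    ∃ θ : (ℕ → I) → (ℕ → I), Continuous θ ∧
      ∀ t, (q.setWeights t).reduce = q.reduce.setWeights (θ t) := by
  induction q with
  | nil => exact ⟨id, continuous_id, fun _ => rfl⟩
  | cons q f s ih =>
    obtain ⟨θ, hθ, h⟩ := ih
    by_cases hf : IsIdentity f
    · obtain ⟨rfl, rfl⟩ := hf
      simp only [eqToHom_refl, reduce_cons_id, setWeights, h]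
      generalize q.reduce = r
      cases r with
      | nil => exact ⟨id, continuous_id, fun _ => rfl⟩
      | cons r g s' =>
        refine ⟨fun t i => if i = r.length then θ t i * t q.length else θ t i, ?_, fun t => ?_⟩
        · refine continuous_pi fun i => ?_
          split_ifs
          · exact ((continuous_apply i).comp hθ).mul (continuous_apply _)
          · exact (continuous_apply i).comp hθ
        · simp only [setWeights, scaleLast, if_true]
          congr 1
          exact setWeights_congr _ fun i hi => (if_neg hi.ne).symm
    · refine ⟨fun t i => if i = q.reduce.length then t q.length else θ t i, ?_, fun t => ?_⟩
      · refine continuous_pi fun i => ?_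
        split_ifs
        · exact continuous_apply _
        · exact (continuous_apply i).comp hθ
      · rw [setWeights, reduce_cons_of_not _ hf, reduce_cons_of_not _ hf, h]
        simp only [setWeights, if_true]
        congr 1
        exact setWeights_congr _ fun i hi => (if_neg hi.ne).symm

end WPath

/-! ### Coherent systems on a category -/

/-- The shape of all morphisms of `K`. -/
abbrev fullShape (P : K ⥤ C) : Shape C K where
  R x y := x ⟶ y
  mul f g := f ≫ g
  mul_assoc := Category.assoc
  obj := P.obj
  map _ _ f := P.map f
  map_mul := P.map_comp

/-- Composites of non-identity morphisms are not identities. -/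
def NonIdClosed (K : Type*) [Category K] : Prop :=
  ∀ ⦃x y z : K⦄ (f : x ⟶ y) (g : y ⟶ z), ¬ IsIdentity f → ¬ IsIdentity g → ¬ IsIdentity (f ≫ g)

/-- The shape of the non-identity morphisms of `K`. -/
abbrev nonIdShape (hK : NonIdClosed K) (P : K ⥤ C) : Shape C K where
  R := NonId K
  mul f g := ⟨f.hom ≫ g.hom, hK _ _ f.2 g.2⟩
  mul_assoc _ _ _ := NonId.ext (Category.assoc _ _ _)
  obj := P.obj
  map _ _ f := P.map f.hom
  map_mul _ _ := P.map_comp _ _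

/-- A coherent system of lifts of the morphisms of `K` along `P`. -/
structure Coherent (P : K ⥤ C) (E : TopOver.{w} C) (Ψ : (fullShape P).Assignment E) : Prop extends
    Shape.CoherentOn (fun _ _ _ => True) Ψ where
  id_first : ∀ ⦃x y⦄ (s : I) (r : WPath (fun x y : K => x ⟶ y) x y),
    Ψ ((WPath.nil.cons (𝟙 x) s).comp r) = Ψ r
  id_mid : ∀ ⦃x y z v⦄ (q : WPath (fun x y : K => x ⟶ y) x y) (f : y ⟶ z) (s s' : I)
    (r : WPath (fun x y : K => x ⟶ y) z v),
    Ψ (((q.cons f s).cons (𝟙 z) s').comp r) = Ψ ((q.cons f (s * s')).comp r)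

namespace Coherent

variable {P : K ⥤ C} {E : TopOver.{w} C}

theorem _root_.LittleBoxes.Shape.CoherentOn.scaleLast {hK : NonIdClosed K}
    {Φ : (nonIdShape hK P).Assignment E} (hΦ : Shape.CoherentOn (fun _ _ _ => True) Φ) {x y : K}
    (p : WPath (NonId K) x y) (c : I) : Φ (p.scaleLast c) = Φ p := by
  cases p with
  | nil => rfl
  | cons p f s => exact hΦ.last p f _ _ trivial

/-- Extend a coherent system from non-identity morphisms to all morphisms. -/
theorem of_nonId {hK : NonIdClosed K} {Φ : (nonIdShape hK P).Assignment E}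
    (hΦ : Shape.CoherentOn (fun _ _ _ => True) Φ) :
    Coherent P E fun _ _ w => Φ (WPath.reduce w) where
  nil x := hΦ.nil x
  proj x y w _ := (hΦ.proj _ trivial).trans (WPath.fold_reduce P w)
  cont x y w _ := by
    obtain ⟨θ, hθ, h⟩ := WPath.exists_reduce_setWeights w
    have h' : (fun t => Φ (WPath.reduce (w.setWeights t))) =
        fun t => Φ ((WPath.reduce w).setWeights (θ t)) := funext fun t => congrArg _ (h t)
    rw [h']
    exact (hΦ.cont _ trivial).comp hθ
  last x y z q f s s' _ := by
    by_cases hf : IsIdentity f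
    · obtain ⟨rfl, rfl⟩ := hf
      rw [eqToHom_refl]
      refine (congrArg _ (WPath.reduce_cons_id q s)).trans
        (Eq.trans ?_ (congrArg _ (WPath.reduce_cons_id q s')).symm)
      rw [hΦ.scaleLast, hΦ.scaleLast]
    · refine (congrArg _ (WPath.reduce_cons_of_not q hf s)).trans
        (Eq.trans ?_ (congrArg _ (WPath.reduce_cons_of_not q hf s')).symm)
      exact hΦ.last _ _ _ _ trivial
  -- The identities at the start of `r` only rescale the last weight of the reduced `q`. It remains
  -- `0`, and the value of `Φ` on the left factor does not depend on it.
  zero x y z q r hq _ := by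
    obtain ⟨c, hc⟩ := WPath.exists_reduce_comp r
    have h1 : ((WPath.reduce q).scaleLast c).lastWeight = 0 := by
      rw [WPath.lastWeight_scaleLast, WPath.lastWeight_reduce q hq, zero_mul]
    refine (congrArg _ (hc q)).trans ((hΦ.zero _ _ h1 trivial).trans ?_)
    rw [hΦ.scaleLast]
  -- An identity `f` of weight `1` is removed without effect. If only `g` is an identity, `f`
  -- receives the weight `1 * s`. If neither is, the composite is again a non-identity and the
  -- condition for `Φ` applies.
  one x y z v v' q f g s r _ := by
    obtain ⟨c, hc⟩ := WPath.exists_reduce_comp r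
    refine (congrArg _ (hc _)).trans (Eq.trans ?_ (congrArg _ (hc _)).symm)
    by_cases hf : IsIdentity f
    · obtain ⟨rfl, rfl⟩ := hf
      have h1 : WPath.reduce ((q.cons (𝟙 y) 1).cons g s) = WPath.reduce (q.cons g s) := by
        by_cases hg : IsIdentity g
        · obtain ⟨rfl, rfl⟩ := hg
          simp
        · rw [WPath.reduce_cons_of_not _ hg, WPath.reduce_cons_of_not _ hg]
          simp
      simp only [eqToHom_refl, Category.id_comp, h1]
    · by_cases hg : IsIdentity g
      · obtain ⟨rfl, rfl⟩ := hg
        simp only [eqToHom_refl, Category.comp_id, WPath.reduce_cons_id,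
          WPath.reduce_cons_of_not _ hf, WPath.scaleLast, one_mul]
      · rw [WPath.reduce_cons_of_not _ hg, WPath.reduce_cons_of_not _ hf,
          WPath.reduce_cons_of_not _ (hK _ _ hf hg)]
        exact hΦ.one _ _ _ _ _ trivial
  id_first x y s r := by
    obtain ⟨c, hc⟩ := WPath.exists_reduce_comp r
    refine (congrArg _ (hc _)).trans ?_
    rw [WPath.reduce_cons_id]
    exact congrArg _ (WPath.nil_comp _)
  id_mid x y z v q f s s' r := by
    obtain ⟨c, hc⟩ := WPath.exists_reduce_comp r
    refine (congrArg _ (hc _)).trans (Eq.trans ?_ (congrArg _ (hc _)).symm)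
    by_cases hf : IsIdentity f
    · obtain ⟨rfl, rfl⟩ := hf
      simp only [eqToHom_refl, WPath.reduce_cons_id, WPath.scaleLast_scaleLast]
    · simp only [WPath.reduce_cons_id, WPath.reduce_cons_of_not _ hf, WPath.scaleLast]

variable {Ψ : (fullShape P).Assignment E}

/-- A coherent system is determined by its values on non-identity morphisms. The tail `r` is
arbitrary so that the induction can move edges one at a time from `w` to the tail. -/
theorem reduce_comp (hΨ : Coherent P E Ψ) {x y z : K} (w : WPath (fun x y : K => x ⟶ y) x y)
    (r : WPath (fun x y : K => x ⟶ y) y z) :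
    Ψ ((w.reduce.map (o := id) fun _ _ f => f.hom).comp r) = Ψ (w.comp r) := by
  induction w with
  | nil => rfl
  | cons q f s ih =>
    have e : (q.cons f s).comp r = q.comp ((WPath.nil.cons f s).comp r) := by
      rw [← WPath.comp_assoc]; rfl
    rw [e, ← ih]
    by_cases hf : IsIdentity f
    · obtain ⟨rfl, rfl⟩ := hf
      rw [eqToHom_refl, WPath.reduce_cons_id]
      generalize q.reduce = p
      cases p with
      | nil =>
        exact (congrArg _ (WPath.nil_comp r)).trans
          ((hΨ.id_first s r).symm.trans (congrArg _ (WPath.nil_comp _)).symm)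
      | cons p g s' =>
        rw [← WPath.comp_assoc]
        exact (hΨ.id_mid _ g.hom s' s r).symm
    · rw [WPath.reduce_cons_of_not _ hf, ← WPath.comp_assoc]
      rfl

theorem reduce (hΨ : Coherent P E Ψ) {x y : K} (w : WPath (fun x y : K => x ⟶ y) x y) :
    Ψ (w.reduce.map (o := id) fun _ _ f => f.hom) = Ψ w :=
  hΨ.reduce_comp w WPath.nil

/-- Restriction to the non-identity morphisms. -/
theorem nonId (hΨ : Coherent P E Ψ) (hK : NonIdClosed K) :
    Shape.CoherentOn (Q := nonIdShape hK P) (E := E) (fun _ _ _ => True)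
      (fun _ _ w => Ψ (w.map (o := id) fun _ _ f => f.hom)) where
  nil x := hΨ.nil x
  proj x y w _ := (hΨ.proj _ trivial).trans (WPath.fold_map (o := id) _ _ _)
  cont x y w _ := by
    simp_rw [WPath.map_setWeights]
    exact hΨ.cont _ trivial
  last x y z q f s s' _ := hΨ.last _ _ _ _ trivial
  zero x y z q r hq _ := by
    rw [WPath.map_comp]
    exact hΨ.zero _ _ (by rwa [WPath.lastWeight_map]) trivial
  one x y z v v' q f g s r _ := by
    rw [WPath.map_comp, WPath.map_comp]
    exact hΨ.one _ _ _ _ _ trivial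

/-- Pull back a coherent system along a functor. -/
theorem comap (hΨ : Coherent P E Ψ) {K' : Type*} [Category K'] (T : K' ⥤ K) :
    Coherent (T ⋙ P) E fun _ _ w => Ψ (w.map (o := T.obj) fun _ _ f => T.map f) where
  nil x := hΨ.nil _
  proj x y w _ := (hΨ.proj _ trivial).trans (WPath.fold_map (o := T.obj) _ _ _)
  cont x y w _ := by
    simp_rw [WPath.map_setWeights]
    exact hΨ.cont _ trivial
  last x y z q f s s' _ := hΨ.last _ _ _ _ trivial
  zero x y z q r hq _ := by
    rw [WPath.map_comp]
    exact hΨ.zero _ _ (by rwa [WPath.lastWeight_map]) trivial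
  one x y z v v' q f g s r _ := by
    simp only [WPath.map_comp, WPath.map_cons, T.map_comp]
    exact hΨ.one _ _ _ _ _ trivial
  id_first x y s r := by
    simp only [WPath.map_comp, WPath.map_cons, WPath.map_nil, T.map_id]
    exact hΨ.id_first _ _
  id_mid x y z v q f s s' r := by
    simp only [WPath.map_comp, WPath.map_cons, T.map_id]
    exact hΨ.id_mid _ _ _ _ _

end Coherent

/-! ### Chains of bounded length -/

/-- If `f ≫ g` were an identity, alternating `f` and `g` would give arbitrarily long chains of
non-identity morphisms. -/
theorem ChainsAtMost.nonIdClosed {n : ℕ} (hK : ChainsAtMost K n) : NonIdClosed K := by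
  rintro x y z f g hf hg ⟨rfl, hfg⟩
  have key : ∀ N : ℕ, ∃ p : Quiver.Path x x, NoIdentities p ∧ N ≤ p.length := by
    intro N
    induction N with
    | zero => exact ⟨Quiver.Path.nil, trivial, le_rfl⟩
    | succ N ih =>
      obtain ⟨p, hp, hN⟩ := ih
      exact ⟨(p.cons f).cons g, ⟨⟨hp, hf⟩, hg⟩, by simp only [Quiver.Path.length_cons]; omega⟩
  obtain ⟨p, hp, hN⟩ := key (n + 1)
  have := hK _ _ p hp
  omega

theorem WPath.exists_path {x y : K} (w : WPath (NonId K) x y) :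
    ∃ p : Quiver.Path x y, NoIdentities p ∧ p.length = w.length := by
  induction w with
  | nil => exact ⟨Quiver.Path.nil, trivial, rfl⟩
  | cons w f s ih =>
    obtain ⟨p, hp, hl⟩ := ih
    exact ⟨p.cons f.hom, ⟨hp, f.2⟩, by simp [hl]⟩

theorem ChainsAtMost.length_le {n : ℕ} (hK : ChainsAtMost K n) {x y : K}
    (w : WPath (NonId K) x y) : w.length ≤ n := by
  obtain ⟨p, hp, hl⟩ := w.exists_path
  exact hl ▸ hK _ _ p hp

/-- Projecting to `C` turns a non-identity morphism into an identity only if the first coordinate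
jumps from `0` to `1`, which happens at most once in a chain. -/
theorem ChainsAtMost.two_prod {n : ℕ} (hC : ChainsAtMost C n) :
    ChainsAtMost (Fin 2 × C) (n + 1) := by
  have key : ∀ (x y : Fin 2 × C) (p : Quiver.Path x y), NoIdentities p →
      ∃ q : Quiver.Path x.2 y.2, NoIdentities q ∧
        p.length + (x.1 : ℕ) ≤ q.length + (y.1 : ℕ) := by
    intro x y p
    induction p with
    | nil => exact fun _ => ⟨Quiver.Path.nil, trivial, le_rfl⟩
    | @cons y z p f ih =>
      rintro ⟨hp, hf⟩
      obtain ⟨q, hq, hl⟩ := ih hp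
      have hle : (y.1 : ℕ) ≤ z.1 := leOfHom f.1
      by_cases h2 : IsIdentity f.2
      · obtain ⟨y1, y2⟩ := y
        obtain ⟨z1, z2⟩ := z
        obtain ⟨h, hf2⟩ := h2
        dsimp only at h
        subst h
        have hne : y1 ≠ z1 := by
          rintro rfl
          refine hf ⟨rfl, Prod.ext (Subsingleton.elim _ _) ?_⟩
          rw [hf2]
          rfl
        have : (y1 : ℕ) ≠ z1 := fun h => hne (Fin.ext h)
        refine ⟨q, hq, ?_⟩
        dsimp only at hle hl ⊢
        rw [Quiver.Path.length_cons]
        omega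
      · refine ⟨q.cons f.2, ⟨hq, h2⟩, ?_⟩
        rw [Quiver.Path.length_cons, Quiver.Path.length_cons]
        omega
  intro x y p hp
  obtain ⟨q, hq, hl⟩ := key x y p hp
  have h1 := hC _ _ q hq
  have h2 := y.1.2
  omega

/-! ### Existence and uniqueness of coherent systems -/

/-- The relative extension theorem with values prescribed on empty paths only. -/
theorem exists_coherent {n k : ℕ} (hK : ChainsAtMost K n) (hnk : n ≤ k) {E : TopOver.{w} C}
    (hE : E.Extends k) (P : K ⥤ C) : ∃ Ψ : (fullShape P).Assignment E, Coherent P E Ψ := by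
  obtain ⟨Φ₀, h₀⟩ := Shape.exists_coherentOn_zero (Q := nonIdShape hK.nonIdClosed P) (E := E)
    (fun _ _ w => hK.length_le w) hnk hE
  obtain ⟨Φ, hΦ, -⟩ := Shape.exists_coherent (fun _ _ w => hK.length_le w) hnk hE
    ⟨fun x y w t h => by rwa [WPath.length_setWeights],
      fun x y z a b h => by rw [WPath.length_comp] at h; omega,
      fun x y z a b h => by rw [WPath.length_comp] at h; omega,
      fun x y z v v' q f g s r h => by simp at h⟩ h₀
  exact ⟨_, Coherent.of_nonId hΦ⟩

theorem WPath.fst_le {x y : Fin 2 × C} (w : WPath (NonId (Fin 2 × C)) x y) : x.1 ≤ y.1 := by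
  induction w with
  | nil => exact le_rfl
  | cons w f s ih => exact ih.trans (leOfHom f.hom.1)

/-- Two coherent systems are the ends of a coherent system on `{0 → 1} × C`, whose value on
single morphisms can be prescribed. -/
theorem exists_coherent_join {n k : ℕ} (hC : ChainsAtMost C n) (hnk : n + 1 ≤ k)
    {E : TopOver.{w} C} (hE : E.Extends k) (P : Fin 2 × C ⥤ C)
    {Ψ₀ Ψ₁ : (fullShape P).Assignment E} (h₀ : Coherent P E Ψ₀) (h₁ : Coherent P E Ψ₁) :
    ∃ Ψ : (fullShape P).Assignment E, Coherent P E Ψ ∧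
      (∀ (x y : C) (w : WPath (fun x y : Fin 2 × C => x ⟶ y) (0, x) (0, y)), Ψ w = Ψ₀ w) ∧
      (∀ (x y : C) (w : WPath (fun x y : Fin 2 × C => x ⟶ y) (1, x) (1, y)), Ψ w = Ψ₁ w) ∧
      ∀ (x y : C) (f : ((0, x) : Fin 2 × C) ⟶ (1, y)) (s : I),
        Ψ (WPath.nil.cons f s) = Ψ₀ (WPath.nil.cons f s) := by
  have hK := hC.two_prod
  have h₀' := h₀.nonId hK.nonIdClosed
  have h₁' := h₁.nonId hK.nonIdClosed
  -- Besides the paths within one layer, single edges can be prescribed freely, as they have no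
  -- proper faces. On edges from layer `0` to layer `1` the value of `Ψ₀` is used.
  let D : ∀ ⦃x y : Fin 2 × C⦄, WPath (NonId (Fin 2 × C)) x y → Prop := fun x y w =>
    x.1 = y.1 ∨ w.length ≤ 1
  let Φ₀ : (nonIdShape hK.nonIdClosed P).Assignment E := fun x y w =>
    if x.1 = 0 then Ψ₀ (w.map (o := id) fun _ _ f => f.hom)
    else Ψ₁ (w.map (o := id) fun _ _ f => f.hom)
  have hΦ₀ : Shape.CoherentOn D Φ₀ := by
    refine ⟨fun x => ?_, fun x y w _ => ?_, fun x y w _ => ?_, fun x y z q f s s' _ => ?_,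
      fun x y z q r hq hD => ?_, fun x y z v v' q f g s r _ => ?_⟩
    · by_cases hx : x.1 = 0
      · simpa only [Φ₀, if_pos hx] using h₀'.nil x
      · simpa only [Φ₀, if_neg hx] using h₁'.nil x
    · by_cases hx : x.1 = 0
      · simpa only [Φ₀, if_pos hx] using h₀'.proj w trivial
      · simpa only [Φ₀, if_neg hx] using h₁'.proj w trivial
    · by_cases hx : x.1 = 0
      · simpa only [Φ₀, if_pos hx] using h₀'.cont w trivial
      · simpa only [Φ₀, if_neg hx] using h₁'.cont w trivial
    · by_cases hx : x.1 = 0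
      · simpa only [Φ₀, if_pos hx] using h₀'.last q f s s' trivial
      · simpa only [Φ₀, if_neg hx] using h₁'.last q f s s' trivial
    · cases r with
      | nil =>
        by_cases hx : y.1 = 0
        · simp only [Φ₀, if_pos hx]
          exact (E.comp_one _).symm.trans (congrArg _ (h₀'.nil y).symm)
        · simp only [Φ₀, if_neg hx]
          exact (E.comp_one _).symm.trans (congrArg _ (h₁'.nil y).symm)
      | cons r f s =>
        cases q with
        | nil =>
          by_cases hx : x.1 = 0
          · simp only [Φ₀, if_pos hx, WPath.nil_comp]
            exact (E.one_comp _).symm.trans (congrArg (E.comp · _) (h₀'.nil x).symm)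
          · simp only [Φ₀, if_neg hx, WPath.nil_comp]
            exact (E.one_comp _).symm.trans (congrArg (E.comp · _) (h₁'.nil x).symm)
        | cons q g s' =>
          -- Two nonempty factors have total length at least `2`, so the path stays in one layer,
          -- and its intermediate vertex does too.
          have hxy : x.1 = y.1 := by
            rcases hD with hD | hD
            · exact le_antisymm (WPath.fst_le (q.cons g s'))
                (hD ▸ WPath.fst_le (r.cons f s))
            · simp at hD
          by_cases hx : x.1 = 0
          · have hy : y.1 = 0 := hxy ▸ hx
            simp only [Φ₀, if_pos hx, if_pos hy]
            exact h₀'.zero _ _ hq trivial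
          · have hy : ¬ y.1 = 0 := hxy ▸ hx
            simp only [Φ₀, if_neg hx, if_neg hy]
            exact h₁'.zero _ _ hq trivial
    · by_cases hx : x.1 = 0
      · simpa only [Φ₀, if_pos hx] using h₀'.one q f g s r trivial
      · simpa only [Φ₀, if_neg hx] using h₁'.one q f g s r trivial
  have hD : Shape.FaceClosed (Q := nonIdShape hK.nonIdClosed P) D := by
    refine ⟨fun x y w t h => ?_, fun x y z a b h => ?_, fun x y z a b h => ?_,
      fun x y z v v' q f g s r h => ?_⟩
    · rcases h with h | h
      · exact Or.inl h
      · exact Or.inr (by rwa [WPath.length_setWeights])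
    · rcases h with h | h
      · exact Or.inl (le_antisymm a.fst_le (h ▸ b.fst_le))
      · exact Or.inr (by rw [WPath.length_comp] at h; omega)
    · rcases h with h | h
      · exact Or.inl (le_antisymm b.fst_le (h ▸ a.fst_le))
      · exact Or.inr (by rw [WPath.length_comp] at h; omega)
    · rcases h with h | h
      · exact Or.inl h
      · simp only [WPath.length_comp, WPath.length_cons] at h
        omega
  obtain ⟨Φ, hΦ, hΦD⟩ := Shape.exists_coherent (fun _ _ w => hK.length_le w) hnk hE hD hΦ₀
  refine ⟨_, Coherent.of_nonId hΦ, fun x y w => ?_, fun x y w => ?_, fun x y f s => ?_⟩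
  · refine (hΦD w.reduce (Or.inl rfl)).trans (Eq.trans ?_ (h₀.reduce w))
    exact if_pos rfl
  · refine (hΦD w.reduce (Or.inl rfl)).trans (Eq.trans ?_ (h₁.reduce w))
    exact if_neg (by simp)
  · have hf : ¬ IsIdentity f := fun ⟨h, _⟩ => by simpa using congrArg Prod.fst h
    rw [hΦD _ (Or.inr (by rw [WPath.reduce_cons_of_not _ hf]; simp))]
    exact (if_pos rfl).trans (h₀.reduce _)

end

end LittleBoxes

namespace LittleBoxes

noncomputable section

variable {C : Type u} [Category.{v} C]

/-! ### Sub-boxes and reflections -/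

namespace Box

variable {k : ℕ}

theorem sub_assoc (A B D : Box k) : (A.sub B).sub D = A.sub (B.sub D) := by
  ext i
  · simp only [sub]; ring
  · simp only [sub]; ring

theorem reflect_one (B : Box k) : reflect 1 B = B := by
  have h : ¬ (1 : ℤˣ) = -1 := by decide
  ext i <;> simp [reflect, h]

theorem reflect_full (ε : ℤˣ) : reflect ε (full k) = full k := by
  ext i <;> simp [reflect, full]

theorem sub_full (B : Box k) : B.sub (full k) = B := by
  ext i <;> simp [sub, full]

theorem full_sub (B : Box k) : (full k).sub B = B := by
  ext i <;> simp [sub, full]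

theorem reflect_sub (ε : ℤˣ) (A B : Box k) :
    reflect ε (A.sub B) = (reflect ε A).sub (reflect ε B) := by
  ext i
  · simp only [reflect, sub]
    split_ifs
    · ring
    · rfl
  · simp only [reflect, sub]
    split_ifs
    · ring
    · rfl

theorem reflect_reflect (ε ε' : ℤˣ) (B : Box k) :
    reflect ε (reflect ε' B) = reflect (ε * ε') B := by
  rcases Int.units_eq_one_or ε with rfl | rfl
  · rw [reflect_one, one_mul]
  · rcases Int.units_eq_one_or ε' with rfl | rfl
    · rw [reflect_one, mul_one]
    · rw [show (-1 : ℤˣ) * -1 = 1 by decide, reflect_one]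
      ext i
      · simp only [reflect]
        split_ifs <;> simp
      · simp only [reflect]
        split_ifs <;> simp

theorem reflectPoint_reflectPoint (ε : ℤˣ) (c : Fin k → I) :
    reflectPoint ε (reflectPoint ε c) = c := by
  funext i
  simp only [reflectPoint]
  split_ifs <;> simp

theorem reflectPoint_reflectPoint_mul (ε ε' : ℤˣ) (c : Fin k → I) :
    reflectPoint ε (reflectPoint ε' c) = reflectPoint (ε * ε') c := by
  have h1 : ∀ c : Fin k → I, reflectPoint 1 c = c := fun c =>
    funext fun i => if_neg fun h => absurd h.1 (by decide)
  rcases Int.units_eq_one_or ε with rfl | rfl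
  · rw [h1, one_mul]
  · rcases Int.units_eq_one_or ε' with rfl | rfl
    · rw [h1, mul_one]
    · rw [show (-1 : ℤˣ) * -1 = 1 by decide, h1, reflectPoint_reflectPoint]

theorem mem_interior_reflect {ε : ℤˣ} {B : Box k} {c : Fin k → I} :
    c ∈ (reflect ε B).interior ↔ reflectPoint ε c ∈ B.interior := by
  refine forall_congr' fun i => ?_
  simp only [reflect, reflectPoint]
  split_ifs
  · simp only [unitInterval.coe_symm_eq]
    constructor <;> rintro ⟨h1, h2⟩ <;> constructor <;> linarith
  · rfl

theorem coe_rescale {B : Box k} {c : Fin k → I} (hc : c ∈ B.interior) (i : Fin k) :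
    (B.rescale c i : ℝ) = (c i - B.lo i) / (B.hi i - B.lo i) := by
  have h := B.lo_lt_hi i
  have h1 := (hc i).1
  have h2 := (hc i).2
  have h3 : 0 < B.hi i - B.lo i := by linarith
  refine congrArg Subtype.val (Set.projIcc_of_mem zero_le_one ⟨?_, ?_⟩)
  · exact div_nonneg (by linarith) h3.le
  · rw [div_le_one h3]; linarith

theorem interior_sub_subset (A B : Box k) : (A.sub B).interior ⊆ A.interior := by
  intro c hc i
  obtain ⟨h1, h2⟩ := hc i
  have h3 : 0 < A.hi i - A.lo i := sub_pos.2 (A.lo_lt_hi i)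
  have h4 := mul_nonneg h3.le (B.lo_nonneg i)
  have h5 := mul_le_mul_of_nonneg_left (B.hi_le_one i) h3.le
  simp only [sub] at h1 h2
  constructor <;> linarith

theorem mem_interior_sub {A B : Box k} {c : Fin k → I} :
    c ∈ (A.sub B).interior ↔ c ∈ A.interior ∧ A.rescale c ∈ B.interior := by
  constructor
  · intro hc
    have hA := interior_sub_subset A B hc
    refine ⟨hA, fun i => ?_⟩
    rw [coe_rescale hA i]
    have h3 : 0 < A.hi i - A.lo i := sub_pos.2 (A.lo_lt_hi i)
    obtain ⟨h1, h2⟩ := hc i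
    simp only [sub] at h1 h2
    rw [lt_div_iff₀ h3, div_lt_iff₀ h3]
    constructor <;> linarith
  · rintro ⟨hA, hB⟩ i
    have h3 : 0 < A.hi i - A.lo i := sub_pos.2 (A.lo_lt_hi i)
    obtain ⟨h1, h2⟩ := hB i
    rw [coe_rescale hA i, lt_div_iff₀ h3] at h1
    rw [coe_rescale hA i, div_lt_iff₀ h3] at h2
    simp only [sub]
    constructor <;> linarith

theorem rescale_sub {A B : Box k} {c : Fin k → I} (hc : c ∈ A.interior) :
    (A.sub B).rescale c = B.rescale (A.rescale c) := by
  funext i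
  simp only [rescale]
  congr 1
  have h := coe_rescale hc i
  simp only [rescale] at h
  rw [h]
  have h3 : A.hi i - A.lo i ≠ 0 := (sub_pos.2 (A.lo_lt_hi i)).ne'
  have h4 : B.hi i - B.lo i ≠ 0 := (sub_pos.2 (B.lo_lt_hi i)).ne'
  have h5 : (A.sub B).hi i - (A.sub B).lo i = (A.hi i - A.lo i) * (B.hi i - B.lo i) := by
    simp only [sub]; ring
  rw [h5]
  simp only [sub]
  field_simp
  ring

theorem rescale_reflect (ε : ℤˣ) (B : Box k) (c : Fin k → I) (hc : reflectPoint ε c ∈ B.interior) :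
    (reflect ε B).rescale c = reflectPoint ε (B.rescale (reflectPoint ε c)) := by
  funext i
  refine Subtype.ext ?_
  rw [coe_rescale (mem_interior_reflect.2 hc)]
  have h := coe_rescale hc i
  simp only [reflectPoint] at h ⊢
  have h3 : B.hi i - B.lo i ≠ 0 := (sub_pos.2 (B.lo_lt_hi i)).ne'
  by_cases hi : ε = -1 ∧ (i : ℕ) = 0
  · simp only [reflect, if_pos hi] at h ⊢
    rw [unitInterval.coe_symm_eq] at h ⊢
    have h5 : 1 - B.lo i - (1 - B.hi i) ≠ 0 := by
      intro h6; apply h3; linarith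
    rw [h]
    field_simp
    ring
  · simp only [reflect, if_neg hi] at h ⊢
    exact h.symm

theorem continuous_sub {T : Type*} [TopologicalSpace T] {A B : T → Box k} (hA : Continuous A)
    (hB : Continuous B) : Continuous fun t => (A t).sub (B t) := by
  rw [continuous_iff] at hA hB ⊢
  have a1 := fun i => (continuous_apply i).comp hA.1
  have a2 := fun i => (continuous_apply i).comp hA.2
  have b1 := fun i => (continuous_apply i).comp hB.1
  have b2 := fun i => (continuous_apply i).comp hB.2
  exact ⟨continuous_pi fun i => (a1 i).add (((a2 i).sub (a1 i)).mul (b1 i)),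
    continuous_pi fun i => (a1 i).add (((a2 i).sub (a1 i)).mul (b2 i))⟩

theorem continuous_reflect {T : Type*} [TopologicalSpace T] {A : T → Box k} (hA : Continuous A)
    (ε : ℤˣ) : Continuous fun t => reflect ε (A t) := by
  rw [continuous_iff] at hA ⊢
  have a1 := fun i => (continuous_apply i).comp hA.1
  have a2 := fun i => (continuous_apply i).comp hA.2
  refine ⟨continuous_pi fun i => ?_, continuous_pi fun i => ?_⟩
  · by_cases hi : ε = -1 ∧ (i : ℕ) = 0
    · simp only [reflect, if_pos hi]
      exact continuous_const.sub (a2 i)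
    · simp only [reflect, if_neg hi]
      exact a1 i
  · by_cases hi : ε = -1 ∧ (i : ℕ) = 0
    · simp only [reflect, if_pos hi]
      exact continuous_const.sub (a1 i)
    · simp only [reflect, if_neg hi]
      exact a2 i

end Box

/-! ### The laws satisfied by the labels -/

variable {G : Type} [Group G]

/-- The laws satisfied by the labels of a functor to one of the Burnside categories. -/
structure Labels.Lawful (L : Labels.{w} G C) : Prop where
  finite : ∀ {x y : C} (f : x ⟶ y), Finite (L.lab f)
  one_smul : ∀ {x y : C} (f : x ⟶ y) (a : L.lab f), L.labSmul f 1 a = a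
  mul_smul : ∀ {x y : C} (f : x ⟶ y) (g h : G) (a : L.lab f),
    L.labSmul f (g * h) a = L.labSmul f g (L.labSmul f h a)
  free : ∀ (x : C) (g : G) (a : L.obj x), g • a = a → g = 1
  src_smul : ∀ {x y : C} (f : x ⟶ y) (g : G) (a : L.lab f),
    L.src f (L.labSmul f g a) = g • L.src f a
  tgt_smul : ∀ {x y : C} (f : x ⟶ y) (g : G) (a : L.lab f),
    L.tgt f (L.labSmul f g a) = g • L.tgt f a
  sgn_smul : ∀ {x y : C} (f : x ⟶ y) (g : G) (a : L.lab f),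
    L.sgn f (L.labSmul f g a) = L.sgn f a
  src_comp : ∀ {x y z : C} (f : x ⟶ y) (g : y ⟶ z) (a : L.lab f) (b : L.lab g) h,
    L.src (f ≫ g) (L.comp f g a b h) = L.src f a
  tgt_comp : ∀ {x y z : C} (f : x ⟶ y) (g : y ⟶ z) (a : L.lab f) (b : L.lab g) h,
    L.tgt (f ≫ g) (L.comp f g a b h) = L.tgt g b
  sgn_comp : ∀ {x y z : C} (f : x ⟶ y) (g : y ⟶ z) (a : L.lab f) (b : L.lab g) h,
    L.sgn (f ≫ g) (L.comp f g a b h) = L.sgn g b * L.sgn f a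
  smul_comp : ∀ {x y z : C} (f : x ⟶ y) (g : y ⟶ z) (γ : G) (a : L.lab f) (b : L.lab g) h h',
    L.labSmul (f ≫ g) γ (L.comp f g a b h) = L.comp f g (L.labSmul f γ a) (L.labSmul g γ b) h'
  comp_inj : ∀ {x y z : C} (f : x ⟶ y) (g : y ⟶ z) (a a' : L.lab f) (b b' : L.lab g) h h',
    L.comp f g a b h = L.comp f g a' b' h' → a = a' ∧ b = b'
  comp_surj : ∀ {x y z : C} (f : x ⟶ y) (g : y ⟶ z) (c : L.lab (f ≫ g)),
    ∃ a b h, L.comp f g a b h = c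
  assoc : ∀ {x y z v : C} (f : x ⟶ y) (g : y ⟶ z) (h : z ⟶ v) (a : L.lab f) (b : L.lab g)
    (c : L.lab h) h₁ h₂ h₃ h₄, L.cast (Category.assoc f g h)
      (L.comp (f ≫ g) h (L.comp f g a b h₁) c h₂) = L.comp f (g ≫ h) a (L.comp g h b c h₃) h₄
  src_id : ∀ x : C, Function.Bijective (L.src (𝟙 x))
  tgt_id : ∀ (x : C) (a : L.lab (𝟙 x)), L.tgt (𝟙 x) a = L.src (𝟙 x) a
  sgn_id : ∀ (x : C) (a : L.lab (𝟙 x)), L.sgn (𝟙 x) a = 1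
  id_comp : ∀ {x y : C} (f : x ⟶ y) (i : L.lab (𝟙 x)) (a : L.lab f) h,
    L.cast (Category.id_comp f) (L.comp (𝟙 x) f i a h) = a
  comp_id : ∀ {x y : C} (f : x ⟶ y) (a : L.lab f) (i : L.lab (𝟙 y)) h,
    L.cast (Category.comp_id f) (L.comp f (𝟙 y) a i h) = a

/-! ### The category of box arrows -/

/-- Invariant box configurations refining `f`. -/
abbrev Conf (L : Labels.{w} G C) (k : ℕ) {x y : C} (f : x ⟶ y) : Type w :=
  {e : L.lab f → Box k // e ∈ BoxConfig k (L.src f) ∧ ∀ g a, e (L.labSmul f g a) = e a}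

/-- Morphisms of `C` with a box configuration refining them. -/
abbrev BoxArr (L : Labels.{w} G C) (k : ℕ) (x y : C) := Σ f : x ⟶ y, Conf L k f

namespace Conf

variable {L : Labels.{w} G C} {k : ℕ} {x y z : C}

theorem mk_eq_mk {f f' : x ⟶ y} {e : Conf L k f} {e' : Conf L k f'} :
    (⟨f, e⟩ : BoxArr L k x y) = ⟨f', e'⟩ ↔ ∃ h : f = f', ∀ a, e'.1 (L.cast h a) = e.1 a := by
  constructor
  · intro h
    cases h
    exact ⟨rfl, fun _ => rfl⟩
  · rintro ⟨rfl, h⟩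
    congr 1
    exact Subtype.ext (funext fun a => (h a).symm)

theorem continuous_iff {T : Type*} [TopologicalSpace T] {f : x ⟶ y} {e : T → Conf L k f} :
    Continuous e ↔ ∀ a, Continuous fun t => (e t).1 a :=
  Topology.IsInducing.subtypeVal.continuous_iff.trans _root_.continuous_pi_iff

variable (hL : L.Lawful)

/-- The boxes of a composite. -/
def compBox {f : x ⟶ y} {g : y ⟶ z} (e : Conf L k f) (e' : Conf L k g) (c : L.lab (f ≫ g)) :
    Box k :=
  (e.1 (hL.comp_surj f g c).choose).sub
    (Box.reflect (L.sgn f (hL.comp_surj f g c).choose)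
      (e'.1 (hL.comp_surj f g c).choose_spec.choose))

/-- The pair of labels chosen in `compBox` is unique by `comp_inj`, so it is the given one. -/
theorem compBox_comp {f : x ⟶ y} {g : y ⟶ z} (e : Conf L k f) (e' : Conf L k g) (a : L.lab f)
    (b : L.lab g) (h : L.tgt f a = L.src g b) :
    compBox hL e e' (L.comp f g a b h) = (e.1 a).sub (Box.reflect (L.sgn f a) (e'.1 b)) := by
  obtain ⟨h1, h2⟩ := hL.comp_inj _ _ _ _ _ _ _ _
    (hL.comp_surj f g (L.comp f g a b h)).choose_spec.choose_spec.choose_spec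
  exact congrArg₂ (fun a b => (e.1 a).sub (Box.reflect (L.sgn f a) (e'.1 b))) h1 h2

/-- Composition of box configurations. -/
def comp {f : x ⟶ y} {g : y ⟶ z} (e : Conf L k f) (e' : Conf L k g) : Conf L k (f ≫ g) :=
  ⟨compBox hL e e', by
    intro c c' hne hs
    obtain ⟨a, b, h, rfl⟩ := hL.comp_surj f g c
    obtain ⟨a', b', h', rfl⟩ := hL.comp_surj f g c'
    rw [hL.src_comp, hL.src_comp] at hs
    rw [compBox_comp, compBox_comp]
    -- Two boxes inside the same box `a` are separated by `e'`, since `b` and `b'` share the source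
    -- `t(a)`. Otherwise the surrounding boxes are already disjoint.
    by_cases ha : a = a'
    · subst ha
      have hb : b ≠ b' := fun hb => hne (by subst hb; rfl)
      have hd := e'.2.1 b b' hb (h.symm.trans h')
      refine Set.disjoint_left.2 fun p hp hp' => ?_
      exact Set.disjoint_left.1 hd (Box.mem_interior_reflect.1 (Box.mem_interior_sub.1 hp).2)
        (Box.mem_interior_reflect.1 (Box.mem_interior_sub.1 hp').2)
    · exact (e.2.1 a a' ha hs).mono (Box.interior_sub_subset _ _) (Box.interior_sub_subset _ _),
    by
    intro γ c
    obtain ⟨a, b, h, rfl⟩ := hL.comp_surj f g c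
    rw [hL.smul_comp f g γ a b h (by rw [hL.tgt_smul, hL.src_smul, h]), compBox_comp, compBox_comp,
      hL.sgn_smul, e.2.2, e'.2.2]⟩

/-- The identity configuration, consisting of full cubes. -/
def one (k : ℕ) (x : C) : Conf L k (𝟙 x) :=
  ⟨fun _ => Box.full k, fun _ _ hab h => absurd ((hL.src_id x).1 h) hab, fun _ _ => rfl⟩

theorem one_comp {f : x ⟶ y} (e : Conf L k f) :
    (⟨𝟙 x ≫ f, comp hL (one hL k x) e⟩ : BoxArr L k x y) = ⟨f, e⟩ := by
  refine mk_eq_mk.2 ⟨Category.id_comp f, fun c => ?_⟩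
  obtain ⟨i, a, h, rfl⟩ := hL.comp_surj _ _ c
  rw [hL.id_comp]
  refine Eq.trans ?_ (compBox_comp hL _ _ _ _ _).symm
  rw [hL.sgn_id, Box.reflect_one]
  exact (Box.full_sub _).symm

theorem comp_one {f : x ⟶ y} (e : Conf L k f) :
    (⟨f ≫ 𝟙 y, comp hL e (one hL k y)⟩ : BoxArr L k x y) = ⟨f, e⟩ := by
  refine mk_eq_mk.2 ⟨Category.comp_id f, fun c => ?_⟩
  obtain ⟨a, i, h, rfl⟩ := hL.comp_surj _ _ c
  rw [hL.comp_id]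
  refine Eq.trans ?_ (compBox_comp hL _ _ _ _ _).symm
  exact ((congrArg _ (Box.reflect_full _)).trans (Box.sub_full _)).symm

/-- Reflection commutes with the formation of sub-boxes, and iterated reflections multiply as the
signs do under `σ(b, a) = σ(b) σ(a)`. -/
theorem assoc {v : C} {f : x ⟶ y} {g : y ⟶ z} {h : z ⟶ v} (e : Conf L k f) (e' : Conf L k g)
    (e'' : Conf L k h) : (⟨(f ≫ g) ≫ h, comp hL (comp hL e e') e''⟩ : BoxArr L k x v) =
      ⟨f ≫ g ≫ h, comp hL e (comp hL e' e'')⟩ := by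
  refine mk_eq_mk.2 ⟨Category.assoc f g h, fun p => ?_⟩
  obtain ⟨q, c, h1, rfl⟩ := hL.comp_surj _ _ p
  obtain ⟨a, b, h2, rfl⟩ := hL.comp_surj _ _ q
  have h3 : L.tgt g b = L.src h c := by rw [← h1, hL.tgt_comp]
  rw [hL.assoc f g h a b c h2 h1 h3 (by rw [hL.src_comp, h2])]
  have e1 : (comp hL e (comp hL e' e'')).1 (L.comp f (g ≫ h) a (L.comp g h b c h3)
      (by rw [hL.src_comp, h2])) = _ := compBox_comp hL _ _ _ _ _
  have e2 : (comp hL e' e'').1 (L.comp g h b c h3) = _ := compBox_comp hL _ _ _ _ _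
  have e3 : (comp hL (comp hL e e') e'').1 (L.comp (f ≫ g) h (L.comp f g a b h2) c h1) = _ :=
    compBox_comp hL _ _ _ _ _
  have e4 : (comp hL e e').1 (L.comp f g a b h2) = _ := compBox_comp hL _ _ _ _ _
  rw [e1, e2, e3, e4, hL.sgn_comp, Box.sub_assoc, Box.reflect_sub, Box.reflect_reflect, mul_comm]

/-- `BoxArr` is a disjoint union over morphisms, so `f` and `g` are locally constant. With both
fixed, each box of the composite is given by an explicit formula in two boxes. -/
theorem continuous_comp : Continuous fun p : BoxArr L k x y × BoxArr L k y z =>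
    (⟨p.1.1 ≫ p.2.1, comp hL p.1.2 p.2.2⟩ : BoxArr L k x z) := by
  refine continuous_iff_continuousAt.2 ?_
  rintro ⟨⟨f, e⟩, ⟨g, e'⟩⟩
  have h1 : Topology.IsOpenEmbedding (Sigma.mk f : Conf L k f → BoxArr L k x y) := .sigmaMk
  have h2 : Topology.IsOpenEmbedding (Sigma.mk g : Conf L k g → BoxArr L k y z) := .sigmaMk
  refine ((h1.prodMap h2).continuousAt_iff (x := (e, e'))).1 (Continuous.continuousAt ?_)
  suffices h5 : Continuous fun p : Conf L k f × Conf L k g => comp hL p.1 p.2 from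
    (Topology.IsOpenEmbedding.sigmaMk.continuous :
      Continuous (Sigma.mk (f ≫ g) : _ → BoxArr L k x z)).comp h5
  refine continuous_iff.2 fun c => ?_
  have h3 : ∀ a, Continuous fun p : Conf L k f × Conf L k g => p.1.1 a := fun a =>
    (continuous_apply a).comp (continuous_subtype_val.comp continuous_fst)
  have h4 : ∀ b, Continuous fun p : Conf L k f × Conf L k g => p.2.1 b := fun b =>
    (continuous_apply b).comp (continuous_subtype_val.comp continuous_snd)
  exact Box.continuous_sub (h3 _) (Box.continuous_reflect (h4 _) _)

end Conf

/-- The inclusion of a summand of the disjoint union is an embedding, so continuity can be tested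
among configurations over `f`. -/
theorem BoxArr.exists_conf {L : Labels.{w} G C} {k : ℕ} {x y : C} {T : Type*} [TopologicalSpace T] {γ : T → BoxArr L k x y} (hγ : Continuous γ)
    {f : x ⟶ y} (h : ∀ t, (γ t).1 = f) :
    ∃ c : T → Conf L k f, Continuous c ∧ ∀ t, γ t = ⟨f, c t⟩ := by
  have hc : ∀ t, ∃ c : Conf L k f, γ t = ⟨f, c⟩ := by
    intro t
    have h := h t
    generalize γ t = a at h
    obtain ⟨f', c⟩ := a
    cases h
    exact ⟨c, rfl⟩
  choose c hc using hc
  refine ⟨c, ?_, hc⟩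
  have h1 : Topology.IsEmbedding (Sigma.mk f : Conf L k f → BoxArr L k x y) := .sigmaMk
  refine h1.continuous_iff.2 ?_
  rwa [show Sigma.mk f ∘ c = γ from funext fun t => (hc t).symm]

/-- The topological category of box configurations refining the morphisms of `C`. -/
def boxCat {L : Labels.{w} G C} (hL : L.Lawful) (k : ℕ) : TopOver.{max v w} C where
  hom x y := BoxArr L k x y
  proj a := a.1
  one x := ⟨𝟙 x, Conf.one hL k x⟩
  comp a b := ⟨a.1 ≫ b.1, Conf.comp hL a.2 b.2⟩
  one_comp a := Conf.one_comp hL a.2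
  comp_one a := Conf.comp_one hL a.2
  assoc a b c := Conf.assoc hL a.2 b.2 c.2
  proj_one _ := rfl
  proj_comp _ _ := rfl
  continuous_comp := Conf.continuous_comp hL

/-- An invariant configuration is a family of boxes indexed by the orbits of labels, so
`exists_box_extension` is applied to the set of orbits. Two orbits need disjoint boxes when they
contain distinct labels with a common source. -/
theorem boxCat_extends {L : Labels.{w} G C} (hL : L.Lawful) (k : ℕ) : (boxCat hL k).Extends k := by
  classical
  intro d hd x y f S hS g hg hgf
  obtain ⟨c, hcc, hc⟩ := BoxArr.exists_conf hg hgf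
  have := hL.finite f
  let st : Setoid (L.lab f) :=
    { r := fun a b => ∃ γ : G, L.labSmul f γ a = b
      iseqv :=
        { refl := fun a => ⟨1, hL.one_smul f a⟩
          symm := by
            rintro a b ⟨γ, rfl⟩
            exact ⟨γ⁻¹, by rw [← hL.mul_smul, inv_mul_cancel, hL.one_smul]⟩
          trans := by
            rintro a b c ⟨γ, rfl⟩ ⟨γ', rfl⟩
            exact ⟨γ' * γ, hL.mul_smul f _ _ _⟩ } }
  have hout : ∀ (e : Conf L k f) (a : L.lab f), e.1 (Quotient.mk st a).out = e.1 a := by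
    intro e a
    obtain ⟨γ, hγ⟩ : ∃ γ : G, L.labSmul f γ (Quotient.mk st a).out = a := Quotient.mk_out a
    conv_rhs => rw [← hγ, e.2.2]
  let R : Quotient st → Quotient st → Prop := fun p q =>
    ∃ a b : L.lab f, Quotient.mk st a = p ∧ Quotient.mk st b = q ∧ a ≠ b ∧ L.src f a = L.src f b
  -- Here freeness is used: a group element that carries a label to another one with the same source
  -- fixes this source, so it is trivial.
  have hR : ∀ p, ¬ R p p := by
    rintro p ⟨a, b, rfl, hb, hne, hs⟩
    obtain ⟨γ, hγ⟩ : ∃ γ : G, L.labSmul f γ b = a := Quotient.exact hb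
    rw [← hγ, hL.src_smul] at hs
    rw [hL.free _ γ _ hs, hL.one_smul] at hγ
    exact hne hγ.symm
  obtain ⟨e, he, heS, hdis⟩ := exists_box_extension hd R hR hS
    (e := fun t p => if h : t ∈ S then (c ⟨t, h⟩).1 p.out else Box.full k) (by
      rw [continuousOn_iff_continuous_domRestrict]
      refine continuous_pi fun p => ?_
      convert Conf.continuous_iff.1 hcc p.out using 1
      exact funext fun t => dif_pos t.2) (by
      rintro t ht p q ⟨a, b, rfl, rfl, hne, hs⟩
      simp only [dif_pos ht, hout]
      exact (c ⟨t, ht⟩).2.1 a b hne hs)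
  refine ⟨fun t => ⟨f, ⟨fun a => e t (Quotient.mk st a), fun a b hne hs =>
    hdis t _ _ ⟨a, b, rfl, rfl, hne, hs⟩, fun γ a => ?_⟩⟩, ?_, ?_, fun _ => rfl⟩
  · exact congrArg (e t) (Quotient.sound (s := st) ⟨γ⁻¹, by
      rw [← hL.mul_smul, inv_mul_cancel, hL.one_smul]⟩)
  · refine continuous_sigmaMk.comp (Conf.continuous_iff.2 fun a => ?_)
    exact (continuous_apply (Quotient.mk st a)).comp he
  · intro t
    rw [hc t]
    refine congrArg (Sigma.mk f) (Subtype.ext (funext fun a => ?_))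
    refine (congrFun (heS t.2) _).trans ?_
    simp only [dif_pos t.2, hout]

end

end LittleBoxes

namespace LittleBoxes

noncomputable section

variable {C : Type u} [Category.{v} C] {K : Type*} [Category K]

/-! ### Coherent systems indexed by paths and parameters -/

/-- The compatibility conditions of homotopy coherent diagrams for lifts of the morphisms of `K`
along `P`. -/
structure PathCoherent (P : K ⥤ C) (E : TopOver.{w} C)
    (φ : ∀ ⦃x y : K⦄ (p : Quiver.Path x y), (Fin (p.length - 1) → I) → E.hom (P.obj x) (P.obj y)) :
    Prop where
  proj : ∀ ⦃x y⦄ (p : Quiver.Path x y) t, E.proj (φ p t) = P.map (composePath p)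
  cont : ∀ ⦃x y⦄ (p : Quiver.Path x y), Continuous (φ p)
  nil : ∀ (x : K) t, φ (Quiver.Path.nil : Quiver.Path x x) t = E.one _
  id_first : ∀ ⦃x y : K⦄ (r : Quiver.Path x y) (t : ℕ → I),
    φ ((𝟙 x : x ⟶ x).toPath.comp r) (cut t) = φ r (cut (shift 1 t))
  id_mid : ∀ ⦃x y z : K⦄ (q : Quiver.Path x y) (r : Quiver.Path y z), 0 < q.length →
    0 < r.length → ∀ t : ℕ → I,
    φ ((q.cons (𝟙 y)).comp r) (cut t) = φ (q.comp r) (cut (merge q.length t))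
  id_last : ∀ ⦃x y : K⦄ (q : Quiver.Path x y) (t : ℕ → I),
    φ (q.cons (𝟙 y)) (cut t) = φ q (cut t)
  zero : ∀ ⦃x y z : K⦄ (q : Quiver.Path x y) (r : Quiver.Path y z), 0 < q.length →
    0 < r.length → ∀ t : ℕ → I, t (q.length - 1) = 0 →
    φ (q.comp r) (cut t) = E.comp (φ q (cut t)) (φ r (cut (shift q.length t)))
  one : ∀ ⦃x y z y' : K⦄ (q : Quiver.Path x y) (f : y ⟶ z) (g : z ⟶ y')
    ⦃z' : K⦄ (r : Quiver.Path y' z') (t : ℕ → I), t q.length = 1 →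
    φ (((q.cons f).cons g).comp r) (cut t) = φ ((q.cons (f ≫ g)).comp r) (cut (dropAt q.length t))

/-! ### Translation between weighted paths and paths with parameters. -/

namespace WPath

variable {x y z : K}

/-- A path with all weights equal to `1`. -/
def ofPath {x : K} : ∀ {y : K}, Quiver.Path x y → WPath (fun x y : K => x ⟶ y) x y
  | _, .nil => nil
  | _, .cons p f => cons (ofPath p) f 1

/-- Forget the weights. -/
def toPath {x : K} : ∀ {y : K}, WPath (fun x y : K => x ⟶ y) x y → Quiver.Path x y
  | _, nil => .nil
  | _, cons p f _ => .cons (toPath p) f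

@[simp] theorem length_ofPath (p : Quiver.Path x y) : (ofPath p).length = p.length := by
  induction p with
  | nil => rfl
  | cons p f ih => simp [ofPath, ih]

@[simp] theorem length_toPath (w : WPath (fun x y : K => x ⟶ y) x y) :
    w.toPath.length = w.length := by
  induction w with
  | nil => rfl
  | cons p f s ih => simp [toPath, ih]

theorem ofPath_comp (p : Quiver.Path x y) (q : Quiver.Path y z) :
    ofPath (p.comp q) = (ofPath p).comp (ofPath q) := by
  induction q with
  | nil => rfl
  | cons q f ih => simp [ofPath, ih]

theorem toPath_comp (p : WPath (fun x y : K => x ⟶ y) x y)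
    (q : WPath (fun x y : K => x ⟶ y) y z) : (p.comp q).toPath = p.toPath.comp q.toPath := by
  induction q with
  | nil => rfl
  | cons q f s ih => simp [toPath, ih]

theorem toPath_setWeights (p : WPath (fun x y : K => x ⟶ y) x y) (t : ℕ → I) :
    (p.setWeights t).toPath = p.toPath := by
  induction p with
  | nil => rfl
  | cons p f s ih => simp [setWeights, toPath, ih]

theorem toPath_ofPath (p : Quiver.Path x y) : (ofPath p).toPath = p := by
  induction p with
  | nil => rfl
  | cons p f ih => simp [ofPath, toPath, ih]

theorem fold_ofPath (P : K ⥤ C) (p : Quiver.Path x y) :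
    (ofPath p).fold (o := P.obj) (fun _ _ f => P.map f) = P.map (composePath p) := by
  induction p with
  | nil => exact (P.map_id _).symm
  | cons p f ih => simp [ofPath, fold, ih]

theorem map_composePath_toPath (P : K ⥤ C) (w : WPath (fun x y : K => x ⟶ y) x y) :
    P.map (composePath w.toPath) = w.fold (o := P.obj) (fun _ _ f => P.map f) := by
  induction w with
  | nil => exact P.map_id _
  | cons p f s ih => simp [toPath, fold, ih]

end WPath

variable {P : K ⥤ C} {E : TopOver.{w} C}

/-- The values of a coherent system at paths and parameters. -/
def onPaths (Ψ : (fullShape P).Assignment E) ⦃x y : K⦄ (p : Quiver.Path x y)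
    (t : Fin (p.length - 1) → I) : E.hom (P.obj x) (P.obj y) :=
  Ψ ((WPath.ofPath p).setWeights (pad t))

namespace Coherent

variable {Ψ : (fullShape P).Assignment E}

/-- `cut` forgets only the parameter at the last edge, on which a coherent system does not depend.
-/
theorem onPaths_cut (hΨ : Coherent P E Ψ) {x y : K} (p : Quiver.Path x y) (t : ℕ → I) :
    onPaths Ψ p (cut t) = Ψ ((WPath.ofPath p).setWeights t) := by
  cases p with
  | nil => rfl
  | cons p f =>
    have h : (WPath.ofPath p).setWeights (pad (cut t : Fin ((p.cons f).length - 1) → I)) =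
        (WPath.ofPath p).setWeights t :=
      WPath.setWeights_congr _ fun i hi => pad_cut t (by
        simpa using hi)
    simp only [onPaths, WPath.ofPath, WPath.setWeights]
    rw [h]
    exact hΨ.last _ _ _ _ trivial

theorem pathCoherent (hΨ : Coherent P E Ψ) : PathCoherent P E (onPaths Ψ) where
  proj x y p t := by
    refine (hΨ.proj _ trivial).trans ?_
    rw [WPath.fold_setWeights]
    exact WPath.fold_ofPath P p
  cont x y p := (hΨ.cont _ trivial).comp continuous_pad
  nil x t := hΨ.nil x
  id_first x y r t := by
    rw [hΨ.onPaths_cut, hΨ.onPaths_cut, WPath.ofPath_comp, WPath.setWeights_comp]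
    exact hΨ.id_first _ _
  id_mid x y z q r hq hr t := by
    rw [hΨ.onPaths_cut, hΨ.onPaths_cut, WPath.ofPath_comp, WPath.ofPath_comp]
    cases q with
    | nil => simp at hq
    | cons q f =>
      have h1 := WPath.setWeights_cons_cons_comp (WPath.ofPath q) f 1 (𝟙 y) 1 (WPath.ofPath r) t
      have h2 := WPath.setWeights_merge (WPath.ofPath q) f 1 (WPath.ofPath r) t
      rw [WPath.length_ofPath] at h1 h2
      refine (congrArg (@Ψ _ _) h1).trans (Eq.trans ?_ (congrArg (@Ψ _ _) h2).symm)
      exact hΨ.id_mid _ _ _ _ _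
  id_last x y q t := by
    rw [hΨ.onPaths_cut, hΨ.onPaths_cut]
    cases q with
    | nil => exact hΨ.id_first _ WPath.nil
    | cons q f =>
      exact (hΨ.id_mid _ _ _ _ WPath.nil).trans (hΨ.last _ _ _ _ trivial)
  zero x y z q r hq hr t ht := by
    rw [hΨ.onPaths_cut, hΨ.onPaths_cut, hΨ.onPaths_cut, WPath.ofPath_comp, WPath.setWeights_comp,
      WPath.length_ofPath]
    refine hΨ.zero _ _ ?_ trivial
    rw [WPath.lastWeight_setWeights _ _ (by simpa using hq), WPath.length_ofPath, ht]
  one x y z y' q f g z' r t ht := by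
    rw [hΨ.onPaths_cut, hΨ.onPaths_cut, WPath.ofPath_comp, WPath.ofPath_comp]
    have h1 := WPath.setWeights_cons_cons_comp (WPath.ofPath q) f 1 g 1 (WPath.ofPath r) t
    have h2 := WPath.setWeights_dropAt (WPath.ofPath q) (f ≫ g) 1 (WPath.ofPath r) t
    rw [WPath.length_ofPath] at h1 h2
    rw [ht] at h1
    refine (congrArg (@Ψ _ _) h1).trans (Eq.trans ?_ (congrArg (@Ψ _ _) h2).symm)
    exact hΨ.one _ _ _ _ _ trivial

end Coherent

/-- The values at weighted paths. -/
def onWPaths (φ : ∀ ⦃x y : K⦄ (p : Quiver.Path x y),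
      (Fin (p.length - 1) → I) → E.hom (P.obj x) (P.obj y)) : (fullShape P).Assignment E :=
  fun _ _ w => φ (WPath.toPath w) (cut w.weights)

theorem apply_cut_congr {φ : ∀ ⦃x y : K⦄ (p : Quiver.Path x y),
      (Fin (p.length - 1) → I) → E.hom (P.obj x) (P.obj y)} {x y : K} {p p' : Quiver.Path x y}
    (hp : p = p') {t t' : ℕ → I} (h : ∀ i < p.length - 1, t i = t' i) :
    φ p (cut t) = φ p' (cut t') := by
  subst hp
  congr 1
  exact funext fun i => h i i.2

theorem onWPaths_setWeights (φ : ∀ ⦃x y : K⦄ (p : Quiver.Path x y),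
      (Fin (p.length - 1) → I) → E.hom (P.obj x) (P.obj y)) {x y : K}
    (u : WPath (fun x y : K => x ⟶ y) x y) (t : ℕ → I) :
    onWPaths φ (u.setWeights t) = φ u.toPath (cut t) :=
  apply_cut_congr (φ := φ) (u.toPath_setWeights t) fun i hi => u.weights_setWeights t (by
    rw [WPath.toPath_setWeights, WPath.length_toPath] at hi
    omega)

theorem WPath.shift_weights_comp {x y z : K} (p : WPath (fun x y : K => x ⟶ y) x y)
    (q : WPath (fun x y : K => x ⟶ y) y z) : shift p.length (p.comp q).weights = q.weights :=
  funext fun i => p.weights_comp_add q i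

/-- Each condition at a weighted path is the condition on `φ` at its underlying path and weight
sequence. The empty factors that `PathCoherent` excludes are covered by `nil`, the unit laws and
`id_last`. -/
theorem PathCoherent.coherent {φ : ∀ ⦃x y : K⦄ (p : Quiver.Path x y),
      (Fin (p.length - 1) → I) → E.hom (P.obj x) (P.obj y)} (hφ : PathCoherent P E φ) :
    Coherent P E (onWPaths φ) where
  nil x := hφ.nil x _
  proj x y w _ := (hφ.proj _ _).trans (WPath.map_composePath_toPath P w)
  cont x y w _ := by
    have h : (fun t => onWPaths φ (w.setWeights t)) = fun t => φ w.toPath (cut t) :=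
      funext fun t => onWPaths_setWeights φ w t
    rw [h]
    exact (hφ.cont _).comp continuous_cut
  last x y z q f s s' _ := by
    refine apply_cut_congr (φ := φ) rfl fun i hi => ?_
    have hi' : i < q.length := by simpa [WPath.toPath] using hi
    simp only [WPath.weights]
    rw [if_neg hi'.ne, if_neg hi'.ne]
  zero x y z q r hq _ := by
    cases r with
    | nil => exact (E.comp_one _).symm.trans (congrArg _ (hφ.nil _ _).symm)
    | cons r f s =>
      cases q with
      | nil =>
        rw [WPath.nil_comp]
        exact (E.one_comp _).symm.trans (congrArg (E.comp · _) (hφ.nil _ _).symm)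
      | cons q g s' =>
        have h1 := hφ.zero (WPath.toPath (q.cons g s')) (WPath.toPath (r.cons f s)) (by simp)
          (by simp) ((q.cons g s').comp (r.cons f s)).weights (by
            rw [WPath.length_toPath, WPath.weights_comp_of_lt _ _ (by simp),
              WPath.weights_length_sub_one _ (by simp), hq])
        refine Eq.trans (apply_cut_congr (φ := φ) (WPath.toPath_comp _ _) fun _ _ => rfl)
          (h1.trans (congrArg₂ E.comp ?_ ?_))
        · refine apply_cut_congr (φ := φ) rfl fun i hi => WPath.weights_comp_of_lt _ _ ?_
          rw [WPath.length_toPath] at hi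
          omega
        · refine apply_cut_congr (φ := φ) rfl fun i _ => ?_
          rw [WPath.length_toPath, WPath.shift_weights_comp]
  one x y z v v' q f g s r _ := by
    -- All pieces of the path are recovered from `t`, so `setWeights_dropAt` describes the merged
    -- path through `dropAt q.length t`.
    set t := (((q.cons f 1).cons g s).comp r).weights with ht
    have e := (((q.cons f 1).cons g s).comp r).setWeights_weights
    have hq : q.setWeights t = q := by
      conv_rhs => rw [← q.setWeights_weights]
      refine q.setWeights_congr fun i hi => ?_
      rw [ht, WPath.weights_comp_of_lt _ _ (by simp; omega)]
      simp only [WPath.weights, WPath.length_cons]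
      rw [if_neg (by omega), if_neg hi.ne]
    have h0 : t q.length = 1 := by
      rw [ht, WPath.weights_comp_of_lt _ _ (by simp)]
      simp [WPath.weights]
    have h1 : t (q.length + 1) = s := by
      rw [ht, WPath.weights_comp_of_lt _ _ (by simp)]
      simp [WPath.weights]
    have hr : r.setWeights (shift (q.length + 1 + 1) t) = r := by
      have := WPath.shift_weights_comp ((q.cons f 1).cons g s) r
      simp only [WPath.length_cons] at this
      rw [ht, this, WPath.setWeights_weights]
    have h2 := WPath.setWeights_dropAt q (f ≫ g) s r t
    rw [hq, hr, h1] at h2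
    have h3 := onWPaths_setWeights φ ((q.cons (f ≫ g) s).comp r) (dropAt q.length t)
    rw [h2] at h3
    refine Eq.trans ?_ h3.symm
    have h4 := hφ.one (WPath.toPath q) f g (WPath.toPath r) t (by rw [WPath.length_toPath, h0])
    rw [WPath.length_toPath] at h4
    refine Eq.trans ?_ (h4.trans ?_)
    · exact apply_cut_congr (φ := φ) (WPath.toPath_comp _ _) fun _ _ => rfl
    · exact apply_cut_congr (φ := φ) (WPath.toPath_comp (q.cons (f ≫ g) s) r).symm
        fun _ _ => rfl
  id_first x y s r := by
    refine Eq.trans ?_ ((hφ.id_first (WPath.toPath r)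
      ((WPath.nil.cons (𝟙 x) s).comp r).weights).trans ?_)
    · exact apply_cut_congr (φ := φ) (WPath.toPath_comp _ _) fun _ _ => rfl
    · exact apply_cut_congr (φ := φ) rfl fun i _ =>
        WPath.weights_comp_add (WPath.nil.cons (𝟙 x) s) r i
  id_mid x y z v q f s s' r := by
    cases r with
    | nil =>
      refine (hφ.id_last (WPath.toPath (q.cons f s)) _).trans ?_
      refine apply_cut_congr (φ := φ) rfl fun i hi => ?_
      have hi' : i < q.length := by simpa [WPath.toPath] using hi
      simp only [WPath.comp_nil, WPath.weights, WPath.length_cons]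
      rw [if_neg hi'.ne, if_neg hi'.ne]
      exact if_neg (by omega)
    | cons r g c =>
      generalize hr' : r.cons g c = r'
      have hr'0 : 0 < r'.length := by rw [← hr']; simp
      set t := (((q.cons f s).cons (𝟙 z) s').comp r').weights with ht
      have hq : q.setWeights t = q := by
        conv_rhs => rw [← q.setWeights_weights]
        refine q.setWeights_congr fun i hi => ?_
        rw [ht, WPath.weights_comp_of_lt _ _ (by simp; omega)]
        simp only [WPath.weights, WPath.length_cons]
        rw [if_neg hi.ne]
        exact if_neg (by omega)
      have h0 : t q.length = s := by
        rw [ht, WPath.weights_comp_of_lt _ _ (by simp)]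
        simp [WPath.weights]
      have h1 : t (q.length + 1) = s' := by
        rw [ht, WPath.weights_comp_of_lt _ _ (by simp)]
        simp [WPath.weights]
      have hr : r'.setWeights (shift (q.length + 1 + 1) t) = r' := by
        have := WPath.shift_weights_comp ((q.cons f s).cons (𝟙 z) s') r'
        simp only [WPath.length_cons] at this
        rw [ht, this, WPath.setWeights_weights]
      have h2 := WPath.setWeights_merge q f s r' t
      rw [hq, hr, h0, h1] at h2
      have h3 := onWPaths_setWeights φ ((q.cons f s).comp r') (merge (q.length + 1) t)
      rw [h2] at h3
      refine Eq.trans ?_ h3.symm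
      have h4 := hφ.id_mid (WPath.toPath (q.cons f s)) (WPath.toPath r') (by simp)
        (by simpa using hr'0) t
      rw [WPath.length_toPath] at h4
      refine Eq.trans ?_ (h4.trans ?_)
      · exact apply_cut_congr (φ := φ) (WPath.toPath_comp _ _) fun _ _ => rfl
      · exact apply_cut_congr (φ := φ) (WPath.toPath_comp (q.cons f s) r').symm fun _ _ => rfl

end

end LittleBoxes

namespace LittleBoxes

noncomputable section

variable {C : Type u} [Category.{v} C]

/-! ### Box maps -/

namespace Wedge

variable {k : ℕ} {X Y : Type w}

theorem cell_eq_pt (x : X) {c : Fin k → I} (hc : c ∈ Cube.boundary (Fin k)) :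
    cell x c = pt k X :=
  Collapse.mk_eq (inr_mem.2 hc) (inl_mem k X)

theorem induction {p : Wedge k X → Prop} (hpt : p (pt k X)) (hcell : ∀ x c, p (cell x c))
    (z : Wedge k X) : p z := by
  refine Collapse.ind ?_ z
  rintro (⟨⟩ | ⟨x, c⟩)
  exacts [hpt, hcell x c]

theorem continuous_cell (x : X) : Continuous (cell x : (Fin k → I) → Wedge k X) :=
  Collapse.isQuotientMap_mk.continuous.comp (continuous_inr.comp
    (@continuous_sigmaMk X (fun _ => Fin k → I) _ x))

/-- A map out of a product with a wedge is continuous if it is so on the base point and the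
cubes. -/
theorem continuous_prod {T Z : Type*} [TopologicalSpace T] [LocallyCompactSpace T]
    [TopologicalSpace Z] {g : T × Wedge k X → Z} (hpt : Continuous fun t => g (t, pt k X))
    (hcell : ∀ x, Continuous fun p : T × (Fin k → I) => g (p.1, cell x p.2)) : Continuous g := by
  -- Since `T` is locally compact, the product of `T` with the quotient map is again a quotient map.
  refine Collapse.isQuotientMap_mk.continuous_lift_prod_right ?_
  refine continuous_iff_continuousAt.2 ?_
  rintro ⟨t, (⟨⟩ | ⟨x, c⟩)⟩
  · have h : Topology.IsOpenEmbedding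
        (Sum.inl : PUnit.{w + 1} → PUnit.{w + 1} ⊕ (Σ _ : X, Fin k → I)) := .inl
    exact ((Topology.IsOpenEmbedding.id.prodMap h).continuousAt_iff (x := (t, PUnit.unit))).1
      (hpt.comp continuous_fst).continuousAt
  · have h : Topology.IsOpenEmbedding ((Sum.inr : _ → PUnit.{w + 1} ⊕ (Σ _ : X, Fin k → I)) ∘
        Sigma.mk x) := Topology.IsOpenEmbedding.inr.comp .sigmaMk
    exact ((Topology.IsOpenEmbedding.id.prodMap h).continuousAt_iff (x := (t, c))).1
      (hcell x).continuousAt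

end Wedge

namespace Box

variable {k : ℕ}

theorem reflectPoint_mem_boundary (ε : ℤˣ) {c : Fin k → I} (hc : c ∈ Cube.boundary (Fin k)) :
    reflectPoint ε c ∈ Cube.boundary (Fin k) := by
  obtain ⟨i, hi⟩ := hc
  refine ⟨i, ?_⟩
  simp only [reflectPoint]
  split_ifs
  · rcases hi with hi | hi
    · exact Or.inr (by rw [hi, unitInterval.symm_zero])
    · exact Or.inl (by rw [hi, unitInterval.symm_one])
  · exact hi

theorem rescale_mem_boundary {B : Box k} {c : Fin k → I} (hc : c ∉ B.interior) :
    B.rescale c ∈ Cube.boundary (Fin k) := by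
  obtain ⟨i, hi⟩ := not_forall.1 hc
  have h3 : 0 < B.hi i - B.lo i := sub_pos.2 (B.lo_lt_hi i)
  refine ⟨i, ?_⟩
  by_cases h : B.lo i < c i
  · refine Or.inr (Set.projIcc_of_right_le _ ?_)
    rw [le_div_iff₀ h3]
    have := not_lt.1 fun h' => hi ⟨h, h'⟩
    linarith
  · refine Or.inl (Set.projIcc_of_le_left _ ?_)
    exact div_nonpos_of_nonpos_of_nonneg (by linarith [not_lt.1 h]) h3.le

theorem rescale_full (c : Fin k → I) : (full k).rescale c = c := by
  funext i
  simp only [rescale, full, sub_zero, div_one]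
  exact Set.projIcc_val zero_le_one (c i)

theorem reflectPoint_one (c : Fin k → I) : reflectPoint 1 c = c :=
  funext fun _ => if_neg fun h => absurd h.1 (by decide)

theorem continuous_reflectPoint (ε : ℤˣ) :
    Continuous (reflectPoint ε : (Fin k → I) → Fin k → I) := by
  refine continuous_pi fun i => ?_
  simp only [reflectPoint]
  split_ifs
  · exact unitInterval.continuous_symm.comp (continuous_apply i)
  · exact continuous_apply i

variable {T : Type*} [TopologicalSpace T] {B : T → Box k}

theorem continuous_rescale (hB : Continuous B) :
    Continuous fun p : T × (Fin k → I) => (B p.1).rescale p.2 := by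
  rw [continuous_iff] at hB
  have a1 := fun i => ((continuous_apply i).comp hB.1).comp (continuous_fst (Y := Fin k → I))
  have a2 := fun i => ((continuous_apply i).comp hB.2).comp (continuous_fst (Y := Fin k → I))
  refine continuous_pi fun i => continuous_projIcc.comp ?_
  refine Continuous.div ?_ ((a2 i).sub (a1 i)) fun p =>
    (sub_pos.2 ((B p.1).lo_lt_hi i)).ne'
  exact (continuous_subtype_val.comp ((continuous_apply i).comp continuous_snd)).sub (a1 i)

theorem isOpen_interior (hB : Continuous B) :
    IsOpen {p : T × (Fin k → I) | p.2 ∈ (B p.1).interior} := by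
  rw [continuous_iff] at hB
  have a1 := fun i => ((continuous_apply i).comp hB.1).comp (continuous_fst (Y := Fin k → I))
  have a2 := fun i => ((continuous_apply i).comp hB.2).comp (continuous_fst (Y := Fin k → I))
  have a3 : ∀ i, Continuous fun p : T × (Fin k → I) => (p.2 i : ℝ) := fun i =>
    continuous_subtype_val.comp ((continuous_apply i).comp continuous_snd)
  have h : {p : T × (Fin k → I) | p.2 ∈ (B p.1).interior} =
      ⋂ i, {p | (B p.1).lo i < p.2 i} ∩ {p | (p.2 i : ℝ) < (B p.1).hi i} := by
    ext p
    rw [Set.mem_iInter]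
    rfl
  rw [h]
  exact isOpen_iInter_of_finite fun i =>
    (isOpen_lt (a1 i) (a3 i)).inter (isOpen_lt (a3 i) (a2 i))

end Box

/-! ### Continuity of box maps in the boxes and the point together. -/

section BoxMap

variable {k : ℕ} {A X Y : Type w} {s : A → X}

theorem boxMap_cell_of_mem (e : BoxConfig k s) (t : A → Y) (sg : A → ℤˣ) {x : X} {a : A}
    (ha : s a = x) {c : Fin k → I} (hc : c ∈ (e.1 a).interior) :
    boxMap e t sg (Wedge.cell x c) =
      Wedge.cell (t a) (Box.reflectPoint (sg a) ((e.1 a).rescale c)) := by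
  have h : ∃ a, s a = x ∧ c ∈ (e.1 a).interior := ⟨a, ha, hc⟩
  have h1 : h.choose = a := by
    by_contra hne
    exact Set.disjoint_left.1 (e.2 _ _ hne (h.choose_spec.1.trans ha.symm)) h.choose_spec.2 hc
  refine (dif_pos h).trans ?_
  rw [h1]

theorem boxMap_cell_of_not_mem (e : BoxConfig k s) (t : A → Y) (sg : A → ℤˣ) {x : X}
    {c : Fin k → I} (h : ∀ a, s a = x → c ∉ (e.1 a).interior) :
    boxMap e t sg (Wedge.cell x c) = Wedge.pt k Y :=
  dif_neg fun ⟨a, ha, hc⟩ => h a ha hc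

/-- Near an interior point of a box the map is given by one continuous formula. At a point outside
all open boxes, the clamped formula of every box takes the base point as value, so nearby all of the
finitely many formulas take values close to the base point. -/
theorem continuous_boxMap [Finite A] {T : Type*} [TopologicalSpace T] [LocallyCompactSpace T]
    {e : T → BoxConfig k s} (he : Continuous e) (t : A → Y) (sg : A → ℤˣ) :
    Continuous fun p : T × Wedge k X => boxMap (e p.1) t sg p.2 := by
  have he' : ∀ a, Continuous fun τ => (e τ).1 a := fun a =>
    (continuous_apply a).comp (continuous_subtype_val.comp he)
  refine Wedge.continuous_prod continuous_const fun x => ?_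
  let h : A → T × (Fin k → I) → Wedge k Y := fun a p =>
    Wedge.cell (t a) (Box.reflectPoint (sg a) (((e p.1).1 a).rescale p.2))
  have hh : ∀ a, Continuous (h a) := fun a => (Wedge.continuous_cell _).comp
    ((Box.continuous_reflectPoint _).comp (Box.continuous_rescale (he' a)))
  refine continuous_iff_continuousAt.2 fun p₀ => ?_
  by_cases hp : ∃ a, s a = x ∧ p₀.2 ∈ ((e p₀.1).1 a).interior
  · obtain ⟨a, ha, hc⟩ := hp
    refine (hh a).continuousAt.congr ?_
    filter_upwards [(Box.isOpen_interior (he' a)).mem_nhds hc] with p hp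
    exact (boxMap_cell_of_mem (e p.1) t sg ha hp).symm
  · have h0 : ∀ a, s a = x → h a p₀ = Wedge.pt k Y := fun a ha =>
      Wedge.cell_eq_pt _ (Box.reflectPoint_mem_boundary _
        (Box.rescale_mem_boundary fun hc => hp ⟨a, ha, hc⟩))
    have h1 : boxMap (e p₀.1) t sg (Wedge.cell x p₀.2) = Wedge.pt k Y :=
      boxMap_cell_of_not_mem _ _ _ fun a ha hc => hp ⟨a, ha, hc⟩
    intro U hU
    replace hU : U ∈ nhds (Wedge.pt k Y) := by rwa [← h1]
    have h2 : ∀ᶠ p in nhds p₀, ∀ a, s a = x → h a p ∈ U := by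
      refine Filter.eventually_all.2 fun a => ?_
      by_cases ha : s a = x
      · have h3 := (hh a).tendsto p₀
        rw [h0 a ha] at h3
        filter_upwards [h3 hU] with p hp _ using hp
      · exact Filter.Eventually.of_forall fun p h => absurd h ha
    refine Filter.mem_map.2 ?_
    filter_upwards [h2] with p hp'
    change boxMap (e p.1) t sg (Wedge.cell x p.2) ∈ U
    by_cases hp : ∃ a, s a = x ∧ p.2 ∈ ((e p.1).1 a).interior
    · obtain ⟨a, ha, hc⟩ := hp
      have := hp' a ha
      rwa [boxMap_cell_of_mem (e p.1) t sg ha hc]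
    · rw [boxMap_cell_of_not_mem _ _ _ fun a ha hc => hp ⟨a, ha, hc⟩]
      exact mem_of_mem_nhds hU

end BoxMap

/-! ### The maps of box arrows -/

variable {G : Type} [Group G] {L : Labels.{w} G C} {k : ℕ} {x y z : C}

/-- The box map of a box arrow. -/
def BoxArr.act (A : BoxArr L k x y) : L.wedges k x → L.wedges k y :=
  boxMap (⟨A.2.1, A.2.2.1⟩ : BoxConfig k (L.src A.1)) (L.tgt A.1) (L.sgn A.1)

namespace BoxArr

theorem act_pt (A : BoxArr L k x y) : act A (L.wedges k x).pt = (L.wedges k y).pt := rfl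

theorem act_cell_of_mem (A : BoxArr L k x y) {i : L.obj x} {a : L.lab A.1} (ha : L.src A.1 a = i)
    {c : Fin k → I} (hc : c ∈ (A.2.1 a).interior) : act A (Wedge.cell i c) =
      Wedge.cell (L.tgt A.1 a) (Box.reflectPoint (L.sgn A.1 a) ((A.2.1 a).rescale c)) :=
  boxMap_cell_of_mem (⟨A.2.1, A.2.2.1⟩ : BoxConfig k (L.src A.1)) _ _ ha hc

theorem act_cell_of_not_mem (A : BoxArr L k x y) {i : L.obj x} {c : Fin k → I}
    (h : ∀ a, L.src A.1 a = i → c ∉ (A.2.1 a).interior) :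
    act A (Wedge.cell i c) = Wedge.pt k (L.obj y) :=
  boxMap_cell_of_not_mem (⟨A.2.1, A.2.2.1⟩ : BoxConfig k (L.src A.1)) _ _ h

theorem act_one (hL : L.Lawful) (a : L.wedges k x) : act ((boxCat hL k).one x) a = a := by
  revert a
  refine Wedge.induction rfl fun i c => ?_
  obtain ⟨j, rfl⟩ := (hL.src_id x).2 i
  by_cases hc : c ∈ (Box.full k).interior
  · refine (act_cell_of_mem ((boxCat hL k).one x) (a := j) rfl hc).trans ?_
    have h : (((boxCat hL k).one x).2.1 j).rescale c = c := Box.rescale_full c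
    have h' : L.sgn ((boxCat hL k).one x).1 j = 1 := hL.sgn_id x j
    have h'' : L.tgt ((boxCat hL k).one x).1 j = L.src (𝟙 x) j := hL.tgt_id x j
    rw [h, h', h'', Box.reflectPoint_one]
  · refine (act_cell_of_not_mem ((boxCat hL k).one x) fun a _ => hc).trans ?_
    have h := Box.rescale_mem_boundary hc
    rw [Box.rescale_full] at h
    exact (Wedge.cell_eq_pt _ h).symm

/-- A point lies in the box of `(b, a)` exactly if it lies in that of `a` and its image lies in that
of `b`. The reflection by `σ(a)` coming from the reflected box then cancels against the factor
`σ(a)` of `σ(b, a)`. -/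
theorem act_comp (hL : L.Lawful) (A : BoxArr L k x y) (B : BoxArr L k y z) (p : L.wedges k x) :
    act ((boxCat hL k).comp A B) p = act B (act A p) := by
  revert p
  refine Wedge.induction rfl fun i c => ?_
  have key : ∀ a b h, ((boxCat hL k).comp A B).2.1 (L.comp A.1 B.1 a b h) =
    (A.2.1 a).sub (Box.reflect (L.sgn A.1 a) (B.2.1 b)) := Conf.compBox_comp hL A.2 B.2
  have mem : ∀ a b h, c ∈ (((boxCat hL k).comp A B).2.1 (L.comp A.1 B.1 a b h)).interior ↔
      c ∈ (A.2.1 a).interior ∧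
        Box.reflectPoint (L.sgn A.1 a) ((A.2.1 a).rescale c) ∈ (B.2.1 b).interior := fun a b h => by
    rw [key, Box.mem_interior_sub, Box.mem_interior_reflect]
  by_cases hA : ∃ a, L.src A.1 a = i ∧ c ∈ (A.2.1 a).interior
  · obtain ⟨a, ha, hc⟩ := hA
    rw [act_cell_of_mem A ha hc]
    by_cases hB : ∃ b, L.src B.1 b = L.tgt A.1 a ∧
        Box.reflectPoint (L.sgn A.1 a) ((A.2.1 a).rescale c) ∈ (B.2.1 b).interior
    · obtain ⟨b, hb, hc'⟩ := hB
      rw [act_cell_of_mem B hb hc']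
      refine (act_cell_of_mem ((boxCat hL k).comp A B) (a := L.comp A.1 B.1 a b hb.symm)
        ((hL.src_comp _ _ _ _ _).trans ha) ((mem _ _ _).2 ⟨hc, hc'⟩)).trans ?_
      rw [key, Box.rescale_sub hc, Box.rescale_reflect _ _ _ hc']
      have h1 : L.tgt ((boxCat hL k).comp A B).1 (L.comp A.1 B.1 a b hb.symm) = L.tgt B.1 b :=
        hL.tgt_comp _ _ _ _ _
      have h2 : L.sgn ((boxCat hL k).comp A B).1 (L.comp A.1 B.1 a b hb.symm) =
        L.sgn B.1 b * L.sgn A.1 a := hL.sgn_comp _ _ _ _ _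
      rw [h1, h2, ← Box.reflectPoint_reflectPoint_mul, Box.reflectPoint_reflectPoint]
    · rw [act_cell_of_not_mem B fun b hb hc' => hB ⟨b, hb, hc'⟩]
      refine act_cell_of_not_mem _ fun d hd hcd => ?_
      obtain ⟨a', b', h, rfl⟩ := hL.comp_surj A.1 B.1 d
      obtain ⟨h1, h2⟩ := (mem _ _ _).1 hcd
      have hd' : L.src A.1 a' = i := (hL.src_comp _ _ _ _ _).symm.trans hd
      have haa : a' = a := by
        by_contra hne
        exact Set.disjoint_left.1 (A.2.2.1 a' a hne (hd'.trans ha.symm)) h1 hc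
      subst haa
      exact hB ⟨b', h.symm, h2⟩
  · rw [act_cell_of_not_mem A fun a ha hc => hA ⟨a, ha, hc⟩]
    refine act_cell_of_not_mem _ fun d hd hcd => ?_
    obtain ⟨a', b', h, rfl⟩ := hL.comp_surj A.1 B.1 d
    exact hA ⟨a', (hL.src_comp _ _ _ _ _).symm.trans hd, ((mem _ _ _).1 hcd).1⟩

theorem act_smul (hL : L.Lawful) (A : BoxArr L k x y) (g : G) (p : L.wedges k x) :
    act A (g • p) = g • act A p := by
  revert p
  refine Wedge.induction rfl fun i c => ?_
  change act A (Wedge.cell (g • i) c) = _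
  by_cases hA : ∃ a, L.src A.1 a = i ∧ c ∈ (A.2.1 a).interior
  · obtain ⟨a, ha, hc⟩ := hA
    rw [act_cell_of_mem A ha hc]
    rw [act_cell_of_mem A (a := L.labSmul A.1 g a) (by rw [hL.src_smul, ha])
      (by rwa [A.2.2.2]), hL.sgn_smul, A.2.2.2, hL.tgt_smul]
    rfl
  · rw [act_cell_of_not_mem A fun a ha hc => hA ⟨a, ha, hc⟩, act_cell_of_not_mem A]
    · rfl
    · intro a ha hc
      refine hA ⟨L.labSmul A.1 g⁻¹ a, ?_, by rwa [A.2.2.2]⟩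
      rw [hL.src_smul, ha, inv_smul_smul]

theorem continuous_act (hL : L.Lawful) {T : Type*} [TopologicalSpace T] [LocallyCompactSpace T]
    {γ : T → BoxArr L k x y} (hγ : Continuous γ) {f : x ⟶ y} (h : ∀ t, (γ t).1 = f) :
    Continuous fun p : T × L.wedges k x => act (γ p.1) p.2 := by
  obtain ⟨c, hc, hcγ⟩ := exists_conf hγ h
  simp_rw [hcγ]
  have := hL.finite f
  exact continuous_boxMap (e := fun t => (⟨(c t).1, (c t).2.1⟩ : BoxConfig k (L.src f)))
    ((continuous_subtype_val.comp hc).subtype_mk _) (L.tgt f) (L.sgn f)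

end BoxArr

/-! ### Diagrams of box maps -/

section Diagram

variable {K : Type*} [Category K] {P : K ⥤ C} {hL : L.Lawful}
  {φ : ∀ ⦃x y : K⦄ (p : Quiver.Path x y),
    (Fin (p.length - 1) → I) → (boxCat hL k).hom (P.obj x) (P.obj y)}

/-- The homotopy coherent diagram of a coherent system of box configurations. -/
def PathCoherent.diagram (hφ : PathCoherent P (boxCat hL k) φ) :
    HCDiagram K fun x => L.wedges k (P.obj x) where
  map p t := BoxArr.act (φ p t)
  continuous_map p := BoxArr.continuous_act hL (hφ.cont p) (hφ.proj p)
  map_pt p t := BoxArr.act_pt _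
  map_smul p t := BoxArr.act_smul hL _
  map_nil x t a := by rw [hφ.nil]; exact BoxArr.act_one hL a
  map_id_first r t a := by rw [hφ.id_first]
  map_id_mid q r hq hr t a := by rw [hφ.id_mid q r hq hr]
  map_id_last q t a := by rw [hφ.id_last]
  map_zero q r hq hr t ht a := by rw [hφ.zero q r hq hr t ht]; exact BoxArr.act_comp hL _ _ a
  map_one q f g _ r t ht a := by rw [hφ.one q f g r t ht]

end Diagram

/-! ### Spatial refinements as coherent systems in `boxCat`. -/

section Families

variable {hL : L.Lawful}

/-- The system of box configurations of a spatial refinement. -/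
def BoxFamilies.system (hL : L.Lawful) {D : HCDiagram C (L.wedges k)} (B : BoxFamilies L k D)
    ⦃x y : C⦄ (p : Quiver.Path x y) (t : Fin (p.length - 1) → I) : (boxCat hL k).hom x y :=
  ⟨composePath p, ⟨(B.e p t).1, (B.e p t).2, B.smul_eq p t⟩⟩

theorem BoxFamilies.map_eq_act {D : HCDiagram C (L.wedges k)} (B : BoxFamilies L k D)
    {x y : C} (p : Quiver.Path x y) (t : Fin (p.length - 1) → I) :
    D.map p t = BoxArr.act (B.system hL p t) :=
  B.map_eq p t

theorem BoxFamilies.pathCoherent {D : HCDiagram C (L.wedges k)} (B : BoxFamilies L k D) :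
    PathCoherent (𝟭 C) (boxCat hL k) (B.system hL) where
  proj x y p t := rfl
  cont x y p := by
    exact (Topology.IsEmbedding.sigmaMk.continuous :
      Continuous (Sigma.mk (composePath p) : _ → BoxArr L k x y)).comp
        ((continuous_subtype_val.comp (B.continuous_e p)).subtype_mk _)
  nil x t := Conf.mk_eq_mk.2 ⟨rfl, fun a => (B.nil_eq x t a).symm⟩
  id_first x y r t := (Conf.mk_eq_mk.2 ⟨by simp, fun a => B.id_first r t a⟩).symm
  id_mid x y z q r hq hr t := (Conf.mk_eq_mk.2 ⟨by simp, fun a => B.id_mid q r hq hr t a⟩).symm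
  id_last x y q t := (Conf.mk_eq_mk.2 ⟨by simp, fun a => B.id_last q t a⟩).symm
  zero x y z q r hq hr t ht := by
    refine (Conf.mk_eq_mk.2 ⟨(composePath_comp q r).symm, fun c => ?_⟩).symm
    obtain ⟨a, b, h, rfl⟩ := hL.comp_surj _ _ c
    exact (B.zero_eq q r hq hr t ht a b h).trans (Conf.compBox_comp hL (B.system hL q (cut t)).2
      (B.system hL r (cut (shift q.length t))).2 a b h).symm
  one x y z y' q f g z' r t ht := (Conf.mk_eq_mk.2 ⟨by simp, fun a => B.one_eq q f g r t ht a⟩).symm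

/-- In dimension `0` reflections act trivially, so coherence in `boxCat` cannot detect signs; the
sign condition is therefore assumed separately. -/
theorem PathCoherent.isSpatialRefinement {φ : ∀ ⦃x y : C⦄ (p : Quiver.Path x y),
      (Fin (p.length - 1) → I) → (boxCat hL k).hom x y}
    (hφ : PathCoherent (𝟭 C) (boxCat hL k) φ)
    (hk : k = 0 → ∀ {x y : C} (f : x ⟶ y) (a : L.lab f), L.sgn f a = 1) :
    IsSpatialRefinement L k (hφ.diagram : HCDiagram C (L.wedges k)) := by
  have h : ∀ (x y : C) (p : Quiver.Path x y), ∃ c : (Fin (p.length - 1) → I) →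
      Conf L k (composePath p), Continuous c ∧ ∀ t, φ p t = ⟨composePath p, c t⟩ :=
    fun x y p => BoxArr.exists_conf (hφ.cont p) (hφ.proj p)
  choose c hc hcφ using h
  have cast_eq : ∀ {x y : C} {p p' : Quiver.Path x y} {t t'}, φ p t = φ p' t' →
      ∃ h : composePath p' = composePath p, ∀ a, (c x y p t).1 (L.cast h a) =
        (c x y p' t').1 a := fun {x y p p' t t'} h => by
    rw [hcφ, hcφ] at h
    exact Conf.mk_eq_mk.1 h.symm
  refine ⟨?_⟩
  exact
    { e := fun {x y} p t => ⟨(c x y p t).1, (c x y p t).2.1⟩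
      continuous_e := fun {x y} p => (continuous_subtype_val.comp (hc x y p)).subtype_mk _
      map_eq := fun {x y} p t => by
        change BoxArr.act (φ p t) = BoxArr.act ⟨composePath p, c x y p t⟩
        rw [hcφ]
      sgn_eq_one := hk
      smul_eq := fun {x y} p t => (c x y p t).2.2
      nil_eq := fun x t a => by
        have h := hφ.nil x t
        rw [hcφ] at h
        exact ((Conf.mk_eq_mk.1 h).2 a).symm
      id_first := fun r t a => (cast_eq (hφ.id_first r t)).2 a
      id_mid := fun q r hq hr t a => (cast_eq (hφ.id_mid q r hq hr t)).2 a
      id_last := fun q t a => (cast_eq (hφ.id_last q t)).2 a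
      zero_eq := fun q r hq hr t ht a b h => by
        have h1 := hφ.zero q r hq hr t ht
        rw [hcφ, hcφ, hcφ] at h1
        exact ((Conf.mk_eq_mk.1 h1.symm).2 _).trans (Conf.compBox_comp hL _ _ a b h)
      one_eq := fun q f g _ r t ht a => (cast_eq (hφ.one q f g r t ht)).2 a }

end Families

end

end LittleBoxes

namespace LittleBoxes

noncomputable section

variable {C : Type u} [Category.{v} C] {G : Type} [Group G] {L : Labels.{w} G C} {k n : ℕ}

/-! ### Existence -/

theorem ChainsAtMost.isIdentity (hC : ChainsAtMost C 0) {x y : C} (f : x ⟶ y) : IsIdentity f := by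
  by_contra h
  have := hC x y f.toPath ⟨trivial, h⟩
  simp at this

theorem exists_isSpatialRefinement (hL : L.Lawful) (hC : ChainsAtMost C n) (hnk : n ≤ k) :
    ∃ D : HCDiagram C (L.wedges k), IsSpatialRefinement L k D := by
  obtain ⟨Ψ, hΨ⟩ := exists_coherent hC hnk (boxCat_extends hL k) (𝟭 C)
  refine ⟨_, hΨ.pathCoherent.isSpatialRefinement ?_⟩
  intro hk x y f a
  -- In dimension `0` every morphism is an identity, and the labels of identities have sign `+1`.
  obtain rfl : n = 0 := by omega
  obtain ⟨rfl, rfl⟩ := hC.isIdentity f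
  exact hL.sgn_id x a

/-! ### Uniqueness -/

theorem GMap.isWeakEquiv_of_toFun_eq {X : GSpace.{w} G} (f : GMap X X) (hf : ∀ a, f.toFun a = a) :
    f.IsWeakEquiv := by
  intro H
  have h : f.fixed H = ContinuousMap.id _ := by
    ext a
    exact hf a.1
  rw [h]
  refine ⟨id, fun n x => ?_⟩
  have h1 : homotopyGroupMap (ContinuousMap.id (X.Fixed H)) n x = id := by
    funext q
    induction q using Quotient.inductionOn
    rfl
  rw [h1]
  exact Function.bijective_id

theorem joinObj_self {C : Type u} (X : C → GSpace.{w} G) : joinObj X X = fun z => X z.2 := by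
  funext ⟨i, x⟩
  fin_cases i <;> rfl

/-- The equality `joinObj_self` needs a case distinction on `Fin 2`, so a diagram is transported
along it with its values compared by `HEq`. -/
theorem HCDiagram.exists_of_eq {K : Type*} [Category K] {X Y : K → GSpace.{w} G} (h : Y = X)
    (D : HCDiagram K X) : ∃ D' : HCDiagram K Y, ∀ ⦃x y : K⦄ (p : Quiver.Path x y) t (a : X x)
      (a' : Y x), HEq a' a → HEq (D'.map p t a') (D.map p t a) := by
  subst h
  exact ⟨D, fun x y p t a a' h => by cases h; rfl⟩

theorem WPath.map_snd_ofPath_mapPath (i : Fin 2) {x y : C} (p : Quiver.Path x y) :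
    (WPath.ofPath ((Prod.sectR i C).toPrefunctor.mapPath p)).map
      (o := (CategoryTheory.Prod.snd (Fin 2) C).obj)
      (fun _ _ f => (CategoryTheory.Prod.snd (Fin 2) C).map f) = WPath.ofPath p := by
  induction p with
  | nil => rfl
  | cons p f ih => exact congrArg (fun q => WPath.cons q f 1) ih

theorem weaklyEquivalent (hL : L.Lawful) (hC : ChainsAtMost C n) (hnk : n + 1 ≤ k)
    {D E : HCDiagram C (L.wedges k)} (hD : IsSpatialRefinement L k D)
    (hE : IsSpatialRefinement L k E) : WeaklyEquivalent D E := by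
  obtain ⟨BD⟩ := hD
  obtain ⟨BE⟩ := hE
  have hφD := BD.pathCoherent (hL := hL)
  have hφE := BE.pathCoherent (hL := hL)
  obtain ⟨Ψ, hΨ, hΨ₀, hΨ₁, hcr⟩ := exists_coherent_join hC hnk (boxCat_extends hL k)
    (CategoryTheory.Prod.snd (Fin 2) C ⋙ 𝟭 C)
    (hφD.coherent.comap (CategoryTheory.Prod.snd (Fin 2) C))
    (hφE.coherent.comap (CategoryTheory.Prod.snd (Fin 2) C))
  obtain ⟨D', hD'⟩ := HCDiagram.exists_of_eq (joinObj_self (L.wedges k)) hΨ.pathCoherent.diagram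
  have system_eq : ∀ {F : HCDiagram C (L.wedges k)} (B : BoxFamilies L k F) (i : Fin 2) {x y : C}
      (p : Quiver.Path x y) (t : ℕ → I), onWPaths (P := 𝟭 C) (B.system hL) (WPath.map
        (o := (CategoryTheory.Prod.snd (Fin 2) C).obj)
        (fun _ _ f => (CategoryTheory.Prod.snd (Fin 2) C).map f)
        ((WPath.ofPath ((Prod.sectR i C).toPrefunctor.mapPath p)).setWeights t)) =
          B.system hL p (cut t) := by
    intro F B i x y p t
    rw [WPath.map_setWeights, WPath.map_snd_ofPath_mapPath]
    refine (onWPaths_setWeights (P := 𝟭 C) (B.system hL) (WPath.ofPath p) t).trans ?_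
    exact apply_cut_congr (P := 𝟭 C) (φ := B.system hL) (WPath.toPath_ofPath p) fun _ _ => rfl
  -- The projection to `C` sends the crossing to an identity morphism, where the prescribed
  -- configuration consists of full cubes.
  have hone : ∀ x : C, onPaths Ψ (crossing x).toPath (fun _ => 0) = (boxCat hL k).one x := by
    intro x
    refine (hcr x x (crossing x) _).trans ?_
    exact (hφD.coherent.id_first _ WPath.nil).trans (hφD.coherent.nil x)
  refine ⟨⟨D', fun {x y} p t a => ?_, fun {x y} p t a => ?_⟩, fun x => ?_⟩
  · refine (eq_of_heq (hD' _ _ _ _ HEq.rfl)).trans ?_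
    rw [BD.map_eq_act (hL := hL)]
    exact congrArg (fun A : BoxArr L k x y => A.act a) ((hΨ.onPaths_cut _ t).trans
      ((hΨ₀ x y _).trans (system_eq BD 0 p t)))
  · refine (eq_of_heq (hD' _ _ _ _ HEq.rfl)).trans ?_
    rw [BE.map_eq_act (hL := hL)]
    exact congrArg (fun A : BoxArr L k x y => A.act a) ((hΨ.onPaths_cut _ t).trans
      ((hΨ₁ x y _).trans (system_eq BE 1 p t)))
  · refine GMap.isWeakEquiv_of_toFun_eq _ fun a => ?_
    refine (eq_of_heq (hD' _ _ _ _ HEq.rfl)).trans ?_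
    change BoxArr.act (onPaths Ψ (crossing x).toPath (fun _ => 0)) a = a
    rw [hone]
    exact BoxArr.act_one hL a

end

end LittleBoxes

namespace LittleBoxes

noncomputable section

variable {C : Type u} [Category.{v} C] {G : Type} [Group G] {L : Labels.{w} G C} {k : ℕ}

/-! ### Suspensions -/

namespace Box

/-- The box `B × [0,1]`. -/
def prolong (B : Box k) : Box (k + 1) where
  lo := Fin.snoc (α := fun _ => ℝ) B.lo 0
  hi := Fin.snoc (α := fun _ => ℝ) B.hi 1
  lo_nonneg := Fin.lastCases (by simp) fun i => by simpa using B.lo_nonneg i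
  lo_lt_hi := Fin.lastCases (by simp) fun i => by simpa using B.lo_lt_hi i
  hi_le_one := Fin.lastCases (by simp) fun i => by simpa using B.hi_le_one i

@[simp] theorem prolong_lo_castSucc (B : Box k) (i : Fin k) : B.prolong.lo i.castSucc = B.lo i :=
  Fin.snoc_castSucc (α := fun _ => ℝ) 0 B.lo i

@[simp] theorem prolong_hi_castSucc (B : Box k) (i : Fin k) : B.prolong.hi i.castSucc = B.hi i :=
  Fin.snoc_castSucc (α := fun _ => ℝ) 1 B.hi i

@[simp] theorem prolong_lo_last (B : Box k) : B.prolong.lo (Fin.last k) = 0 :=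
  Fin.snoc_last (α := fun _ => ℝ) 0 B.lo

@[simp] theorem prolong_hi_last (B : Box k) : B.prolong.hi (Fin.last k) = 1 :=
  Fin.snoc_last (α := fun _ => ℝ) 1 B.hi

theorem prolong_full : (full k).prolong = full (k + 1) := by
  ext i <;> refine Fin.lastCases ?_ (fun i => ?_) i <;> simp [full]

theorem prolong_sub (A B : Box k) : (A.sub B).prolong = A.prolong.sub B.prolong := by
  ext i <;> refine Fin.lastCases ?_ (fun i => ?_) i <;> simp [sub]

/-- For `k > 0` the new last coordinate is not the first one. For `k = 0` it would be the one that
is reflected, which is why the sign must be `+1`. -/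
theorem prolong_reflect {ε : ℤˣ} (hε : k = 0 → ε = 1) (B : Box k) :
    (reflect ε B).prolong = reflect ε B.prolong := by
  have h : ¬ (ε = -1 ∧ k = 0) := fun h => absurd ((hε h.2).symm.trans h.1) (by decide)
  ext i <;> refine Fin.lastCases ?_ (fun i => ?_) i <;>
    simp [reflect, h, -Fin.castSucc_eq_zero_iff, -Fin.val_eq_zero_iff]

theorem reflectPoint_snoc {ε : ℤˣ} (hε : k = 0 → ε = 1) (c : Fin k → I) (r : I) :
    reflectPoint ε (Fin.snoc (α := fun _ => I) c r) =
      Fin.snoc (α := fun _ => I) (reflectPoint ε c) r := by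
  have h : ¬ (ε = -1 ∧ k = 0) := fun h => absurd ((hε h.2).symm.trans h.1) (by decide)
  ext i
  refine Fin.lastCases ?_ (fun i => ?_) i <;> simp [reflectPoint, h]

theorem rescale_prolong (B : Box k) (c : Fin k → I) (r : I) :
    B.prolong.rescale (Fin.snoc (α := fun _ => I) c r) =
      Fin.snoc (α := fun _ => I) (B.rescale c) r := by
  ext i
  refine Fin.lastCases ?_ (fun i => ?_) i <;> simp [rescale]

theorem mem_interior_prolong {B : Box k} {c : Fin (k + 1) → I} :
    c ∈ B.prolong.interior ↔ (fun i : Fin k => c i.castSucc) ∈ B.interior ∧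
      0 < c (Fin.last k) ∧ c (Fin.last k) < 1 := by
  constructor
  · intro h
    refine ⟨fun i => by simpa using h i.castSucc, ?_⟩
    have := h (Fin.last k)
    rw [prolong_lo_last, prolong_hi_last] at this
    exact this
  · rintro ⟨h1, h2⟩
    refine Fin.lastCases ?_ fun i => ?_
    · rw [prolong_lo_last, prolong_hi_last]
      exact h2
    · rw [prolong_lo_castSucc, prolong_hi_castSucc]
      exact h1 i

theorem continuous_prolong : Continuous (prolong : Box k → Box (k + 1)) := by
  have h := Box.continuous_iff.1 (continuous_id (X := Box k))
  refine Box.continuous_iff.2 ⟨continuous_pi ?_, continuous_pi ?_⟩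
  · refine Fin.lastCases ?_ fun i => ?_
    · simpa only [prolong_lo_last] using continuous_const
    · simp only [prolong_lo_castSucc]
      exact (continuous_apply i).comp h.1
  · refine Fin.lastCases ?_ fun i => ?_
    · simpa only [prolong_hi_last] using continuous_const
    · simp only [prolong_hi_castSucc]
      exact (continuous_apply i).comp h.2

end Box

namespace BoxArr

variable {x y z : C}

/-- The box arrow with all boxes multiplied by `[0,1]`. -/
def prolong (A : BoxArr L k x y) : BoxArr L (k + 1) x y :=
  ⟨A.1, ⟨fun a => (A.2.1 a).prolong, fun a b hab h => Set.disjoint_left.2 fun _ hc hc' =>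
    Set.disjoint_left.1 (A.2.2.1 a b hab h) (Box.mem_interior_prolong.1 hc).1
      (Box.mem_interior_prolong.1 hc').1, fun g a => congrArg Box.prolong (A.2.2.2 g a)⟩⟩

theorem prolong_one (hL : L.Lawful) (x : C) :
    prolong ((boxCat hL k).one x) = (boxCat hL (k + 1)).one x :=
  Conf.mk_eq_mk.2 ⟨rfl, fun _ => Box.prolong_full.symm⟩

theorem prolong_comp (hL : L.Lawful) (A : BoxArr L k x y) (B : BoxArr L k y z)
    (hA : k = 0 → ∀ a, L.sgn A.1 a = 1) : prolong ((boxCat hL k).comp A B) =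
      (boxCat hL (k + 1)).comp (prolong A) (prolong B) := by
  refine Conf.mk_eq_mk.2 ⟨rfl, fun c => ?_⟩
  obtain ⟨a, b, h, rfl⟩ := hL.comp_surj A.1 B.1 c
  refine (Conf.compBox_comp hL (prolong A).2 (prolong B).2 a b h).trans ?_
  have h1 := congrArg Box.prolong (Conf.compBox_comp hL A.2 B.2 a b h)
  refine Eq.trans ?_ h1.symm
  rw [Box.prolong_sub, Box.prolong_reflect fun hk => hA hk a]
  rfl

theorem continuous_prolong : Continuous (prolong : BoxArr L k x y → BoxArr L (k + 1) x y) := by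
  refine continuous_sigma fun f => ?_
  refine (Topology.IsEmbedding.sigmaMk.continuous :
    Continuous (Sigma.mk f : _ → BoxArr L (k + 1) x y)).comp (Conf.continuous_iff.2 fun a => ?_)
  exact Box.continuous_prolong.comp (Conf.continuous_iff.1 continuous_id a)

theorem suspWedge_act (A : BoxArr L k x y) (hA : k = 0 → ∀ a, L.sgn A.1 a = 1)
    (z : L.wedges k x) (r : I) :
    suspWedge G k (L.obj y) (Collapse.mk _ (A.act z, r)) =
      A.prolong.act (suspWedge G k (L.obj x) (Collapse.mk _ (z, r))) := by
  revert z
  refine Wedge.induction rfl fun i c => ?_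
  change _ = A.prolong.act (Wedge.cell i (Fin.snoc (α := fun _ => I) c r))
  have hsnoc : (fun j : Fin k => Fin.snoc (α := fun _ => I) c r j.castSucc) = c :=
    funext fun j => Fin.snoc_castSucc (α := fun _ => I) _ _ _
  by_cases h : ∃ a, L.src A.1 a = i ∧ c ∈ (A.2.1 a).interior
  · obtain ⟨a, ha, hc⟩ := h
    rw [act_cell_of_mem A ha hc]
    change Wedge.cell _ (Fin.snoc (α := fun _ => I) _ r) = _
    -- At `r = 0` and `r = 1` the point is not interior to the prolonged box, but both sides are the
    -- base point.
    by_cases hr : 0 < r ∧ r < 1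
    · rw [act_cell_of_mem A.prolong (a := a) ha (Box.mem_interior_prolong.2 ⟨by rwa [hsnoc], by
        simpa using hr⟩)]
      have h1 : A.prolong.2.1 a = (A.2.1 a).prolong := rfl
      rw [h1, Box.rescale_prolong]
      exact congrArg (Wedge.cell _) (Box.reflectPoint_snoc (fun hk => hA hk a) _ _).symm
    · have hr' : r = 0 ∨ r = 1 := by
        by_contra hne
        rw [not_or] at hne
        exact hr ⟨unitInterval.pos_iff_ne_zero.2 hne.1, unitInterval.lt_one_iff_ne_one.2 hne.2⟩
      have hb : ∀ d : Fin k → I, Fin.snoc (α := fun _ => I) d r ∈ Cube.boundary (Fin (k + 1)) :=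
        fun d => ⟨Fin.last k, by simpa using hr'⟩
      rw [Wedge.cell_eq_pt _ (hb _), Wedge.cell_eq_pt _ (hb _)]
      rfl
  · rw [act_cell_of_not_mem A fun a ha hc => h ⟨a, ha, hc⟩, act_cell_of_not_mem A.prolong]
    · rfl
    · intro a ha hc
      have hc' := (Box.mem_interior_prolong.1 hc).1
      rw [hsnoc] at hc'
      exact h ⟨a, ha, hc'⟩

end BoxArr

/-! ### The homeomorphism between the suspended wedge and the wedge. -/

section SuspWedge

variable (G) (k) (X : Type w) [MulAction G X]

theorem continuous_suspWedge : Continuous (suspWedge G k X) := by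
  refine Collapse.isQuotientMap_mk.continuous_iff.2 ?_
  have h : Continuous fun p : I × Wedge k X =>
      (suspWedge G k X (Collapse.mk _ (p.2, p.1)) : Wedge (k + 1) X) := by
    refine Wedge.continuous_prod continuous_const fun x => (Wedge.continuous_cell x).comp ?_
    refine continuous_pi (Fin.lastCases ?_ fun i => ?_)
    · simpa using continuous_fst
    · simp only [Fin.snoc_castSucc]
      exact (continuous_apply i).comp continuous_snd
  exact h.comp continuous_swap

/-- The inverse of `suspWedge`: the last coordinate is the suspension coordinate. -/
def desuspWedge : wedge G (k + 1) X → (wedge G k X).susp :=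
  Wedge.lift (wedge G k X).susp.pt
    (fun x c => Collapse.mk _ (Wedge.cell x fun i => c i.castSucc, c (Fin.last k))) (by
      rintro x c ⟨i, hi⟩
      refine Collapse.mk_eq ?_ (Or.inl rfl)
      revert hi
      refine Fin.lastCases (fun hi => Or.inr hi) (fun i hi => Or.inl ?_) i
      exact Wedge.cell_eq_pt x ⟨i, hi⟩)

theorem continuous_desuspWedge : Continuous (desuspWedge G k X) := by
  -- The trivial parameter space `Unit` serves to apply `Wedge.continuous_prod`.
  have h : Continuous fun p : Unit × Wedge (k + 1) X => desuspWedge G k X p.2 := by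
    refine Wedge.continuous_prod continuous_const fun x => ?_
    refine Collapse.isQuotientMap_mk.continuous.comp (Continuous.prodMk ?_ ?_)
    · exact (Wedge.continuous_cell x).comp
        (continuous_pi fun i => (continuous_apply i.castSucc).comp continuous_snd)
    · exact (continuous_apply (Fin.last k)).comp continuous_snd
  exact h.comp (continuous_const.prodMk continuous_id : Continuous fun z => ((), z))

theorem isHomeomorph_suspWedge : IsHomeomorph (suspWedge G k X) := by
  refine isHomeomorph_iff_exists_inverse.2 ⟨continuous_suspWedge G k X, desuspWedge G k X, ?_, ?_,
    continuous_desuspWedge G k X⟩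
  · refine Collapse.ind ?_
    rintro ⟨z, r⟩
    revert z
    refine Wedge.induction ?_ fun x c => ?_
    · exact Collapse.mk_eq (Or.inl rfl) (Or.inl rfl)
    · change Collapse.mk _ (Wedge.cell x _, _) = _
      simp only [Fin.snoc_castSucc, Fin.snoc_last]
      rfl
  · refine Wedge.induction rfl fun x c => ?_
    exact congrArg (Wedge.cell x) (Fin.snoc_init_self (α := fun _ => I) c)

theorem suspWedge_smul (g : G) (a : (wedge G k X).susp) :
    suspWedge G k X (g • a) = g • suspWedge G k X a := by
  revert a
  refine Collapse.ind ?_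
  rintro ⟨z, r⟩
  revert z
  exact Wedge.induction rfl fun x c => rfl

end SuspWedge

/-- Multiplying all boxes by `[0,1]` is continuous and respects identities and composition, so it
preserves every compatibility condition. For composition in dimension `0` the absence of signs `-1`
is needed. -/
theorem suspIsSpatialRefinement (hL : L.Lawful) {D : HCDiagram C (L.wedges k)}
    (hD : IsSpatialRefinement L k D) : SuspIsSpatialRefinement L k D := by
  obtain ⟨B⟩ := hD
  have hφ := B.pathCoherent (hL := hL)
  have hφ' : PathCoherent (𝟭 C) (boxCat hL (k + 1)) fun x y p t => (B.system hL p t).prolong :=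
    { proj := fun x y p t => rfl
      cont := fun x y p => BoxArr.continuous_prolong.comp (hφ.cont p)
      nil := fun x t => (congrArg BoxArr.prolong (hφ.nil x t)).trans (BoxArr.prolong_one hL x)
      id_first := fun x y r t => congrArg BoxArr.prolong (hφ.id_first r t)
      id_mid := fun x y z q r hq hr t => congrArg BoxArr.prolong (hφ.id_mid q r hq hr t)
      id_last := fun x y q t => congrArg BoxArr.prolong (hφ.id_last q t)
      zero := fun x y z q r hq hr t ht => (congrArg BoxArr.prolong (hφ.zero q r hq hr t ht)).trans
        (BoxArr.prolong_comp hL _ _ fun hk a => B.sgn_eq_one hk _ a)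
      one := fun x y z y' q f g z' r t ht => congrArg BoxArr.prolong (hφ.one q f g r t ht) }
  refine ⟨_, hφ'.isSpatialRefinement fun h => absurd h k.succ_ne_zero,
    fun x => isHomeomorph_suspWedge G k _, fun x => rfl, fun x => suspWedge_smul G k _,
    fun {x y} p t => Collapse.ind ?_⟩
  rintro ⟨z, r⟩
  refine Eq.trans ?_ (BoxArr.suspWedge_act (B.system hL p t) (fun hk a => B.sgn_eq_one hk _ a) z r)
  rw [← B.map_eq_act]
  rfl

end

end LittleBoxes

namespace LittleBoxes

noncomputable section

variable {C : Type u} [Category.{v} C]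

/-! ### The labels of functors to the Burnside categories -/

section Ordinary

variable (F : StrictlyUnitaryPseudofunctor (LocallyDiscrete C) Burn.{w})

/-- In a locally discrete bicategory an equality of morphisms is a 2-morphism. Transport of labels
is thus the value of `F` on it, and the coherence axioms of `F` turn into equations between labels.
-/
theorem ordinaryLabels_cast {x y : C} {f g : x ⟶ y} (h : f = g) (η : f.toLoc ⟶ g.toLoc)
    (a : (ordinaryLabels F).lab f) :
    (ordinaryLabels F).cast h a = Corr.Hom.equiv (F.map₂ η) a := by
  subst h
  obtain rfl : η = 𝟙 _ := Subsingleton.elim _ _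
  rw [F.map₂_id]
  rfl

theorem Corr.bijective_src_of_eq_one {X : Type w} {hX : Finite X} {A : Corr X X}
    (h : A = Corr.one X hX) : Function.Bijective A.src := by
  subst h
  exact Function.bijective_id

theorem Corr.tgt_eq_src_of_eq_one {X : Type w} {hX : Finite X} {A : Corr X X}
    (h : A = Corr.one X hX) (a : A.carrier) : A.tgt a = A.src a := by
  subst h
  rfl

theorem ordinaryLabels_lawful : (ordinaryLabels F).Lawful where
  finite f := (F.map f.toLoc).finite
  one_smul _ _ := rfl
  mul_smul _ _ _ _ := rfl
  free _ _ _ _ := rfl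
  src_smul _ _ _ := rfl
  tgt_smul _ _ _ := rfl
  sgn_smul _ _ _ := rfl
  src_comp f g a b h := Corr.Hom.src_eq (F.mapComp f.toLoc g.toLoc).inv ⟨(b, a), h⟩
  tgt_comp f g a b h := Corr.Hom.tgt_eq (F.mapComp f.toLoc g.toLoc).inv ⟨(b, a), h⟩
  sgn_comp _ _ _ _ _ := rfl
  smul_comp _ _ _ _ _ _ _ := rfl
  comp_inj f g a a' b b' h h' e := by
    have e' := congrArg Subtype.val
      ((Corr.Hom.equiv (F.mapComp f.toLoc g.toLoc).inv).injective e)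
    exact ⟨congrArg Prod.snd e', congrArg Prod.fst e'⟩
  comp_surj f g c := by
    obtain ⟨⟨⟨b, a⟩, h⟩, e⟩ := (Corr.Hom.equiv (F.mapComp f.toLoc g.toLoc).inv).surjective c
    exact ⟨a, b, h, e⟩
  assoc f g h a b c h₁ h₂ h₃ h₄ := by
    refine (ordinaryLabels_cast F (Category.assoc f g h)
      (Bicategory.associator f.toLoc g.toLoc h.toLoc).hom _).trans ?_
    have e := F.mapComp_assoc_right_inv f.toLoc g.toLoc h.toLoc
    have e' := congrArg (fun θ => Corr.Hom.equiv θ) e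
    exact (DFunLike.congr_fun e' ⟨(⟨(c, b), h₃⟩, a), h₁⟩).symm
  -- Strict unitality makes `F` of an identity equal to the identity correspondence, not only
  -- isomorphic to it.
  src_id x := Corr.bijective_src_of_eq_one (F.map_id ⟨x⟩)
  tgt_id x := Corr.tgt_eq_src_of_eq_one (F.map_id ⟨x⟩)
  sgn_id _ _ := rfl
  id_comp f i a h := by
    refine (ordinaryLabels_cast F (Category.id_comp f)
      (Bicategory.leftUnitor f.toLoc).hom _).trans ?_
    -- At the pair `(a, i)` the right-hand side discards the label `i` of the identity and returns
    -- `a`, so the value of the unit constraint does not matter.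
    have e : (F.mapComp (𝟙 _) f.toLoc).inv ≫ F.map₂ (Bicategory.leftUnitor f.toLoc).hom =
        Bicategory.whiskerRight (F.mapId _).hom (F.map f.toLoc) ≫
          (Bicategory.leftUnitor (F.map f.toLoc)).hom := by
      rw [F.map₂_left_unitor, Iso.inv_hom_id_assoc]
    exact DFunLike.congr_fun (congrArg (fun θ => Corr.Hom.equiv θ) e) ⟨(a, i), h⟩
  comp_id f a i h := by
    refine (ordinaryLabels_cast F (Category.comp_id f)
      (Bicategory.rightUnitor f.toLoc).hom _).trans ?_
    have e : (F.mapComp f.toLoc (𝟙 _)).inv ≫ F.map₂ (Bicategory.rightUnitor f.toLoc).hom =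
        Bicategory.whiskerLeft (F.map f.toLoc) (F.mapId _).hom ≫
          (Bicategory.rightUnitor (F.map f.toLoc)).hom := by
      rw [F.map₂_right_unitor, Iso.inv_hom_id_assoc]
    exact DFunLike.congr_fun (congrArg (fun θ => Corr.Hom.equiv θ) e) ⟨(i, a), h⟩

end Ordinary

section Signed

/-- Forgetting the signs. -/
def forgetSigns : StrictlyUnitaryPseudofunctor SignedBurn.{w} Burn.{w} :=
  .mk' {
    obj := fun X => ⟨X.carrier, X.finite⟩
    map := fun A => A.toCorr
    map_id := fun _ => rfl
    map₂ := fun η => SignedCorr.Hom.toHom η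
    map₂_id := fun _ => rfl
    map₂_comp := fun _ _ => rfl
    mapComp := fun {X _ Z} A B => Burn.mkIso (X := ⟨X.carrier, X.finite⟩)
      (Y := ⟨Z.carrier, Z.finite⟩) (Corr.Hom.refl (A.toCorr.comp B.toCorr))
    map₂_whisker_left := fun _ _ _ _ => rfl
    map₂_whisker_right := fun _ _ => rfl
    map₂_left_unitor := fun _ => rfl
    map₂_right_unitor := fun _ => rfl
    map₂_associator := fun _ _ _ => rfl }

variable (F : StrictlyUnitaryPseudofunctor (LocallyDiscrete C) SignedBurn.{w})

theorem SignedCorr.sgn_eq_one_of_eq_one {X : Type w} {hX : Finite X} {A : SignedCorr X X}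
    (h : A = SignedCorr.one X hX) (a : A.carrier) : A.sgn a = 1 := by
  subst h
  rfl

/-- The laws that do not involve signs are inherited from the composite with `forgetSigns`. -/
theorem signedLabels_lawful : (signedLabels F).Lawful :=
  have hF := ordinaryLabels_lawful (F.comp forgetSigns)
  { finite := hF.finite
    one_smul := fun _ _ => rfl
    mul_smul := fun _ _ _ _ => rfl
    free := fun _ _ _ _ => rfl
    src_smul := fun _ _ _ => rfl
    tgt_smul := fun _ _ _ => rfl
    sgn_smul := fun _ _ _ => rfl
    src_comp := hF.src_comp
    tgt_comp := hF.tgt_comp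
    sgn_comp := fun f g a b h => SignedCorr.Hom.sgn_eq (F.mapComp f.toLoc g.toLoc).inv ⟨(b, a), h⟩
    smul_comp := fun _ _ _ _ _ _ _ => rfl
    comp_inj := hF.comp_inj
    comp_surj := hF.comp_surj
    assoc := hF.assoc
    src_id := hF.src_id
    tgt_id := hF.tgt_id
    sgn_id := fun x => SignedCorr.sgn_eq_one_of_eq_one (F.map_id ⟨x⟩)
    id_comp := hF.id_comp
    comp_id := hF.comp_id }

end Signed

section Equivariant

/-- Forgetting the action of `ℤ/2`. -/
def forgetAction : StrictlyUnitaryPseudofunctor EquivBurn.{w} Burn.{w} :=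
  .mk' {
    obj := fun X => ⟨X.carrier, X.finite⟩
    map := fun A => A.toCorr
    map_id := fun _ => rfl
    map₂ := fun η => EquivCorr.Hom.toHom η
    map₂_id := fun _ => rfl
    map₂_comp := fun _ _ => rfl
    mapComp := fun {X _ Z} A B => Burn.mkIso (X := ⟨X.carrier, X.finite⟩)
      (Y := ⟨Z.carrier, Z.finite⟩) (Corr.Hom.refl (A.toCorr.comp B.toCorr))
    map₂_whisker_left := fun _ _ _ _ => rfl
    map₂_whisker_right := fun _ _ => rfl
    map₂_left_unitor := fun _ => rfl
    map₂_right_unitor := fun _ => rfl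
    map₂_associator := fun _ _ _ => rfl }

variable (F : StrictlyUnitaryPseudofunctor (LocallyDiscrete C) EquivBurn.{w})

/-- The laws that do not involve the action are inherited from the composite with `forgetAction`.
Freeness has to be checked only for `ξ = -1`, the sole non-trivial element. -/
theorem equivariantLabels_lawful : (equivariantLabels F).Lawful :=
  have hF := ordinaryLabels_lawful (F.comp forgetAction)
  { finite := hF.finite
    one_smul := fun f => (F.map f.toLoc).action.one_smul
    mul_smul := fun f => (F.map f.toLoc).action.mul_smul
    free := fun x g a h => by
      rcases Int.units_eq_one_or g with rfl | rfl
      · rfl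
      · exact absurd h ((F.obj ⟨x⟩).free a)
    src_smul := fun f => (F.map f.toLoc).src_smul
    tgt_smul := fun f => (F.map f.toLoc).tgt_smul
    sgn_smul := fun _ _ _ => rfl
    src_comp := hF.src_comp
    tgt_comp := hF.tgt_comp
    sgn_comp := fun _ _ _ _ _ => rfl
    smul_comp := fun f g γ a b h _ =>
      (EquivCorr.Hom.smul_eq (F.mapComp f.toLoc g.toLoc).inv γ ⟨(b, a), h⟩).symm
    comp_inj := hF.comp_inj
    comp_surj := hF.comp_surj
    assoc := hF.assoc
    src_id := hF.src_id
    tgt_id := hF.tgt_id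
    sgn_id := fun _ _ => rfl
    id_comp := hF.id_comp
    comp_id := hF.comp_id }

end Equivariant

end

end LittleBoxes

theorem mainTheorem9 {C : Type u} [Category.{v} C] (n : ℕ) (hC : ChainsAtMost C n) :
    (∀ F : StrictlyUnitaryPseudofunctor (LocallyDiscrete C) Burn.{w},
      (∀ k : ℕ, n ≤ k → ∃ D : HCDiagram C ((ordinaryLabels F).wedges k),
        IsSpatialRefinement (ordinaryLabels F) k D) ∧
      (∀ k : ℕ, n + 1 ≤ k → ∀ D E : HCDiagram C ((ordinaryLabels F).wedges k),
        IsSpatialRefinement (ordinaryLabels F) k D → IsSpatialRefinement (ordinaryLabels F) k E →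
          WeaklyEquivalent D E) ∧
      (∀ (k : ℕ) (D : HCDiagram C ((ordinaryLabels F).wedges k)),
        IsSpatialRefinement (ordinaryLabels F) k D → SuspIsSpatialRefinement (ordinaryLabels F) k D)) ∧
    (∀ F : StrictlyUnitaryPseudofunctor (LocallyDiscrete C) SignedBurn.{w},
      (∀ k : ℕ, n ≤ k → ∃ D : HCDiagram C ((signedLabels F).wedges k),
        IsSpatialRefinement (signedLabels F) k D) ∧
      (∀ k : ℕ, n + 1 ≤ k → ∀ D E : HCDiagram C ((signedLabels F).wedges k),
        IsSpatialRefinement (signedLabels F) k D → IsSpatialRefinement (signedLabels F) k E →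
          WeaklyEquivalent D E) ∧
      (∀ (k : ℕ) (D : HCDiagram C ((signedLabels F).wedges k)),
        IsSpatialRefinement (signedLabels F) k D → SuspIsSpatialRefinement (signedLabels F) k D)) ∧
    (∀ F : StrictlyUnitaryPseudofunctor (LocallyDiscrete C) EquivBurn.{w},
      (∀ k : ℕ, n ≤ k → ∃ D : HCDiagram C ((equivariantLabels F).wedges k),
        IsSpatialRefinement (equivariantLabels F) k D) ∧
      (∀ k : ℕ, n + 1 ≤ k → ∀ D E : HCDiagram C ((equivariantLabels F).wedges k),
        IsSpatialRefinement (equivariantLabels F) k D → IsSpatialRefinement (equivariantLabels F) k E →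
          WeaklyEquivalent D E) ∧
      (∀ (k : ℕ) (D : HCDiagram C ((equivariantLabels F).wedges k)),
        IsSpatialRefinement (equivariantLabels F) k D → SuspIsSpatialRefinement (equivariantLabels F) k D)) := by
  exact ⟨fun F => ⟨fun _ h => exists_isSpatialRefinement (ordinaryLabels_lawful F) hC h,
      fun _ h _ _ => weaklyEquivalent (ordinaryLabels_lawful F) hC h,
      fun _ _ => suspIsSpatialRefinement (ordinaryLabels_lawful F)⟩,
    fun F => ⟨fun _ h => exists_isSpatialRefinement (signedLabels_lawful F) hC h,
      fun _ h _ _ => weaklyEquivalent (signedLabels_lawful F) hC h,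
      fun _ _ => suspIsSpatialRefinement (signedLabels_lawful F)⟩,
    fun F => ⟨fun _ h => exists_isSpatialRefinement (equivariantLabels_lawful F) hC h,
      fun _ h _ _ => weaklyEquivalent (equivariantLabels_lawful F) hC h,
      fun _ _ => suspIsSpatialRefinement (equivariantLabels_lawful F)⟩⟩
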